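/- Let $V$ be a finite set of points of the sphere at infinity of hyperbolic 3-space $\mathbf H^3$, not contained in the boundary of a single hyperbolic plane, and let $P$ be the convex ideal polyhedron with ideal vertex set $V$, i.e. the hyperbolic convex hull of $V$. For $v\in V$, the link of $v$ is the limit, as $r\to 0$, of the sections of $P$ by the Euclidean spheres of radius $r$ centred at $v$ in the conformal (Poincaré) ball model, rescaled to radius one, and the dual polygon $v^*\subset\mathbf S^2$ is the spherical polar of the link: the set of unit vectors having non-positive inner product with every vector of the link. For a face $F$ of $P$ at $v$ let $c_F^v$ be the outward unit normal of $F$ at $v$ in this model (equivalently, the outward unit normal of the side cut out by $F$ on the Euclidean polygon in which $P$ meets a small horosphere at $v$). If faces $F,G$ meet along an edge $e$ with endpoints $v,w$, the side of $v^*$ dual to $e$ is the geodesic arc from $c_F^v$ to $c_G^v$. The Gaussian image $P^*$ is the metric space obtained from the disjoint union of the $v^*$, $v\in V$ (with their spherical metrics), by identifying isometrically, for every edge $e=F\cap G$ of $P$ with endpoints $v,w$, the sides of $v^*$ and $w^*$ dual to $e$, so that $c_F^v$ is identified with $c_F^w$ and $c_G^v$ with $c_G^w$ (with the quotient metric, points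 at quotient distance zero being identified). **Theorem 4.5.** (a) Every $v^*$ is a closed hemisphere of the unit sphere $\mathbf S^2$. (b) For every edge $e$ of $P$ and every endpoint $v$ of $e$, the side dual to $e$ is contained in $v^*$, its length is the exterior dihedral angle of $P$ at $e$ (that is, $\pi$ minus the dihedral angle), and this number lies in $(0,\pi)$. (c) $P^*$ is ideally admissible, with respect to the cell decomposition whose 2-cells, edges and vertices are respectively the images in $P^*$ of the polygons $v^*$ ($v\in V$), of the sides dual to the edges of $P$, and of the points $c_F^v$ ($F$ a face of $P$). That is: 1. $P^*$ is a metric space (all distances are finite) homeomorphic to $\mathbf S^2$. 2. These cells form a CW structure of dimension at most $2$ on $P^*$ that is combinatorially equivalent to a convex polyhedron: the poset of its closed cells is isomorphic to the poset of vertices, edges and faces of some 3-dimensional compact convex polyhedron in Euclidean space. 3. Each closed 2-cell is isometric to a closed hemisphere of $\mathbf S^2$ (with the spherical metric), its boundary corresponding to the equator. 4. Any two different closed 2-cells are disjoint, or intersect in a single vertex, or intersect in an edge; in the last case this edge is contained in the boundaries of both 2-cells and is a geodesic arc whose length $l$ satisfies $0<l<\pi$. 5. Every simple cycle in the 1-skeleton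 has length strictly greater than $2\pi$ unless it is the boundary of a 2-cell. -/

import Mathlib

open Set Filter Topology MeasureTheory InnerProductGeometry
open scoped ENNReal RealInnerProductSpace

noncomputable section

/-- Euclidean 3-space. Its open unit ball carries the ball models of hyperbolic 3-space and its
unit sphere is both the sphere at infinity and the standard sphere of curvature one. -/
abbrev E3 : Type := EuclideanSpace ℝ (Fin 3)

/-! ### Ideally admissible metric spaces -/

/-- `F` is a proper face (vertex, edge or facet) of the convex polyhedron `K`. -/
def IsProperFace (K F : Set E3) : Prop :=
  IsExposed ℝ K F ∧ F.Nonempty ∧ F ≠ K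

/-- The geodesic arc of the unit sphere from `a` to `b` (for unit vectors `a ≠ -b`). -/
def sphericalArc (a b : E3) : Set E3 :=
  {x | ‖x‖ = 1 ∧ angle a x + angle x b = angle a b}

/-- The closed hemisphere of the unit sphere centred at the unit vector `a`. -/
def closedHemisphere (a : E3) : Set E3 := {u | ‖u‖ = 1 ∧ 0 ≤ ⟪a, u⟫}

/-- The boundary great circle of the closed hemisphere centred at `a`. -/
def equator (a : E3) : Set E3 := {u | ‖u‖ = 1 ∧ ⟪a, u⟫ = 0}

/-- The set `c`, with boundary `b`, is isometric to a closed hemisphere of the unit sphere (with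
its spherical, i.e. angular, metric) by an isometry that takes the equator onto `b`. -/
def IsHemisphereWithBoundary {Q : Type*} [EMetricSpace Q] (c b : Set Q) : Prop :=
  ∃ (a : E3) (φ : E3 → Q), ‖a‖ = 1 ∧
    (∀ x ∈ closedHemisphere a, ∀ y ∈ closedHemisphere a,
      edist (φ x) (φ y) = ENNReal.ofReal (angle x y)) ∧
    φ '' closedHemisphere a = c ∧ φ '' equator a = b

/-- The set `s` is a geodesic arc of length `l`, i.e. isometric to the interval `[0, l]`. -/
def IsGeodesicArc {Q : Type*} [EMetricSpace Q] (s : Set Q) (l : ℝ) : Prop :=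
  ∃ γ : ℝ → Q, (∀ t ∈ Icc 0 l, ∀ u ∈ Icc 0 l,
    edist (γ t) (γ u) = ENNReal.ofReal |t - u|) ∧ γ '' Icc 0 l = s

/-- The length of an arc: its one-dimensional Hausdorff measure. -/
def arcLength {Q : Type*} [EMetricSpace Q] (s : Set Q) : ℝ≥0∞ :=
  letI : MeasurableSpace Q := borel Q
  haveI : BorelSpace Q := ⟨rfl⟩
  Measure.hausdorffMeasure 1 s

section IdeallyAdmissible

open Topology.CWComplex

universe u

/-- The closed cells of a cell complex, ordered by inclusion. -/
def ClosedCells (Q : Type u) [TopologicalSpace Q] [CWComplex (univ : Set Q)] : Type u :=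
  {c : Set Q // ∃ (n : ℕ) (i : cell (univ : Set Q) n), c = closedCell n i}

instance (Q : Type u) [TopologicalSpace Q] [CWComplex (univ : Set Q)] :
    PartialOrder (ClosedCells Q) :=
  inferInstanceAs (PartialOrder (Subtype _))

/-- A simple cycle in the 1-skeleton: a cyclic sequence of distinct vertices `x i` and distinct
edges `e i`, the endpoints of `e i` being `x i` and `x (i + 1)` (indices modulo `k + 2`). -/
structure IsSimpleCycle {Q : Type u} [TopologicalSpace Q] [CWComplex (univ : Set Q)] {k : ℕ}
    (x : Fin (k + 2) → cell (univ : Set Q) 0) (e : Fin (k + 2) → cell (univ : Set Q) 1) :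
    Prop where
  vertices_injective : Function.Injective x
  edges_injective : Function.Injective e
  endpoints : ∀ i, cellFrontier 1 (e i) = closedCell 0 (x i) ∪ closedCell 0 (x (i + 1))

/-- `Q` is ideally admissible, as witnessed by the given cell structure. An extended metric space
`Q` is *ideally admissible* if it has a cell structure (a CW structure on the whole space) with
this property. -/
structure IsIdeallyAdmissible (Q : Type u) [EMetricSpace Q] [CWComplex (univ : Set Q)] :
    Prop where
  /-- `Q` is a metric space: all distances are finite. -/
  edist_ne_top : ∀ x y : Q, edist x y ≠ ⊤
  /-- `Q` is homeomorphic to the 2-sphere. -/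
  homeomorph_sphere : Nonempty (Q ≃ₜ Metric.sphere (0 : E3) 1)
  /-- The cell complex has dimension at most two. -/
  dim_le_two : ∀ n : ℕ, 3 ≤ n → IsEmpty (cell (univ : Set Q) n)
  /-- The cell complex is combinatorially equivalent to a (3-dimensional, bounded) convex
  polyhedron: the poset of closed cells is isomorphic to the poset of proper faces. -/
  combinatorial : ∃ S : Finset E3, affineSpan ℝ (S : Set E3) = ⊤ ∧
    Nonempty (ClosedCells Q ≃o {F : Set E3 // IsProperFace (convexHull ℝ (S : Set E3)) F})
  /-- Every 2-cell is isometric to a hemisphere. -/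
  hemisphere : ∀ i : cell (univ : Set Q) 2,
    IsHemisphereWithBoundary (closedCell 2 i) (cellFrontier 2 i)
  /-- Two different 2-cells are disjoint, or they meet in a single vertex only, or they are
  identified along an edge; that edge is then an arc of the two equators, of length strictly
  between `0` and `π`. -/
  gluing : ∀ i j : cell (univ : Set Q) 2, i ≠ j →
    closedCell 2 i ∩ closedCell 2 j = (∅ : Set Q) ∨
    (∃ x : cell (univ : Set Q) 0, closedCell 2 i ∩ closedCell 2 j = closedCell 0 x) ∨
    ∃ e : cell (univ : Set Q) 1, closedCell 2 i ∩ closedCell 2 j = closedCell 1 e ∧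
      closedCell 1 e ⊆ cellFrontier 2 i ∩ cellFrontier 2 j ∧
      ∃ l : ℝ, 0 < l ∧ l < Real.pi ∧ IsGeodesicArc (closedCell 1 e) l
  /-- A simple cycle of the 1-skeleton that is not the boundary of a 2-cell is longer than `2π`. -/
  cycle : ∀ (k : ℕ) (x : Fin (k + 2) → cell (univ : Set Q) 0)
    (e : Fin (k + 2) → cell (univ : Set Q) 1), IsSimpleCycle x e →
    (¬ ∃ i : cell (univ : Set Q) 2, cellFrontier 2 i = ⋃ m, closedCell 1 (e m)) →
    ENNReal.ofReal (2 * Real.pi) < ∑ m, arcLength (closedCell 1 (e m))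

end IdeallyAdmissible

/-! ### Convex ideal polyhedra -/

/-- A convex ideal polyhedron in hyperbolic 3-space, given by its finite set of ideal vertices on
the sphere at infinity; the vertices do not all lie in one plane. The polyhedron itself is the
hyperbolic convex hull of the vertices, which in the projective model is the Euclidean one. -/
structure IdealPolyhedron where
  vertices : Finset E3
  norm_vertices : ∀ v ∈ vertices, ‖v‖ = 1
  nondegenerate : affineSpan ℝ (vertices : Set E3) = ⊤

namespace IdealPolyhedron

variable (P : IdealPolyhedron)

/-- A face of `P`. In the projective model it lies in the plane `⟪normal, x⟫ = level`, and `P`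
lies in the half-space `⟪normal, x⟫ ≤ level`. The vertices in that plane have to span it. -/
structure Face where
  normal : E3
  level : ℝ
  norm_normal : ‖normal‖ = 1
  supporting : ∀ v ∈ P.vertices, ⟪normal, v⟫ ≤ level
  spanning : Module.finrank ℝ (vectorSpan ℝ {v | v ∈ P.vertices ∧ ⟪normal, v⟫ = level}) = 2

variable {P}

/-- The points of `F` among the vertices of `P`. -/
def Face.Contains (F : P.Face) (v : P.vertices) : Prop := ⟪F.normal, (v : E3)⟫ = F.level

/-- The faces `F` and `G` are the two faces at an edge of `P`, and `v` is an endpoint of it. -/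
def IsEdgeAt (F G : P.Face) (v : P.vertices) : Prop :=
  F ≠ G ∧ F.Contains v ∧ G.Contains v ∧ ∃ w, w ≠ v ∧ F.Contains w ∧ G.Contains w

/-- The faces `F` and `G` meet along an edge of `P`. -/
def IsEdge (F G : P.Face) : Prop := ∃ v, IsEdgeAt F G v

/-- The exterior dihedral angle (`π` minus the dihedral angle) of `P` at the edge between `F` and
`G`. In Minkowski space the outward unit normal of the hyperbolic plane `⟪n, x⟫ = h` is the
spacelike vector `(h, n) / √(1 - h²)`, and the cosine of the exterior dihedral angle is the
Lorentzian product of the two outward unit normals. -/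
def exteriorDihedralAngle (F G : P.Face) : ℝ :=
  Real.arccos ((⟪F.normal, G.normal⟫ - F.level * G.level) /
    (√(1 - F.level ^ 2) * √(1 - G.level ^ 2)))

/-! ### Links of ideal vertices and their spherical duals -/

variable (P)

/-- The polyhedron in the conformal (Poincaré) ball model of hyperbolic space; the map
`y ↦ 2 y / (1 + |y|²)` is the change of coordinates to the projective model. -/
def ballModel : Set E3 :=
  {y | ‖y‖ < 1 ∧ (2 / (1 + ‖y‖ ^ 2)) • y ∈ convexHull ℝ (P.vertices : Set E3)}

/-- The link of the ideal vertex `v`: in the conformal ball model, the limit, as the radius tends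
to zero, of the sections of `P` by spheres centred at `v`, rescaled to radius one. -/
def link (v : P.vertices) : Set E3 :=
  {u | MapClusterPt u (𝓝[P.ballModel] (v : E3))
    (fun x => ‖x - (v : E3)‖⁻¹ • (x - (v : E3)))}

/-- The spherical polygon dual to the vertex `v`: the spherical polar of the link of `v`. -/
def vertexDual (v : P.vertices) : Set E3 :=
  {u | ‖u‖ = 1 ∧ ∀ x ∈ P.link v, ⟪u, x⟫ ≤ 0}

variable {P}

/-- The outward unit normal of the face `F` at its ideal vertex `v`, in the conformal ball model
(where `F` lies in the sphere `|y|² h - 2 ⟪n, y⟫ + h = 0`, orthogonal to the sphere at infinity).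
It is orthogonal to `v`; it is also the outward unit normal of the side cut out by `F` on the
Euclidean polygon in which `P` meets a small horosphere at `v`. This is the vertex of
`P.vertexDual v` corresponding to `F`. -/
def Face.normalAt (F : P.Face) (v : P.vertices) : E3 :=
  ‖F.normal - F.level • (v : E3)‖⁻¹ • (F.normal - F.level • (v : E3))

/-- The side of `P.vertexDual v` corresponding to the edge between the faces `F` and `G`. -/
def dualSide (F G : P.Face) (v : P.vertices) : Set E3 :=
  sphericalArc (F.normalAt v) (G.normalAt v)

/-! ### The Gaussian image -/

variable (P)

/-- The disjoint union of the spherical polygons dual to the vertices of `P`. -/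
structure DualPieces where
  vertex : P.vertices
  point : E3
  mem : point ∈ P.vertexDual vertex

variable {P}

/-- The gluing: if `v` and `w` are the two endpoints of the edge between the faces `F` and `G`,
then the corresponding sides of the polygons dual to `v` and `w` are identified isometrically, the
end belonging to `F` with the end belonging to `F`. -/
def Glued (p q : P.DualPieces) : Prop :=
  p.vertex ≠ q.vertex ∧ ∃ F G : P.Face, IsEdgeAt F G p.vertex ∧ IsEdgeAt F G q.vertex ∧
    p.point ∈ dualSide F G p.vertex ∧ q.point ∈ dualSide F G q.vertex ∧
    angle (F.normalAt p.vertex) p.point = angle (F.normalAt q.vertex) q.point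

open Classical in
/-- The cost of one step of a chain: nothing between identified points, the spherical distance
between points of the same polygon; other steps are not allowed. -/
def stepCost (p q : P.DualPieces) : ℝ≥0∞ :=
  if Glued p q then 0
  else if p.vertex = q.vertex then ENNReal.ofReal (angle p.point q.point)
  else ⊤

lemma Glued.symm {p q : P.DualPieces} (h : Glued p q) : Glued q p := by
  obtain ⟨h1, F, G, h2, h3, h4, h5, h6⟩ := h
  exact ⟨h1.symm, F, G, h3, h2, h5, h4, h6.symm⟩

lemma stepCost_comm (p q : P.DualPieces) : stepCost p q = stepCost q p := by
  have h : Glued p q = Glued q p := propext ⟨Glued.symm, Glued.symm⟩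
  unfold stepCost
  rw [h, angle_comm p.point]
  by_cases hv : p.vertex = q.vertex
  · rw [if_pos hv, if_pos hv.symm]
  · rw [if_neg hv, if_neg (Ne.symm hv)]

/-- There is a chain from `p` to `q` of total cost `r`. -/
inductive HasChain : P.DualPieces → P.DualPieces → ℝ≥0∞ → Prop
  | refl (p : P.DualPieces) : HasChain p p 0
  | step (p : P.DualPieces) {q s : P.DualPieces} {r : ℝ≥0∞} (h : HasChain q s r) :
      HasChain p s (stepCost p q + r)

lemma HasChain.trans {p q s : P.DualPieces} {a b : ℝ≥0∞} (h : HasChain p q a)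
    (h' : HasChain q s b) : HasChain p s (a + b) := by
  induction h with
  | refl p => simpa using h'
  | step p h ih => rw [add_assoc]; exact HasChain.step p (ih h')

lemma HasChain.symm {p q : P.DualPieces} {a : ℝ≥0∞} (h : HasChain p q a) : HasChain q p a := by
  induction h with
  | refl p => exact HasChain.refl p
  | @step p q s r h ih =>
    have h1 : HasChain q p (stepCost q p + 0) := HasChain.step q (HasChain.refl p)
    have h2 := ih.trans h1
    rwa [add_zero, stepCost_comm, add_comm] at h2

/-- The quotient (pseudo)metric of the gluing: the infimum of the lengths of chains. -/
instance : PseudoEMetricSpace P.DualPieces where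
  edist p q := sInf {r | HasChain p q r}
  edist_self p := le_antisymm (sInf_le (HasChain.refl p)) bot_le
  edist_comm p q := congrArg sInf (Set.ext fun _ => ⟨HasChain.symm, HasChain.symm⟩)
  edist_triangle p q s := by
    rw [sInf_eq_iInf' {r | HasChain p q r}, sInf_eq_iInf' {r | HasChain q s r},
      ENNReal.iInf_add]
    refine le_iInf fun a => ?_
    rw [ENNReal.add_iInf]
    exact le_iInf fun b => sInf_le (a.2.trans b.2)

variable (P)

/-- The Gaussian image of `P`: the metric space obtained by gluing the spherical polygons dual to
the vertices of `P`, i.e. the quotient metric space in which points of the disjoint union at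
quotient distance zero are identified. -/
abbrev GaussianImage : Type := SeparationQuotient P.DualPieces

/-- The image of the vertex `v` under the Gauss map. -/
def gaussVertex (v : P.vertices) : Set P.GaussianImage :=
  {q | ∃ p : P.DualPieces, p.vertex = v ∧ q = SeparationQuotient.mk p}

variable {P}

/-- The image of the edge between the faces `F` and `G` under the Gauss map. -/
def gaussEdge (F G : P.Face) : Set P.GaussianImage :=
  {q | ∃ p : P.DualPieces, IsEdgeAt F G p.vertex ∧ p.point ∈ dualSide F G p.vertex ∧
    q = SeparationQuotient.mk p}

/-- The image of the face `F` under the Gauss map (a single point). -/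
def gaussFace (F : P.Face) : Set P.GaussianImage :=
  {q | ∃ p : P.DualPieces, F.Contains p.vertex ∧ p.point = F.normalAt p.vertex ∧
    q = SeparationQuotient.mk p}

end IdealPolyhedron

end

/-! ### Linear algebra in Euclidean 3-space -/

/-! The proof compares the Gaussian image with the normal fan of the Euclidean polytope spanned by
the vertices, and reduces its metric properties to an inequality for cuts of the edge graph.

Hemispheres and angles. All directions from `v` into the polyhedron tend to `-v` in the ball model
(`link_eq`), so the dual polygon is a hemisphere. The normal of `F` at `v` is the projection along
`v` of one vector `F.conormal` that does not depend on `v`. Inner products of these projections are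
Lorentz products, so a side has the exterior dihedral angle as its length, at either endpoint of the
edge.

Topology. `lift v` pushes a point of the half-space `0 ≤ ⟪y, v⟫` along `v` until it lies in the
normal cone of `v`. It is piecewise linear and bijective, and takes `s • F.normalAt v + t •
G.normalAt v` to `s • F.conormal + t • G.conormal`, which no longer mentions `v`. The normalised
lifts therefore agree on identified points and form a Lipschitz bijection `gaussMap` onto the unit
sphere, a homeomorphism by compactness. Each closed cell is described by the set `support q` of the
normal cones that contain the image of `q`, so incidence becomes inclusion of vertex sets. Radial
projection to the boundary of the polar polytope turns cells into proper faces.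

Cut inequality (`cut_sum_aux`). Let `A` be a nonempty set of vertices and `v₀` a vertex outside. For
a generic unit vector orthogonal to `v₀`, take the vertex `w` of `A` of greatest slope seen from
`v₀`, and apply the reflection that exchanges `v₀` and `w`. Signs of slope differences survive
(`slope_exchange`), so the result lies in the side dual to an edge that leaves `A` at `w`. Thus the
sides of the cut edges, reflected to the circle orthogonal to `v₀`, cover this circle, and the
exterior angles along the cut add up to at least `2π`. If `A` and its complement both have two
elements, two of these arcs overlap and the inequality is strict.

Cycles and distances. A set of edges that meets every face evenly is a cut (`exists_cut_eq`); this
is the vanishing of the first cohomology of the sphere mod 2, proved with the flow of steepest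
edges. A simple cycle of dual edges is such a set, and it bounds a 2-cell when one side of the cut
is a single vertex; otherwise the strict inequality applies. For the quotient metric, a chain
between two points of one hemisphere is replaced by arcs and a chain of dual edges (`Reach`).
Closing the edge chain by a boundary arc of length at most `π` gives a cut or cancels completely, so
no chain is shorter than the angle (`JoinsBy.angle_le`), and the hemispheres embed isometrically. -/

lemma finrank_E3 : Module.finrank ℝ E3 = 3 := by simp

lemma exists_ne_zero_orthogonal_pair (a b : E3) : ∃ m : E3, m ≠ 0 ∧ ⟪a, m⟫ = 0 ∧ ⟪b, m⟫ = 0 := by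
  set K : Submodule ℝ E3 := Submodule.span ℝ {a, b}
  have h1 : Module.finrank ℝ K ≤ 2 := by
    have := finrank_span_finset_le_card (R := ℝ) ({a, b} : Finset E3)
    simp only [Finset.coe_insert, Finset.coe_singleton] at this
    exact this.trans Finset.card_le_two
  have h2 := Submodule.finrank_add_finrank_orthogonal K
  rw [finrank_E3] at h2
  have h3 : Kᗮ ≠ ⊥ := by
    intro h
    rw [h, finrank_bot] at h2
    omega
  obtain ⟨m, hm, hm0⟩ := Submodule.exists_mem_ne_zero_of_ne_bot h3
  refine ⟨m, hm0, ?_, ?_⟩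
  · exact (Submodule.mem_orthogonal _ _).1 hm a (Submodule.subset_span (by simp))
  · exact (Submodule.mem_orthogonal _ _).1 hm b (Submodule.subset_span (by simp))

lemma exists_combination_of_independent {a b c : E3}
    (h : ∀ s t r : ℝ, s • a + t • b + r • c = 0 → s = 0 ∧ t = 0 ∧ r = 0) (x : E3) :
    ∃ s t r : ℝ, x = s • a + t • b + r • c := by
  have hl : LinearIndependent ℝ ![a, b, c] := by
    rw [Fintype.linearIndependent_iff]
    intro g hg
    simp only [Fin.sum_univ_three, Matrix.cons_val_zero, Matrix.cons_val_one,
      Matrix.cons_val_two] at hg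
    obtain ⟨h0, h1, h2⟩ := h _ _ _ hg
    intro i
    fin_cases i <;> assumption
  have := hl.span_eq_top_of_card_eq_finrank' (by simp)
  have hx : x ∈ Submodule.span ℝ (Set.range ![a, b, c]) := by rw [this]; trivial
  simp only [Matrix.range_cons, Matrix.range_empty, Set.union_empty, Set.singleton_union] at hx
  rw [Submodule.mem_span_triple] at hx
  obtain ⟨s, t, r, hh⟩ := hx
  exact ⟨s, t, r, hh.symm⟩

lemma exists_combination_of_orthogonal {a b d x : E3} (hd : d ≠ 0)
    (h : ∀ s t : ℝ, s • a + t • b = 0 → s = 0 ∧ t = 0)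
    (ha : ⟪d, a⟫ = 0) (hb : ⟪d, b⟫ = 0) (hx : ⟪d, x⟫ = 0) : ∃ s t : ℝ, x = s • a + t • b := by
  obtain ⟨s, t, r, hh⟩ := exists_combination_of_independent (a := a) (b := b) (c := d) (by
    intro s t r h0
    have h1 : ⟪d, s • a + t • b + r • d⟫ = 0 := by rw [h0, inner_zero_right]
    rw [inner_add_right, inner_add_right, inner_smul_right, inner_smul_right, inner_smul_right,
      ha, hb] at h1
    have hr : r = 0 := by simpa [hd] using h1
    subst hr
    obtain ⟨h2, h3⟩ := h s t (by simpa using h0)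
    exact ⟨h2, h3, rfl⟩) x
  refine ⟨s, t, ?_⟩
  rw [hh, inner_add_right, inner_add_right, inner_smul_right, inner_smul_right, inner_smul_right,
      ha, hb] at hx
  have hr : r = 0 := by simpa [hd] using hx
  simpa [hr] using hh

namespace IdealPolyhedron

variable {P : IdealPolyhedron}

/-! ### Vertices, normal cones and faces -/

lemma norm_vertex (v : P.vertices) : ‖(v : E3)‖ = 1 := P.norm_vertices v v.2

lemma inner_vertex_self (v : P.vertices) : ⟪(v : E3), (v : E3)⟫ = 1 := by
  rw [real_inner_self_eq_norm_sq, norm_vertex]; norm_num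

lemma inner_vertex_lt_one {v w : P.vertices} (h : v ≠ w) : ⟪(v : E3), (w : E3)⟫ < 1 :=
  (inner_lt_one_iff_real_of_norm_eq_one (norm_vertex v) (norm_vertex w)).2
    (fun h' => h (Subtype.ext h'))

/-- A line meets the sphere in at most two points, so three different vertices are not collinear.
Algebraically, pairing the relation with `v` and comparing squared norms of its two terms leaves
only `t = 0` or `s = -t`. -/
lemma vertex_sub_independent {v w z : P.vertices} (hw : w ≠ v) (hz : z ≠ v) (hwz : w ≠ z)
    (s t : ℝ) (h : s • ((w : E3) - v) + t • ((z : E3) - v) = 0) : s = 0 ∧ t = 0 := by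
  have hv1 := inner_vertex_self v
  have hw1 := inner_vertex_self w
  have hz1 := inner_vertex_self z
  have hq1 := inner_vertex_lt_one hw
  have hq2 := inner_vertex_lt_one hz
  have h1 : s * (⟪(w : E3), v⟫ - 1) + t * (⟪(z : E3), v⟫ - 1) = 0 := by
    have := congrArg (fun x => ⟪x, (v : E3)⟫) h
    simpa only [inner_add_left, inner_sub_left, real_inner_smul_left, hv1, inner_zero_left]
      using this
  have h2 : s ^ 2 * (⟪(w : E3), v⟫ - 1) = t ^ 2 * (⟪(z : E3), v⟫ - 1) := by
    have h3 : s • ((w : E3) - v) = -(t • ((z : E3) - v)) := eq_neg_of_add_eq_zero_left h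
    have := congrArg (fun x => ⟪x, x⟫) h3
    simp only [inner_neg_neg, real_inner_smul_left, real_inner_smul_right, inner_sub_left,
      inner_sub_right, hv1, hw1, hz1, real_inner_comm (w : E3) (v : E3),
      real_inner_comm (z : E3) (v : E3)] at this
    linear_combination (-1 / 2) * this
  have h4 : t * (t + s) * (⟪(z : E3), v⟫ - 1) = 0 := by
    linear_combination s * h1 - h2
  have h5 : ⟪(z : E3), v⟫ - 1 ≠ 0 := by linarith
  have h6 : ⟪(w : E3), v⟫ - 1 ≠ 0 := by linarith
  rcases mul_eq_zero.1 ((mul_eq_zero.1 h4).resolve_right h5) with ht | ht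
  · subst ht
    simp only [zero_mul, add_zero, mul_eq_zero] at h1
    exact ⟨h1.resolve_right h6, rfl⟩
  · have hs : s = -t := by linarith
    subst hs
    by_cases ht0 : t = 0
    · simp [ht0]
    · exfalso
      apply hwz
      have h7 : t • ((z : E3) - w) = 0 := by
        rw [← h]; module
      rcases smul_eq_zero.1 h7 with h8 | h8
      · exact absurd h8 ht0
      · exact (Subtype.ext (sub_eq_zero.1 h8)).symm

/-- Differences of vertices span the space, so a linear form that is constant on the vertices
vanishes. Nondegeneracy of the polyhedron enters mostly in this form. -/
lemma eq_zero_of_inner_vertex_eq {x : E3} (h : ∀ v w : P.vertices, ⟪x, (v : E3)⟫ = ⟪x, (w : E3)⟫) :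
    x = 0 := by
  have h1 : vectorSpan ℝ (P.vertices : Set E3) = ⊤ := by
    rw [← direction_affineSpan, P.nondegenerate, AffineSubspace.direction_top]
  have h2 : vectorSpan ℝ (P.vertices : Set E3) ≤ (Submodule.span ℝ {x})ᗮ := by
    rw [vectorSpan_def, Submodule.span_le]
    rintro _ ⟨v, hv, w, hw, rfl⟩
    rw [SetLike.mem_coe, Submodule.mem_orthogonal_singleton_iff_inner_right]
    have := h ⟨v, hv⟩ ⟨w, hw⟩
    simp only [vsub_eq_sub, inner_sub_right] at *
    linarith
  rw [h1] at h2
  have := h2 (show x ∈ ⊤ from trivial)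
  rw [Submodule.mem_orthogonal_singleton_iff_inner_right] at this
  simpa using this

instance : Nonempty P.vertices := by
  by_contra h
  have h1 : (P.vertices : Set E3) = ∅ := by
    ext x
    simp only [SetLike.mem_coe, mem_empty_iff_false, iff_false]
    exact fun hx => h ⟨⟨x, hx⟩⟩
  have h2 := P.nondegenerate
  rw [h1, AffineSubspace.span_empty] at h2
  exact bot_ne_top h2

lemma exists_vertex_ne (v w : P.vertices) : ∃ z : P.vertices, z ≠ v ∧ z ≠ w := by
  by_contra! h
  obtain ⟨m, hm0, h1, -⟩ := exists_ne_zero_orthogonal_pair ((v : E3) - w) 0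
  apply hm0
  apply eq_zero_of_inner_vertex_eq (P := P)
  have h2 : ∀ z : P.vertices, ⟪m, (z : E3)⟫ = ⟪m, (v : E3)⟫ := by
    intro z
    by_cases hz : z = v
    · rw [hz]
    · rw [h z hz]
      rw [real_inner_comm, inner_sub_right] at h1
      linarith
  intro a b
  rw [h2 a, h2 b]

variable (P) in
/-- The normal cone of `P` at the vertex `v`: the vectors `x` for which `v` maximises `⟪x, ·⟫`. -/
def normalCone (v : P.vertices) : Set E3 := {x | ∀ w : P.vertices, ⟪x, (w : E3)⟫ ≤ ⟪x, (v : E3)⟫}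

lemma exists_mem_normalCone (x : E3) : ∃ v, x ∈ P.normalCone v :=
  Finite.exists_max (fun w : P.vertices => ⟪x, (w : E3)⟫)

lemma inner_eq_of_mem_normalCone {x : E3} {v w : P.vertices} (hv : x ∈ P.normalCone v)
    (hw : x ∈ P.normalCone w) : ⟪x, (v : E3)⟫ = ⟪x, (w : E3)⟫ :=
  le_antisymm (hw v) (hv w)

lemma smul_mem_normalCone {x : E3} {v : P.vertices} (hv : x ∈ P.normalCone v) {c : ℝ}
    (hc : 0 ≤ c) : c • x ∈ P.normalCone v := by
  intro w
  rw [real_inner_smul_left, real_inner_smul_left]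
  exact mul_le_mul_of_nonneg_left (hv w) hc

lemma add_mem_normalCone {x y : E3} {v : P.vertices} (hx : x ∈ P.normalCone v)
    (hy : y ∈ P.normalCone v) : x + y ∈ P.normalCone v := by
  intro w
  rw [inner_add_left, inner_add_left]
  exact add_le_add (hx w) (hy w)

lemma smul_mem_normalCone_iff {x : E3} {v : P.vertices} {c : ℝ} (hc : 0 < c) :
    c • x ∈ P.normalCone v ↔ x ∈ P.normalCone v := by
  refine ⟨fun h => ?_, fun h => smul_mem_normalCone h hc.le⟩
  have := smul_mem_normalCone h (inv_pos.2 hc).le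
  rwa [smul_smul, inv_mul_cancel₀ hc.ne', one_smul] at this

lemma Face.normal_ne_zero (F : P.Face) : F.normal ≠ 0 := by
  intro h
  have := F.norm_normal
  simp [h] at this

lemma Face.inner_normal_self (F : P.Face) : ⟪F.normal, F.normal⟫ = 1 := by
  rw [real_inner_self_eq_norm_sq, F.norm_normal]; norm_num

lemma Face.inner_le (F : P.Face) (v : P.vertices) : ⟪F.normal, (v : E3)⟫ ≤ F.level :=
  F.supporting v v.2

/-- Two points span only a line, while the vertices of a face span a plane. Applied with `v = w`, or
with arbitrary `v` and `w`, it also supplies the first and second vertex of a face. -/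
lemma Face.exists_contains_ne (F : P.Face) (v w : P.vertices) :
    ∃ z : P.vertices, F.Contains z ∧ z ≠ v ∧ z ≠ w := by
  by_contra! h
  have h1 : Collinear ℝ {x | x ∈ P.vertices ∧ ⟪F.normal, x⟫ = F.level} := by
    refine (collinear_pair ℝ (v : E3) (w : E3)).subset ?_
    rintro x ⟨hx, hx'⟩
    by_cases hxv : (⟨x, hx⟩ : P.vertices) = v
    · left; rw [← hxv]
    · right; rw [← h ⟨x, hx⟩ hx' hxv]; rfl
  rw [collinear_iff_finrank_le_one, F.spanning] at h1
  omega

lemma Face.normal_mem_normalCone_iff (F : P.Face) (v : P.vertices) :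
    F.normal ∈ P.normalCone v ↔ F.Contains v := by
  constructor
  · intro h
    obtain ⟨z, hz, -⟩ := F.exists_contains_ne v v
    have h1 := h z
    rw [hz] at h1
    exact le_antisymm (F.inner_le v) h1
  · intro h w
    rw [h]
    exact F.inner_le w

/-- Three different vertices maximising `⟪x, ·⟫` lie in a face with normal direction `x`. -/
lemma exists_face_of_mem_normalCone {x : E3} (hx : x ≠ 0) {v w z : P.vertices} (hw : w ≠ v)
    (hz : z ≠ v) (hwz : w ≠ z) (hv' : x ∈ P.normalCone v) (hw' : x ∈ P.normalCone w)
    (hz' : x ∈ P.normalCone z) : ∃ F : P.Face, x = ‖x‖ • F.normal := by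
  have hn : 0 < ‖x‖ := norm_pos_iff.2 hx
  have key : ∀ y : P.vertices, ⟪‖x‖⁻¹ • x, (y : E3)⟫ ≤ ⟪‖x‖⁻¹ • x, (v : E3)⟫ :=
    smul_mem_normalCone hv' (inv_nonneg.2 hn.le)
  refine ⟨⟨‖x‖⁻¹ • x, ⟪‖x‖⁻¹ • x, (v : E3)⟫, ?_, fun y hy => key ⟨y, hy⟩, ?_⟩, ?_⟩
  · rw [norm_smul, norm_inv, norm_norm, inv_mul_cancel₀ hn.ne']
  · set S : Set E3 := {y | y ∈ P.vertices ∧ ⟪‖x‖⁻¹ • x, y⟫ = ⟪‖x‖⁻¹ • x, (v : E3)⟫} with hS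
    have mem : ∀ y : P.vertices, x ∈ P.normalCone y → (y : E3) ∈ S := by
      intro y hy
      refine ⟨y.2, ?_⟩
      rw [real_inner_smul_left, real_inner_smul_left, inner_eq_of_mem_normalCone hy hv']
    -- Upper bound: all differences are orthogonal to `x`. Lower bound: `w - v` and `z - v` are
    -- independent.
    apply le_antisymm
    · have h2 : vectorSpan ℝ S ≤ (Submodule.span ℝ {x})ᗮ := by
        rw [vectorSpan_def, Submodule.span_le]
        rintro _ ⟨a, ⟨-, ha⟩, b, ⟨-, hb⟩, rfl⟩
        rw [SetLike.mem_coe, Submodule.mem_orthogonal_singleton_iff_inner_right]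
        have := ha.trans hb.symm
        rw [real_inner_smul_left, real_inner_smul_left] at this
        have h3 := mul_left_cancel₀ (inv_pos.2 hn).ne' this
        simp only [vsub_eq_sub, inner_sub_right]
        linarith
      have : Fact (Module.finrank ℝ E3 = 2 + 1) := ⟨finrank_E3⟩
      exact (Submodule.finrank_mono h2).trans (Submodule.finrank_orthogonal_span_singleton hx).le
    · have h2 : LinearIndependent ℝ ![(w : E3) - v, (z : E3) - v] := by
        rw [LinearIndependent.pair_iff]
        exact vertex_sub_independent hw hz hwz
      have h3 := finrank_span_eq_card h2
      rw [Fintype.card_fin] at h3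
      refine h3.ge.trans ?_
      apply Submodule.finrank_mono
      rw [Submodule.span_le]
      rintro _ ⟨i, rfl⟩
      fin_cases i
      · exact vsub_mem_vectorSpan ℝ (mem w hw') (mem v hv')
      · exact vsub_mem_vectorSpan ℝ (mem z hz') (mem v hv')
  · rw [smul_smul, mul_inv_cancel₀ hn.ne', one_smul]

lemma Face.inner_sub_eq_zero {F : P.Face} {v w : P.vertices} (hv : F.Contains v)
    (hw : F.Contains w) : ⟪F.normal, (w : E3) - v⟫ = 0 := by
  rw [inner_sub_right, hv, hw, sub_self]

lemma Face.inner_sub_nonpos {F : P.Face} {v : P.vertices} (hv : F.Contains v)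
    (w : P.vertices) : ⟪F.normal, (w : E3) - v⟫ ≤ 0 := by
  rw [inner_sub_right, hv]
  linarith [F.inner_le w]

lemma Face.inner_sub_neg {F : P.Face} {v w : P.vertices} (hv : F.Contains v)
    (hw : ¬ F.Contains w) : ⟪F.normal, (w : E3) - v⟫ < 0 := by
  rw [inner_sub_right, hv]
  have := lt_of_le_of_ne (F.inner_le w) hw
  linarith

lemma Face.ext_normal {F G : P.Face} (h : F.normal = G.normal) : F = G := by
  have h2 : F.level = G.level := by
    obtain ⟨v, hv, -⟩ := F.exists_contains_ne (Classical.arbitrary _) (Classical.arbitrary _)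
    have := (G.normal_mem_normalCone_iff v).1 (h ▸ (F.normal_mem_normalCone_iff v).2 hv)
    rw [← hv, ← this, h]
  cases F; cases G
  simp only at h h2
  subst h; subst h2
  rfl

lemma Face.eq_of_smul_eq {F G : P.Face} {a b : ℝ} (ha : 0 < a) (hb : 0 < b)
    (h : a • F.normal = b • G.normal) : F = G := by
  have h1 := congrArg norm h
  rw [norm_smul, norm_smul, F.norm_normal, G.norm_normal, Real.norm_of_nonneg ha.le,
    Real.norm_of_nonneg hb.le, mul_one, mul_one] at h1
  subst h1
  exact Face.ext_normal (smul_right_injective _ ha.ne' h)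

/-- Two normals of faces are not opposite. -/
lemma Face.normal_ne_neg {F G : P.Face} {v : P.vertices} (hF : F.Contains v) (hG : G.Contains v) :
    F.normal ≠ -G.normal := by
  intro h
  apply F.normal_ne_zero
  have h2 : ∀ w : P.vertices, ⟪F.normal, (w : E3)⟫ = ⟪F.normal, (v : E3)⟫ := by
    intro w
    have h3 := F.inner_sub_nonpos hF w
    have h4 := G.inner_sub_nonpos hG w
    rw [h, inner_neg_left] at h3
    have h5 : ⟪G.normal, (w : E3) - v⟫ = 0 := by linarith
    rw [inner_sub_right] at h5
    rw [h, inner_neg_left, inner_neg_left]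
    linarith
  exact eq_zero_of_inner_vertex_eq (P := P) fun a b => by rw [h2 a, h2 b]

/-- A vector orthogonal to a face is a multiple of the normal of the face. -/
lemma Face.exists_eq_smul_normal {F : P.Face} {v w z : P.vertices} (hw : w ≠ v)
    (hz : z ≠ v) (hwz : w ≠ z) (hFv : F.Contains v) (hFw : F.Contains w) (hFz : F.Contains z)
    {x : E3} (g1 : ⟪x, (w : E3) - v⟫ = 0) (g2 : ⟪x, (z : E3) - v⟫ = 0) :
    ∃ r : ℝ, x = r • F.normal := by
  have f1 := Face.inner_sub_eq_zero hFv hFw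
  have f2 := Face.inner_sub_eq_zero hFv hFz
  obtain ⟨s, t, r, h⟩ := exists_combination_of_independent (a := (w : E3) - v) (b := (z : E3) - v)
    (c := F.normal) (by
      intro s t r h
      have h1 : ⟪F.normal, s • ((w : E3) - v) + t • ((z : E3) - v) + r • F.normal⟫ = 0 := by
        rw [h, inner_zero_right]
      rw [inner_add_right, inner_add_right, inner_smul_right, inner_smul_right, inner_smul_right,
        f1, f2, F.inner_normal_self] at h1
      have hr : r = 0 := by linarith
      subst hr
      obtain ⟨h2, h3⟩ := vertex_sub_independent hw hz hwz s t (by simpa using h)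
      exact ⟨h2, h3, rfl⟩) x
  -- The component of `x` in the plane of the face is orthogonal to both directions that span it,
  -- hence to itself.
  have h1 : s • ((w : E3) - v) + t • ((z : E3) - v) = 0 := by
    rw [← inner_self_eq_zero (𝕜 := ℝ)]
    have h2 : s • ((w : E3) - v) + t • ((z : E3) - v) = x - r • F.normal := by
      rw [h]; abel
    nth_rewrite 1 [h2]
    rw [inner_sub_left, inner_add_right, inner_add_right, real_inner_smul_left,
      real_inner_smul_left, real_inner_smul_right, real_inner_smul_right, real_inner_smul_right,
      real_inner_smul_right, f1, f2, g1, g2]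
    ring
  exact ⟨r, by rw [h, h1, zero_add]⟩

lemma Face.eq_of_three_common {F G : P.Face} {v w z : P.vertices} (hw : w ≠ v)
    (hz : z ≠ v) (hwz : w ≠ z) (hFv : F.Contains v) (hFw : F.Contains w) (hFz : F.Contains z)
    (hGv : G.Contains v) (hGw : G.Contains w) (hGz : G.Contains z) : F = G := by
  obtain ⟨r, h⟩ := Face.exists_eq_smul_normal hw hz hwz hFv hFw hFz
    (Face.inner_sub_eq_zero hGv hGw) (Face.inner_sub_eq_zero hGv hGz)
  have h2 := congrArg norm h
  rw [norm_smul, F.norm_normal, G.norm_normal, mul_one, Real.norm_eq_abs] at h2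
  rcases eq_or_eq_neg_of_abs_eq h2.symm with h3 | h3
  · rw [h3, one_smul] at h
    exact Face.ext_normal h.symm
  · rw [h3, neg_one_smul] at h
    exact absurd h (Face.normal_ne_neg hGv hFv)

/-- A face is determined by its set of vertices, because three common vertices already force
equality. -/
instance : Finite P.Face := by
  have : Function.Injective (fun F : P.Face => {v : P.vertices | F.Contains v}) := by
    intro F G h
    have h' : ∀ v, F.Contains v ↔ G.Contains v := fun v => Set.ext_iff.1 h v
    obtain ⟨v, hv, -⟩ := F.exists_contains_ne (Classical.arbitrary _) (Classical.arbitrary _)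
    obtain ⟨w, hw, hwv, -⟩ := F.exists_contains_ne v v
    obtain ⟨z, hz, hzv, hzw⟩ := F.exists_contains_ne v w
    exact Face.eq_of_three_common hwv hzv hzw.symm hv hw hz ((h' _).1 hv) ((h' _).1 hw)
      ((h' _).1 hz)
  exact Finite.of_injective _ this

end IdealPolyhedron

namespace IdealPolyhedron

variable {P : IdealPolyhedron}

/-! ### Edges -/

/-- `F` and `G` are the two faces at an edge, and `v` and `w` are its two endpoints. -/
structure EdgeWith (F G : P.Face) (v w : P.vertices) : Prop where
  face_ne : F ≠ G
  vertex_ne : v ≠ w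
  left_fst : F.Contains v
  left_snd : F.Contains w
  right_fst : G.Contains v
  right_snd : G.Contains w

lemma isEdgeAt_iff {F G : P.Face} {v : P.vertices} :
    IsEdgeAt F G v ↔ ∃ w, EdgeWith F G v w :=
  ⟨fun ⟨h1, h2, h3, w, h4, h5, h6⟩ => ⟨w, h1, h4.symm, h2, h5, h3, h6⟩,
    fun ⟨w, h⟩ => ⟨h.1, h.3, h.5, w, h.2.symm, h.4, h.6⟩⟩

namespace EdgeWith

variable {F G H : P.Face} {v w x y z : P.vertices}

lemma swap_faces (h : EdgeWith F G v w) : EdgeWith G F v w :=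
  ⟨h.1.symm, h.2, h.5, h.6, h.3, h.4⟩

lemma swap_vertices (h : EdgeWith F G v w) : EdgeWith F G w v :=
  ⟨h.1, h.2.symm, h.4, h.3, h.6, h.5⟩

lemma isEdgeAt (h : EdgeWith F G v w) : IsEdgeAt F G v := isEdgeAt_iff.2 ⟨w, h⟩

lemma eq_or_eq_of_contains (h : EdgeWith F G v w) (hF : F.Contains z) (hG : G.Contains z) :
    z = v ∨ z = w := by
  by_contra! hz
  exact h.face_ne (Face.eq_of_three_common h.vertex_ne.symm hz.1 hz.2.symm h.left_fst h.left_snd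
    hF h.right_fst h.right_snd hG)

/-- Some vertex of `F` is not a vertex of `G`. -/
lemma exists_not_contains (h : EdgeWith F G v w) : ∃ z, F.Contains z ∧ ¬ G.Contains z := by
  obtain ⟨z, hz, hzv, hzw⟩ := F.exists_contains_ne v w
  exact ⟨z, hz, fun hG => (h.eq_or_eq_of_contains hz hG).elim hzv hzw⟩

/-- A vertex `a` of `F` off `G` isolates the coefficient of `G.normal` after pairing with `a - v`,
and a vertex of `G` off `F` isolates the other one. -/
lemma normals_independent (h : EdgeWith F G v w) (s t : ℝ)
    (hst : s • F.normal + t • G.normal = 0) : s = 0 ∧ t = 0 := by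
  obtain ⟨a, haF, haG⟩ := h.exists_not_contains
  obtain ⟨b, hbG, hbF⟩ := h.swap_faces.exists_not_contains
  have h1 := congrArg (fun x => ⟪x, (a : E3) - v⟫) hst
  have h2 := congrArg (fun x => ⟪x, (b : E3) - v⟫) hst
  simp only [inner_add_left, real_inner_smul_left, inner_zero_left,
    Face.inner_sub_eq_zero h.left_fst haF, Face.inner_sub_eq_zero h.right_fst hbG] at h1 h2
  have h3 := Face.inner_sub_neg h.right_fst haG
  have h4 := Face.inner_sub_neg h.left_fst hbF
  simp only [mul_zero, zero_add, add_zero, mul_eq_zero] at h1 h2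
  exact ⟨h2.resolve_right h4.ne, h1.resolve_right h3.ne⟩

lemma exists_combination (h : EdgeWith F G v w) {p : E3} (hp : ⟪p, (w : E3) - v⟫ = 0) :
    ∃ s t : ℝ, p = s • F.normal + t • G.normal := by
  refine exists_combination_of_orthogonal (d := (w : E3) - v) ?_ h.normals_independent ?_ ?_ ?_
  · intro h0
    exact h.vertex_ne (Subtype.ext (sub_eq_zero.1 h0).symm)
  · rw [real_inner_comm]; exact Face.inner_sub_eq_zero h.left_fst h.left_snd
  · rw [real_inner_comm]; exact Face.inner_sub_eq_zero h.right_fst h.right_snd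
  · rw [real_inner_comm]; exact hp

/-- The normal cone of an edge is spanned by the normals of its two faces. -/
lemma exists_nonneg_combination (h : EdgeWith F G v w) {p : E3} (hv : p ∈ P.normalCone v)
    (hw : p ∈ P.normalCone w) :
    ∃ s t : ℝ, 0 ≤ s ∧ 0 ≤ t ∧ p = s • F.normal + t • G.normal := by
  obtain ⟨s, t, hp⟩ := h.exists_combination (p := p) (by
    rw [inner_sub_right, inner_eq_of_mem_normalCone hv hw, sub_self])
  obtain ⟨a, haF, haG⟩ := h.exists_not_contains
  obtain ⟨b, hbG, hbF⟩ := h.swap_faces.exists_not_contains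
  have h1 : ⟪p, (a : E3) - v⟫ ≤ 0 := by rw [inner_sub_right]; linarith [hv a]
  have h2 : ⟪p, (b : E3) - v⟫ ≤ 0 := by rw [inner_sub_right]; linarith [hv b]
  rw [hp] at h1 h2
  simp only [inner_add_left, real_inner_smul_left,
    Face.inner_sub_eq_zero h.left_fst haF, Face.inner_sub_eq_zero h.right_fst hbG] at h1 h2
  have h3 := Face.inner_sub_neg h.right_fst haG
  have h4 := Face.inner_sub_neg h.left_fst hbF
  exact ⟨s, t, by nlinarith, by nlinarith, hp⟩

lemma combination_mem (h : EdgeWith F G v w) {s t : ℝ} (hs : 0 ≤ s) (ht : 0 ≤ t) :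
    s • F.normal + t • G.normal ∈ P.normalCone v :=
  add_mem_normalCone (smul_mem_normalCone ((F.normal_mem_normalCone_iff v).2 h.left_fst) hs)
    (smul_mem_normalCone ((G.normal_mem_normalCone_iff v).2 h.right_fst) ht)

/-- A vertex whose normal cone contains an inner point of the normal cone of an edge is an
endpoint of the edge. -/
lemma eq_or_eq_of_mem (h : EdgeWith F G v w) {s t : ℝ} (hs : 0 < s) (ht : 0 < t)
    (hz : s • F.normal + t • G.normal ∈ P.normalCone z) : z = v ∨ z = w := by
  have h1 := inner_eq_of_mem_normalCone hz (h.combination_mem hs.le ht.le)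
  have h2 : s * ⟪F.normal, (z : E3) - v⟫ + t * ⟪G.normal, (z : E3) - v⟫ = 0 := by
    simp only [inner_add_left, real_inner_smul_left, inner_sub_right] at h1 ⊢
    linarith
  have h3 := Face.inner_sub_nonpos h.left_fst z
  have h4 := Face.inner_sub_nonpos h.right_fst z
  apply h.eq_or_eq_of_contains
  · by_contra hF
    nlinarith [Face.inner_sub_neg h.left_fst hF]
  · by_contra hG
    nlinarith [Face.inner_sub_neg h.right_fst hG]

/-- The only faces at an edge are its two faces. -/
lemma face_eq_or_eq (h : EdgeWith F G v w) (hv : H.Contains v) (hw : H.Contains w) :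
    H = F ∨ H = G := by
  obtain ⟨s, t, hs, ht, hH⟩ := h.exists_nonneg_combination
    ((H.normal_mem_normalCone_iff v).2 hv) ((H.normal_mem_normalCone_iff w).2 hw)
  rcases hs.eq_or_lt with rfl | hs
  · rw [zero_smul, zero_add] at hH
    rcases ht.eq_or_lt with rfl | ht
    · rw [zero_smul] at hH
      exact absurd hH H.normal_ne_zero
    · exact Or.inr (Face.eq_of_smul_eq one_pos ht (by rw [one_smul, hH]))
  · rcases ht.eq_or_lt with rfl | ht
    · rw [zero_smul, add_zero] at hH
      exact Or.inl (Face.eq_of_smul_eq one_pos hs (by rw [one_smul, hH]))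
    · exfalso
      obtain ⟨z, hz, hzv, hzw⟩ := H.exists_contains_ne v w
      have := (H.normal_mem_normalCone_iff z).2 hz
      rw [hH] at this
      exact (h.eq_or_eq_of_mem hs ht this).elim hzv hzw

end EdgeWith

/-- If exactly the vertices `v` and `w` maximise `⟪x, ·⟫`, then they span an edge. -/
lemma exists_edgeWith {x : E3} {v w : P.vertices} (hvw : v ≠ w) (hv : x ∈ P.normalCone v)
    (hw : x ∈ P.normalCone w) (hx : ∀ z, x ∈ P.normalCone z → z = v ∨ z = w) :
    ∃ F G : P.Face, EdgeWith F G v w ∧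
      ∃ s t : ℝ, 0 < s ∧ 0 < t ∧ x = s • F.normal + t • G.normal := by
  classical
  -- The supporting plane is rotated about the line through `v` and `w`: the normals are `x` plus
  -- multiples of `m`. With `a` and `b` the heights below `v` for `x` and `m`, the rotation first
  -- hits a new vertex, in either sense, where `b / a` is greatest or least.
  obtain ⟨m, hm0, hm1, hm2⟩ := exists_ne_zero_orthogonal_pair x ((w : E3) - v)
  set a : P.vertices → ℝ := fun z => ⟪x, (v : E3) - z⟫ with ha
  set b : P.vertices → ℝ := fun z => ⟪m, (v : E3) - z⟫ with hb
  have hbv : b v = 0 := by simp [hb]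
  have hav : a v = 0 := by simp [ha]
  have hbw : b w = 0 := by
    simp only [hb]
    rw [← neg_sub, inner_neg_right, real_inner_comm, hm2, neg_zero]
  have haw : a w = 0 := by
    simp only [ha]
    rw [inner_sub_right, inner_eq_of_mem_normalCone hv hw, sub_self]
  have hapos : ∀ z, z ≠ v → z ≠ w → 0 < a z := by
    intro z hz1 hz2
    have h1 : ¬ x ∈ P.normalCone z := fun h => (hx z h).elim hz1 hz2
    simp only [ha]
    rw [inner_sub_right, sub_pos]
    refine lt_of_le_of_ne (hv z) fun h => h1 fun y => ?_
    rw [h]; exact hv y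
  set Z : Finset P.vertices := Finset.univ.filter (fun z => z ≠ v ∧ z ≠ w) with hZ
  have memZ : ∀ z, z ∈ Z ↔ z ≠ v ∧ z ≠ w := by simp [hZ]
  have hZne : Z.Nonempty := by
    obtain ⟨z, hz⟩ := exists_vertex_ne v w
    exact ⟨z, (memZ z).2 hz⟩
  obtain ⟨p, hp, hpmax⟩ := Z.exists_max_image (fun z => b z / a z) hZne
  obtain ⟨q, hq, hqmin⟩ := Z.exists_min_image (fun z => b z / a z) hZne
  rw [memZ] at hp hq
  set R := b p / a p
  set r := b q / a q
  have hR : ∀ z, b z ≤ R * a z := by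
    intro z
    by_cases hz1 : z = v
    · rw [hz1, hbv, hav, mul_zero]
    by_cases hz2 : z = w
    · rw [hz2, hbw, haw, mul_zero]
    exact (div_le_iff₀ (hapos z hz1 hz2)).1 (hpmax z ((memZ z).2 ⟨hz1, hz2⟩))
  have hr : ∀ z, r * a z ≤ b z := by
    intro z
    by_cases hz1 : z = v
    · rw [hz1, hbv, hav, mul_zero]
    by_cases hz2 : z = w
    · rw [hz2, hbw, haw, mul_zero]
    exact (le_div_iff₀ (hapos z hz1 hz2)).1 (hqmin z ((memZ z).2 ⟨hz1, hz2⟩))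
  have hRp : b p = R * a p := by
    simp only [R]; rw [div_mul_cancel₀ _ (hapos p hp.1 hp.2).ne']
  have hrq : b q = r * a q := by
    simp only [r]; rw [div_mul_cancel₀ _ (hapos q hq.1 hq.2).ne']
  have hne : ∀ k : ℝ, m ≠ k • x := by
    intro k hk
    apply hm0
    rw [← inner_self_eq_zero (𝕜 := ℝ)]
    nth_rewrite 1 [hk]
    rw [real_inner_smul_left, hm1, mul_zero]
  -- If the extreme quotients agreed, `m - r • x` would be constant on the vertices and hence zero.
  have hrR : r < R := by
    by_contra! hle
    apply hne r
    rw [← sub_eq_zero]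
    apply eq_zero_of_inner_vertex_eq (P := P)
    have h2 : ∀ z : P.vertices, ⟪m - r • x, (z : E3)⟫ = ⟪m - r • x, (v : E3)⟫ := by
      intro z
      have h3 := hR z
      have h4 := hr z
      have h5 : 0 ≤ a z := by
        simp only [ha]; rw [inner_sub_right]; linarith [hv z]
      have h6 : b z = r * a z := by nlinarith
      simp only [ha, hb, inner_sub_right] at h6
      rw [inner_sub_left, inner_sub_left, real_inner_smul_left, real_inner_smul_left]
      linarith
    intro c d
    rw [h2 c, h2 d]
  -- the two faces
  have memN : ∀ (y : E3), (∀ z : P.vertices, 0 ≤ ⟪y, (v : E3) - z⟫) → ∀ z : P.vertices,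
      ⟪y, (v : E3) - z⟫ = 0 → y ∈ P.normalCone z := by
    intro y hy z hz u
    have := hy u
    rw [inner_sub_right] at this hz
    linarith
  have e1 : ∀ z : P.vertices, ⟪R • x - m, (v : E3) - z⟫ = R * a z - b z := by
    intro z
    rw [inner_sub_left, real_inner_smul_left]
  have e2 : ∀ z : P.vertices, ⟪m - r • x, (v : E3) - z⟫ = b z - r * a z := by
    intro z
    rw [inner_sub_left, real_inner_smul_left]
  have n1 : R • x - m ≠ 0 := fun h => hne R (sub_eq_zero.1 h).symm
  have n2 : m - r • x ≠ 0 := fun h => hne r (sub_eq_zero.1 h)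
  have p1 := memN (R • x - m) (fun z => by rw [e1]; linarith [hR z])
  have p2 := memN (m - r • x) (fun z => by rw [e2]; linarith [hr z])
  have q1v := p1 v (by rw [e1, hav, hbv]; ring)
  have q1w := p1 w (by rw [e1, haw, hbw]; ring)
  have q1p := p1 p (by rw [e1, hRp]; ring)
  have q2v := p2 v (by rw [e2, hav, hbv]; ring)
  have q2w := p2 w (by rw [e2, haw, hbw]; ring)
  have q2q := p2 q (by rw [e2, hrq]; ring)
  obtain ⟨F, hF⟩ := exists_face_of_mem_normalCone n1 hvw.symm hp.1 hp.2.symm q1v q1w q1p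
  obtain ⟨G, hG⟩ := exists_face_of_mem_normalCone n2 hvw.symm hq.1 hq.2.symm q2v q2w q2q
  have np1 : 0 < ‖R • x - m‖ := norm_pos_iff.2 n1
  have np2 : 0 < ‖m - r • x‖ := norm_pos_iff.2 n2
  have cF : ∀ z, R • x - m ∈ P.normalCone z → F.Contains z := by
    intro z hz
    rw [hF, smul_mem_normalCone_iff np1] at hz
    exact (F.normal_mem_normalCone_iff z).1 hz
  have cG : ∀ z, m - r • x ∈ P.normalCone z → G.Contains z := by
    intro z hz
    rw [hG, smul_mem_normalCone_iff np2] at hz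
    exact (G.normal_mem_normalCone_iff z).1 hz
  -- The two extreme normals `R • x - m` and `m - r • x` add up to `(R - r) • x`.
  have hsum : x = ((R - r)⁻¹ * ‖R • x - m‖) • F.normal + ((R - r)⁻¹ * ‖m - r • x‖) • G.normal := by
    rw [mul_smul, mul_smul, ← hF, ← hG, ← smul_add]
    have : R • x - m + (m - r • x) = (R - r) • x := by module
    rw [this, smul_smul, inv_mul_cancel₀ (sub_pos.2 hrR).ne', one_smul]
  have hinv : 0 < (R - r)⁻¹ := inv_pos.2 (sub_pos.2 hrR)
  refine ⟨F, G, ⟨?_, hvw, cF v q1v, cF w q1w, cG v q2v, cG w q2w⟩, _, _,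
    mul_pos hinv np1, mul_pos hinv np2, hsum⟩
  -- If both extreme planes were the same face, `x` would be a multiple of its normal, and `p` would
  -- be a third vertex maximising `⟪x, ·⟫`.
  rintro rfl
  rw [← add_smul] at hsum
  have h1 : x ∈ P.normalCone p := by
    rw [hsum]
    exact smul_mem_normalCone ((F.normal_mem_normalCone_iff p).2 (cF p q1p)) (by positivity)
  exact (hx p h1).elim hp.1 hp.2

/-- The plane of a face is not tangent to the sphere: equality in Cauchy–Schwarz would make two
different vertices both equal to the normal or both to its negative. -/
lemma Face.level_sq_lt_one (F : P.Face) : F.level ^ 2 < 1 := by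
  obtain ⟨v, hv, -⟩ := F.exists_contains_ne (Classical.arbitrary _) (Classical.arbitrary _)
  obtain ⟨w, hw, hwv, -⟩ := F.exists_contains_ne v v
  have h1 : |F.level| ≤ 1 := by
    have := abs_real_inner_le_norm F.normal v
    rwa [hv, F.norm_normal, norm_vertex, one_mul] at this
  rw [sq_lt_one_iff_abs_lt_one]
  refine lt_of_le_of_ne h1 fun h => hwv (Subtype.ext ?_)
  rcases eq_or_eq_neg_of_abs_eq h with h2 | h2
  · have e1 := (inner_eq_one_iff_of_norm_eq_one (𝕜 := ℝ) F.norm_normal (norm_vertex v)).1 (hv.trans h2)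
    have e2 := (inner_eq_one_iff_of_norm_eq_one (𝕜 := ℝ) F.norm_normal (norm_vertex w)).1 (hw.trans h2)
    rw [← e1, ← e2]
  · have n : ‖-F.normal‖ = 1 := by rw [norm_neg, F.norm_normal]
    have e1 := (inner_eq_one_iff_of_norm_eq_one (𝕜 := ℝ) n (norm_vertex v)).1
      (by rw [inner_neg_left, hv, h2, neg_neg])
    have e2 := (inner_eq_one_iff_of_norm_eq_one (𝕜 := ℝ) n (norm_vertex w)).1
      (by rw [inner_neg_left, hw, h2, neg_neg])
    rw [← e1, ← e2]

/-! ### Slopes seen from a vertex -/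

/-- The slope of `p` from the vertex `v` to the vertex `z`; up to a constant this is the value of
the linear form `⟪p, ·⟫` at the stereographic projection of `z` from `v`. -/
noncomputable def slope (v : P.vertices) (p : E3) (z : P.vertices) : ℝ :=
  ⟪p, (z : E3) - v⟫ / (1 - ⟪(v : E3), (z : E3)⟫)

/-- Adding `s • v` to `p` lowers every slope from `v` by the same amount `s`; the denominator in
`slope` is chosen for this. Along the line `p + s • v`, the normal cone at `v` is thus the half-line
beyond the greatest slope. -/
lemma inner_add_smul_sub {v z : P.vertices} (hz : z ≠ v) (p : E3) (s : ℝ) :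
    ⟪p + s • (v : E3), (z : E3) - v⟫ = (1 - ⟪(v : E3), (z : E3)⟫) * (slope v p z - s) := by
  have h := inner_vertex_lt_one hz.symm
  have h1 : (1 - ⟪(v : E3), (z : E3)⟫) ≠ 0 := by linarith
  rw [slope, mul_sub, mul_div_cancel₀ _ h1, inner_add_left, real_inner_smul_left,
    inner_sub_right (v : E3), inner_vertex_self]
  ring

lemma add_smul_mem_normalCone_iff {v : P.vertices} {p : E3} {s : ℝ} :
    p + s • (v : E3) ∈ P.normalCone v ↔ ∀ z, z ≠ v → slope v p z ≤ s := by
  constructor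
  · intro h z hz
    have h1 := inner_add_smul_sub hz p s
    have h2 := inner_vertex_lt_one hz.symm
    have h3 : ⟪p + s • (v : E3), (z : E3) - v⟫ ≤ 0 := by rw [inner_sub_right]; linarith [h z]
    rw [h1] at h3
    by_contra! h4
    nlinarith
  · intro h z
    by_cases hz : z = v
    · rw [hz]
    have h1 := inner_add_smul_sub hz p s
    have h2 := inner_vertex_lt_one (Ne.symm hz)
    have h3 : ⟪p + s • (v : E3), (z : E3) - v⟫ ≤ 0 := by
      rw [h1]; nlinarith [h z hz]
    rw [inner_sub_right] at h3
    linarith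

lemma add_smul_mem_normalCone_iff_slope_eq {v z : P.vertices} (hz : z ≠ v) {p : E3} {s : ℝ}
    (h : p + s • (v : E3) ∈ P.normalCone v) :
    p + s • (v : E3) ∈ P.normalCone z ↔ slope v p z = s := by
  have h1 := inner_add_smul_sub hz p s
  have h2 := inner_vertex_lt_one hz.symm
  constructor
  · intro h'
    have h3 := inner_eq_of_mem_normalCone h h'
    rw [inner_sub_right, h3, sub_self] at h1
    have h4 := mul_eq_zero.1 h1.symm
    have := h4.resolve_left (by linarith)
    linarith
  · intro h3 y
    rw [h3, sub_self, mul_zero, inner_sub_right] at h1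
    linarith [h y]

/-! ### The two edges of a face at a vertex -/

/-- The vertex `x` of `F` with greatest slope is joined to `v` by an edge: the normal of `F` is
tilted by a small multiple of `b + slope v b x • v`. The tilted vector takes the same value at `v`
and `x`, drops at the other vertices of `F`, and stays below at the vertices off `F` if the tilt is
small. So exactly `v` and `x` are maximal for it. -/
lemma Face.exists_edgeWith_max_slope {F : P.Face} {v : P.vertices} (hv : F.Contains v) {b : E3}
    (hb0 : b ≠ 0) (hb1 : ⟪(v : E3), b⟫ = 0) (hb2 : ⟪F.normal, b⟫ = 0) :
    ∃ G x, EdgeWith F G v x ∧ ∀ z, z ≠ v → z ≠ x → F.Contains z → slope v b z < slope v b x := by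
  classical
  -- Equal slopes at two vertices of `F` make `b + s • v` normal to the face, say `r • F.normal`.
  -- Since `b` is orthogonal to both `v` and `F.normal`, this gives `r * (1 - F.level ^ 2) = 0`,
  -- hence `b = 0`.
  have hinj : ∀ z z' : P.vertices, z ≠ v → z' ≠ v → F.Contains z → F.Contains z' →
      slope v b z = slope v b z' → z = z' := by
    intro z z' hz hz' hFz hFz' heq
    by_contra hne
    set s := slope v b z
    have h1 := inner_add_smul_sub hz b s
    have h2 := inner_add_smul_sub hz' b s
    rw [sub_self, mul_zero] at h1
    rw [← heq, sub_self, mul_zero] at h2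
    obtain ⟨r, hr⟩ := Face.exists_eq_smul_normal hz hz' hne hv hFz hFz' h1 h2
    have e1 : s = r * F.level := by
      have := congrArg (fun x => ⟪(v : E3), x⟫) hr
      simp only [inner_add_right, real_inner_smul_right, hb1, inner_vertex_self] at this
      rw [real_inner_comm, hv] at this
      linarith
    have e2 : s * F.level = r := by
      have := congrArg (fun x => ⟪F.normal, x⟫) hr
      simp only [inner_add_right, real_inner_smul_right, hb2, F.inner_normal_self] at this
      rw [hv] at this
      linarith
    have e3 : r * (1 - F.level ^ 2) = 0 := by rw [e1] at e2; linear_combination -e2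
    have e4 : r = 0 := (mul_eq_zero.1 e3).resolve_right (by linarith [F.level_sq_lt_one])
    rw [e4, zero_mul] at e1
    rw [e1, e4] at hr
    simp only [zero_smul, add_zero] at hr
    exact hb0 hr
  set Z : Finset P.vertices := Finset.univ.filter (fun z => z ≠ v ∧ F.Contains z) with hZ
  have memZ : ∀ z, z ∈ Z ↔ z ≠ v ∧ F.Contains z := by simp [hZ]
  obtain ⟨x, hx, hmax⟩ := Z.exists_max_image (slope v b) (by
    obtain ⟨z, hz, hzv, -⟩ := F.exists_contains_ne v v
    exact ⟨z, (memZ z).2 ⟨hzv, hz⟩⟩)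
  rw [memZ] at hx
  have hlt : ∀ z, z ≠ v → z ≠ x → F.Contains z → slope v b z < slope v b x := by
    intro z hz hzx hFz
    exact lt_of_le_of_ne (hmax z ((memZ z).2 ⟨hz, hFz⟩))
      fun h => hzx (hinj z x hz hx.1 hFz hx.2 h)
  set m := b + slope v b x • (v : E3) with hm
  have key : ∀ᶠ ε : ℝ in 𝓝[>] 0, ∀ z : P.vertices, ¬ F.Contains z →
      ⟪F.normal, (z : E3) - v⟫ + ε * ⟪m, (z : E3) - v⟫ < 0 := by
    rw [eventually_all]
    intro z
    by_cases hz : F.Contains z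
    · simp [hz]
    · have h1 := Face.inner_sub_neg hv hz
      have h2 : Tendsto (fun ε : ℝ => ⟪F.normal, (z : E3) - v⟫ + ε * ⟪m, (z : E3) - v⟫) (𝓝[>] 0)
          (𝓝 (⟪F.normal, (z : E3) - v⟫ + 0 * ⟪m, (z : E3) - v⟫)) := by
        apply Tendsto.mono_left _ nhdsWithin_le_nhds
        exact (Continuous.tendsto (by fun_prop) 0)
      filter_upwards [h2.eventually_lt_const (by simpa using h1)] with ε hε _
      exact hε
  obtain ⟨ε, hε, hε0⟩ := (key.and self_mem_nhdsWithin).exists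
  have hε0 : 0 < ε := hε0
  have hle : ∀ z : P.vertices, z ≠ v → z ≠ x → ⟪F.normal + ε • m, (z : E3) - v⟫ < 0 := by
    intro z hz hzx
    rw [inner_add_left, real_inner_smul_left]
    by_cases hFz : F.Contains z
    · rw [Face.inner_sub_eq_zero hv hFz, hm, inner_add_smul_sub hz]
      have h1 := hlt z hz hzx hFz
      have h2 := inner_vertex_lt_one hz.symm
      have h3 : (1 - ⟪(v : E3), (z : E3)⟫) * (slope v b z - slope v b x) < 0 := by nlinarith
      nlinarith
    · exact hε z hFz
  have heqx : ⟪F.normal + ε • m, (x : E3) - v⟫ = 0 := by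
    rw [inner_add_left, real_inner_smul_left, Face.inner_sub_eq_zero hv hx.2, hm,
      inner_add_smul_sub hx.1, sub_self]
    ring
  rw [inner_sub_right] at heqx
  have hmv : F.normal + ε • m ∈ P.normalCone v := by
    intro z
    by_cases hz : z = v
    · rw [hz]
    by_cases hzx : z = x
    · rw [hzx]; linarith
    · have := hle z hz hzx
      rw [inner_sub_right] at this
      linarith
  obtain ⟨F', G', hFG, -⟩ := exists_edgeWith hx.1.symm hmv
    (fun z => (hmv z).trans (by linarith)) (by
      intro z hz
      by_contra! hcon
      have := hle z hcon.1 hcon.2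
      rw [inner_sub_right, inner_eq_of_mem_normalCone hmv hz, sub_self] at this
      exact lt_irrefl _ this)
  rcases hFG.face_eq_or_eq hv hx.2 with rfl | rfl
  · exact ⟨G', x, hFG, hlt⟩
  · exact ⟨F', x, hFG.swap_faces, hlt⟩

/-- A face has two different edges at each of its vertices. -/
lemma Face.exists_two_edges {F : P.Face} {v : P.vertices} (hv : F.Contains v) :
    ∃ G x H y, EdgeWith F G v x ∧ EdgeWith F H v y ∧ x ≠ y := by
  obtain ⟨b, hb0, hb1, hb2⟩ := exists_ne_zero_orthogonal_pair (v : E3) F.normal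
  obtain ⟨G, x, hG, hx⟩ := Face.exists_edgeWith_max_slope hv hb0 hb1 hb2
  -- The direction `-b` selects the least slope; if both edges ended at the same vertex, a third
  -- vertex of `F` would lie both below and above it.
  obtain ⟨H, y, hH, hy⟩ := Face.exists_edgeWith_max_slope hv (neg_ne_zero.2 hb0)
    (by rw [inner_neg_right, hb1, neg_zero]) (by rw [inner_neg_right, hb2, neg_zero])
  refine ⟨G, x, H, y, hG, hH, ?_⟩
  rintro rfl
  obtain ⟨z, hz, hzv, hzx⟩ := F.exists_contains_ne v x
  have h1 := hx z hzv hzx hz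
  have h2 := hy z hzv hzx hz
  simp only [slope, inner_neg_left, neg_div] at h1 h2
  linarith

namespace EdgeWith

variable {F G H : P.Face} {v w x y z : P.vertices}

lemma not_contains_of_ne (h : EdgeWith F G v x) (h' : EdgeWith F H v y) (hxy : x ≠ y) :
    ¬ G.Contains y := fun hG =>
  (h.eq_or_eq_of_contains h'.left_snd hG).elim h'.vertex_ne.symm hxy.symm

/-- At a vertex `v`, a face is spanned by its two edges. -/
lemma exists_corner_combination (h : EdgeWith F G v x) (h' : EdgeWith F H v y) (hxy : x ≠ y)
    (hz : F.Contains z) :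
    ∃ s t : ℝ, 0 ≤ s ∧ 0 ≤ t ∧ (z : E3) - v = s • ((x : E3) - v) + t • ((y : E3) - v) := by
  obtain ⟨s, t, hst⟩ := exists_combination_of_orthogonal (a := (x : E3) - v) (b := (y : E3) - v)
    (x := (z : E3) - v) F.normal_ne_zero
    (vertex_sub_independent h.vertex_ne.symm h'.vertex_ne.symm hxy)
    (Face.inner_sub_eq_zero h.left_fst h.left_snd) (Face.inner_sub_eq_zero h.left_fst h'.left_snd)
    (Face.inner_sub_eq_zero h.left_fst hz)
  have h1 := Face.inner_sub_nonpos h.right_fst z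
  have h2 := Face.inner_sub_nonpos h'.right_fst z
  rw [hst, inner_add_right, inner_smul_right, inner_smul_right,
    Face.inner_sub_eq_zero h.right_fst h.right_snd] at h1
  rw [hst, inner_add_right, inner_smul_right, inner_smul_right,
    Face.inner_sub_eq_zero h'.right_fst h'.right_snd] at h2
  have h3 := Face.inner_sub_neg h.right_fst (h.not_contains_of_ne h' hxy)
  have h4 := Face.inner_sub_neg h'.right_fst (h'.not_contains_of_ne h hxy.symm)
  exact ⟨s, t, by nlinarith, by nlinarith, hst⟩

/-- A face has only two edges at each of its vertices. -/
lemma vertex_eq_or_eq {K : P.Face} (h : EdgeWith F G v x) (h' : EdgeWith F H v y) (hxy : x ≠ y)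
    (hz : EdgeWith F K v z) : z = x ∨ z = y := by
  obtain ⟨s, t, hs, ht, hst⟩ := h.exists_corner_combination h' hxy hz.left_snd
  by_contra! hne
  have h1 := Face.inner_sub_neg hz.right_fst (hz.not_contains_of_ne h hne.1)
  have h2 := Face.inner_sub_neg hz.right_fst (hz.not_contains_of_ne h' hne.2)
  have h3 := Face.inner_sub_eq_zero hz.right_fst hz.right_snd
  rw [hst, inner_add_right, inner_smul_right, inner_smul_right] at h3
  have hs0 : s = 0 := by nlinarith
  have ht0 : t = 0 := by nlinarith
  rw [hs0, ht0, zero_smul, zero_smul, add_zero, sub_eq_zero] at hst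
  exact hz.vertex_ne (Subtype.ext hst.symm)

/-- Here `z - v` is a nonnegative, nonzero combination of the two edge directions: a face whose two
edges at `v` both ascend lies above `v` everywhere else. -/
lemma inner_corner_pos (h : EdgeWith F G v x) (h' : EdgeWith F H v y) (hxy : x ≠ y)
    (hz : F.Contains z) (hzv : z ≠ v) {p : E3} (hx : 0 < ⟪p, (x : E3) - v⟫)
    (hy : 0 < ⟪p, (y : E3) - v⟫) : 0 < ⟪p, (z : E3) - v⟫ := by
  obtain ⟨s, t, hs, ht, hst⟩ := h.exists_corner_combination h' hxy hz
  have hne : (z : E3) - v ≠ 0 := fun h0 => hzv (Subtype.ext (sub_eq_zero.1 h0))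
  rw [hst, inner_add_right, inner_smul_right, inner_smul_right]
  rcases hs.eq_or_lt with rfl | hs
  · rcases ht.eq_or_lt with rfl | ht
    · simp [hst] at hne
    · nlinarith
  · nlinarith [mul_nonneg ht hy.le, mul_pos hs hx]

/-- If an edge at `v` does not have the largest slope, then one of its neighbours at `v` has a
larger slope. -/
lemma slope_le_of_neighbours {G₁ G₂ : P.Face} {y₁ y₂ : P.vertices} (h : EdgeWith F G v x)
    (h₁ : EdgeWith F G₁ v y₁) (hy₁ : y₁ ≠ x) (h₂ : EdgeWith G G₂ v y₂) (hy₂ : y₂ ≠ x) {p : E3}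
    (hs₁ : slope v p y₁ ≤ slope v p x) (hs₂ : slope v p y₂ ≤ slope v p x) (hz : z ≠ v) :
    slope v p z ≤ slope v p x := by
  have hx := inner_add_smul_sub h.vertex_ne.symm p (slope v p x)
  rw [sub_self, mul_zero] at hx
  -- The vector `p + slope v p x • v` is orthogonal to the edge, so it is a combination of the two
  -- face normals. The neighbour on one face detects the coefficient of the other face; both are
  -- nonnegative, so the vector lies in the normal cone, where the slope bound is global.
  obtain ⟨s, t, hst⟩ := h.exists_combination hx
  have e1 := inner_add_smul_sub h₁.vertex_ne.symm p (slope v p x)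
  have e2 := inner_add_smul_sub h₂.vertex_ne.symm p (slope v p x)
  rw [hst, inner_add_left, real_inner_smul_left, real_inner_smul_left] at e1 e2
  rw [Face.inner_sub_eq_zero h₁.left_fst h₁.left_snd] at e1
  rw [Face.inner_sub_eq_zero h₂.left_fst h₂.left_snd] at e2
  have n1 := Face.inner_sub_neg h.right_fst (h.not_contains_of_ne h₁ hy₁.symm)
  have n2 := Face.inner_sub_neg h.left_fst (h.swap_faces.not_contains_of_ne h₂ hy₂.symm)
  have l1 := inner_vertex_lt_one h₁.vertex_ne
  have l2 := inner_vertex_lt_one h₂.vertex_ne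
  have ht : 0 ≤ t := by
    have : t * ⟪G.normal, (y₁ : E3) - v⟫ ≤ 0 := by nlinarith
    nlinarith
  have hs : 0 ≤ s := by
    have : s * ⟪F.normal, (y₂ : E3) - v⟫ ≤ 0 := by nlinarith
    nlinarith
  have := h.combination_mem hs ht
  rw [← hst, add_smul_mem_normalCone_iff] at this
  exact this z hz

end EdgeWith

end IdealPolyhedron

/-! ### Spherical arcs -/

lemma cos_angle_of_norm_eq_one {a b : E3} (ha : ‖a‖ = 1) (hb : ‖b‖ = 1) :
    Real.cos (angle a b) = ⟪a, b⟫ := by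
  rw [cos_angle, ha, hb, mul_one, div_one]

lemma angle_eq_of_inner_eq_cos {a b : E3} (ha : ‖a‖ = 1) (hb : ‖b‖ = 1) {t : ℝ} (h0 : 0 ≤ t)
    (h1 : t ≤ Real.pi) (h : ⟪a, b⟫ = Real.cos t) : angle a b = t := by
  rw [angle, ha, hb, mul_one, div_one, h, Real.arccos_cos h0 h1]

lemma inner_eq_zero_iff_ne {a : E3} (ha : ‖a‖ = 1) : a ≠ 0 := by
  rintro rfl; simp at ha

lemma angle_eq_zero_of_norm_eq_one {a b : E3} (ha : ‖a‖ = 1) (hb : ‖b‖ = 1) :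
    angle a b = 0 ↔ a = b := by
  constructor
  · intro h
    have := cos_angle_of_norm_eq_one ha hb
    rw [h, Real.cos_zero] at this
    exact (inner_eq_one_iff_of_norm_eq_one (𝕜 := ℝ) ha hb).1 this.symm
  · rintro rfl
    exact angle_self (inner_eq_zero_iff_ne ha)

lemma angle_eq_pi_of_norm_eq_one {a b : E3} (ha : ‖a‖ = 1) (hb : ‖b‖ = 1) :
    angle a b = Real.pi ↔ a = -b := by
  rw [← angle_eq_zero_of_norm_eq_one ha (by rwa [norm_neg]), angle_neg_right]
  constructor <;> intro h <;> linarith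

lemma norm_sub_le_angle {a b : E3} (ha : ‖a‖ = 1) (hb : ‖b‖ = 1) : ‖a - b‖ ≤ angle a b := by
  have h1 : ‖a - b‖ ^ 2 = 2 - 2 * Real.cos (angle a b) := by
    rw [cos_angle_of_norm_eq_one ha hb, norm_sub_sq_real, ha, hb]; ring
  have h2 := Real.one_sub_sq_div_two_le_cos (x := angle a b)
  exact (pow_le_pow_iff_left₀ (norm_nonneg _) (angle_nonneg _ _) two_ne_zero).1 (by linarith)

lemma angle_eq_add_of_mem_cone {a b x : E3} (hx : x ≠ 0) {s t : ℝ} (hs : 0 ≤ s) (ht : 0 ≤ t)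
    (h : x = s • a + t • b) : angle a b = angle a x + angle x b := by
  refine angle_eq_angle_add_add_angle_add_of_mem_span hx ?_
  rw [Submodule.mem_span_pair]
  exact ⟨⟨s, hs⟩, ⟨t, ht⟩, h.symm⟩

/-- Equality in the triangle inequality for angles, away from antipodal ends, means lying in the
cone of the ends. In this form arcs are open to linear algebra. -/
lemma mem_sphericalArc_iff {a b x : E3} (hab : angle a b ≠ Real.pi) :
    x ∈ sphericalArc a b ↔ ‖x‖ = 1 ∧ ∃ s t : ℝ, 0 ≤ s ∧ 0 ≤ t ∧ x = s • a + t • b := by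
  constructor
  · rintro ⟨h1, h2⟩
    refine ⟨h1, ?_⟩
    have := ((angle_eq_angle_add_angle_iff (inner_eq_zero_iff_ne h1)).1 h2.symm).resolve_left hab
    rw [Submodule.mem_span_pair] at this
    obtain ⟨s, t, h⟩ := this
    exact ⟨s, t, s.2, t.2, h.symm⟩
  · rintro ⟨h1, s, t, hs, ht, h⟩
    exact ⟨h1, (angle_eq_add_of_mem_cone (inner_eq_zero_iff_ne h1) hs ht h).symm⟩

lemma left_mem_sphericalArc {a : E3} (ha : ‖a‖ = 1) (b : E3) : a ∈ sphericalArc a b :=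
  ⟨ha, by rw [angle_self (inner_eq_zero_iff_ne ha), zero_add]⟩

lemma sphericalArc_comm (a b : E3) : sphericalArc a b = sphericalArc b a := by
  ext x
  simp only [sphericalArc, mem_ofPred_eq, angle_comm b x, angle_comm x a, angle_comm b a]
  rw [add_comm]

/-! ### Unit-speed parametrisation of arcs -/

/-- The first coefficient of the point at distance `t` from the start on an arc of length `θ`. -/
noncomputable def arcFst (θ t : ℝ) : ℝ := Real.sin (θ - t) / Real.sin θ

/-- The second coefficient of the point at distance `t` from the start on an arc of length `θ`. -/
noncomputable def arcSnd (θ t : ℝ) : ℝ := Real.sin t / Real.sin θ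

/-- The point at distance `t` from `a` on the arc from `a` to `b`. -/
noncomputable def arcPoint (a b : E3) (t : ℝ) : E3 :=
  arcFst (angle a b) t • a + arcSnd (angle a b) t • b

section arcPoint

variable {a b : E3}

lemma arcFst_nonneg {θ t : ℝ} (h1 : θ < Real.pi) (ht0 : 0 ≤ t) (ht1 : t ≤ θ) : 0 ≤ arcFst θ t :=
  div_nonneg (Real.sin_nonneg_of_nonneg_of_le_pi (by linarith) (by linarith))
    (Real.sin_nonneg_of_nonneg_of_le_pi (by linarith) (by linarith))

lemma arcSnd_nonneg {θ t : ℝ} (h1 : θ < Real.pi) (ht0 : 0 ≤ t) (ht1 : t ≤ θ) : 0 ≤ arcSnd θ t :=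
  div_nonneg (Real.sin_nonneg_of_nonneg_of_le_pi (by linarith) (by linarith))
    (Real.sin_nonneg_of_nonneg_of_le_pi (by linarith) (by linarith))

lemma arcFst_zero {θ : ℝ} (h0 : 0 < θ) (h1 : θ < Real.pi) : arcFst θ 0 = 1 := by
  rw [arcFst, sub_zero, div_self (Real.sin_pos_of_pos_of_lt_pi h0 h1).ne']

lemma arcSnd_zero (θ : ℝ) : arcSnd θ 0 = 0 := by simp [arcSnd]

lemma arcFst_self (θ : ℝ) : arcFst θ θ = 0 := by simp [arcFst]

lemma arcSnd_self {θ : ℝ} (h0 : 0 < θ) (h1 : θ < Real.pi) : arcSnd θ θ = 1 := by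
  rw [arcSnd, div_self (Real.sin_pos_of_pos_of_lt_pi h0 h1).ne']

lemma continuous_arcFst (θ : ℝ) : Continuous (arcFst θ) := by
  unfold arcFst; fun_prop

lemma continuous_arcSnd (θ : ℝ) : Continuous (arcSnd θ) := by
  unfold arcSnd; fun_prop

lemma continuous_arcPoint (a b : E3) : Continuous (arcPoint a b) :=
  ((continuous_arcFst _).smul continuous_const).add ((continuous_arcSnd _).smul continuous_const)

/-- The coefficients are those of spherical linear interpolation, and the identity reduces to the
addition theorems. It shows that the parametrisation has unit length and unit speed. -/
lemma inner_arcPoint (ha : ‖a‖ = 1) (hb : ‖b‖ = 1) (h0 : 0 < angle a b) (h1 : angle a b < Real.pi)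
    (s t : ℝ) : ⟪arcPoint a b s, arcPoint a b t⟫ = Real.cos (s - t) := by
  have hs : Real.sin (angle a b) ≠ 0 := (Real.sin_pos_of_pos_of_lt_pi h0 h1).ne'
  have haa : ⟪a, a⟫ = 1 := by rw [real_inner_self_eq_norm_sq, ha]; norm_num
  have hbb : ⟪b, b⟫ = 1 := by rw [real_inner_self_eq_norm_sq, hb]; norm_num
  have hba := real_inner_comm a b
  have hab := cos_angle_of_norm_eq_one ha hb
  simp only [arcPoint, inner_add_left, inner_add_right, real_inner_smul_left,
    real_inner_smul_right, haa, hbb, hba, ← hab, arcFst, arcSnd]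
  rw [Real.sin_sub, Real.sin_sub, Real.cos_sub]
  have := Real.sin_sq_add_cos_sq (angle a b)
  field_simp
  linear_combination (Real.sin s * Real.sin t) * -this

lemma norm_arcPoint (ha : ‖a‖ = 1) (hb : ‖b‖ = 1) (h0 : 0 < angle a b) (h1 : angle a b < Real.pi)
    (t : ℝ) : ‖arcPoint a b t‖ = 1 := by
  have := inner_arcPoint ha hb h0 h1 t t
  rw [sub_self, Real.cos_zero, real_inner_self_eq_norm_sq] at this
  exact (pow_eq_one_iff_of_nonneg (norm_nonneg _) two_ne_zero).1 this

lemma arcPoint_zero (h0 : 0 < angle a b) (h1 : angle a b < Real.pi) : arcPoint a b 0 = a := by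
  rw [arcPoint, arcFst_zero h0 h1, arcSnd_zero, one_smul, zero_smul, add_zero]

lemma arcPoint_angle (h0 : 0 < angle a b) (h1 : angle a b < Real.pi) :
    arcPoint a b (angle a b) = b := by
  rw [arcPoint, arcFst_self, arcSnd_self h0 h1, one_smul, zero_smul, zero_add]

lemma angle_arcPoint (ha : ‖a‖ = 1) (hb : ‖b‖ = 1) (h0 : 0 < angle a b) (h1 : angle a b < Real.pi)
    {s t : ℝ} (hs : s ∈ Icc 0 (angle a b)) (ht : t ∈ Icc 0 (angle a b)) :
    angle (arcPoint a b s) (arcPoint a b t) = |s - t| := by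
  refine angle_eq_of_inner_eq_cos (norm_arcPoint ha hb h0 h1 s) (norm_arcPoint ha hb h0 h1 t)
    (abs_nonneg _) ?_ ?_
  · rw [abs_le]
    constructor <;> linarith [hs.1, hs.2, ht.1, ht.2]
  · rw [inner_arcPoint ha hb h0 h1, Real.cos_abs]

lemma angle_left_arcPoint (ha : ‖a‖ = 1) (hb : ‖b‖ = 1) (h0 : 0 < angle a b)
    (h1 : angle a b < Real.pi) {t : ℝ} (ht : t ∈ Icc 0 (angle a b)) :
    angle a (arcPoint a b t) = t := by
  have := angle_arcPoint ha hb h0 h1 (left_mem_Icc.2 h0.le) ht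
  rwa [arcPoint_zero h0 h1, zero_sub, abs_neg, abs_of_nonneg ht.1] at this

lemma arcPoint_mem (ha : ‖a‖ = 1) (hb : ‖b‖ = 1) (h0 : 0 < angle a b)
    (h1 : angle a b < Real.pi) {t : ℝ} (ht : t ∈ Icc 0 (angle a b)) :
    arcPoint a b t ∈ sphericalArc a b := by
  rw [mem_sphericalArc_iff h1.ne]
  exact ⟨norm_arcPoint ha hb h0 h1 t, _, _, arcFst_nonneg h1 ht.1 ht.2,
    arcSnd_nonneg h1 ht.1 ht.2, rfl⟩

lemma angle_mem_Icc_of_mem {x : E3} (hx : x ∈ sphericalArc a b) : angle a x ∈ Icc 0 (angle a b) :=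
  ⟨angle_nonneg _ _, by rw [← hx.2]; linarith [angle_nonneg x b]⟩

/-- The cosines of the angles from `x` to the two ends form a linear system for the coefficients of
`x`, with determinant `sin² (angle a b)`, and `arcFst`, `arcSnd` are its solution. -/
lemma arcPoint_angle_of_mem (ha : ‖a‖ = 1) (hb : ‖b‖ = 1) (h0 : 0 < angle a b)
    (h1 : angle a b < Real.pi) {x : E3} (hx : x ∈ sphericalArc a b) :
    arcPoint a b (angle a x) = x := by
  obtain ⟨hx1, s, t, hs, ht, hst⟩ := (mem_sphericalArc_iff h1.ne).1 hx
  have haa : ⟪a, a⟫ = 1 := by rw [real_inner_self_eq_norm_sq, ha]; norm_num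
  have hbb : ⟪b, b⟫ = 1 := by rw [real_inner_self_eq_norm_sq, hb]; norm_num
  have hab := cos_angle_of_norm_eq_one ha hb
  have e1 : Real.cos (angle a x) = s + t * Real.cos (angle a b) := by
    rw [cos_angle_of_norm_eq_one ha hx1, hst, inner_add_right, inner_smul_right, inner_smul_right,
      haa, hab]
    ring
  have e2 : Real.cos (angle a b - angle a x) = s * Real.cos (angle a b) + t := by
    have : angle a b - angle a x = angle x b := by rw [← hx.2]; ring
    rw [this, cos_angle_of_norm_eq_one hx1 hb, hst, inner_add_left, real_inner_smul_left,
      real_inner_smul_left, hbb, hab]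
    ring
  have hs' : Real.sin (angle a b) ≠ 0 := (Real.sin_pos_of_pos_of_lt_pi h0 h1).ne'
  have hsc := Real.sin_sq_add_cos_sq (angle a b)
  rw [Real.cos_sub] at e2
  have e3 : arcSnd (angle a b) (angle a x) = t := by
    rw [arcSnd, div_eq_iff hs']
    apply mul_left_cancel₀ hs'
    linear_combination e2 - Real.cos (angle a b) * e1 - t * hsc
  have e4 : arcFst (angle a b) (angle a x) = s := by
    rw [arcFst, div_eq_iff hs', Real.sin_sub]
    rw [arcSnd, div_eq_iff hs'] at e3
    linear_combination Real.sin (angle a b) * e1 - Real.cos (angle a b) * e3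
  rw [arcPoint, e3, e4, ← hst]

end arcPoint

namespace IdealPolyhedron

variable {P : IdealPolyhedron}

/-! ### Normals of faces at a vertex -/

/-- The first component of the outward unit normal of a face in Minkowski space. -/
noncomputable def Face.conormal (F : P.Face) : E3 := (√(1 - F.level ^ 2))⁻¹ • F.normal

lemma Face.sqrt_pos (F : P.Face) : 0 < √(1 - F.level ^ 2) :=
  Real.sqrt_pos.2 (by linarith [F.level_sq_lt_one])

lemma Face.conormal_mem_normalCone_iff (F : P.Face) (v : P.vertices) :
    F.conormal ∈ P.normalCone v ↔ F.Contains v := by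
  rw [Face.conormal, smul_mem_normalCone_iff (inv_pos.2 F.sqrt_pos),
    F.normal_mem_normalCone_iff]

lemma Face.norm_sub_level {F : P.Face} {v : P.vertices} (hv : F.Contains v) :
    ‖F.normal - F.level • (v : E3)‖ = √(1 - F.level ^ 2) := by
  rw [eq_comm, Real.sqrt_eq_iff_eq_sq (by linarith [F.level_sq_lt_one]) (norm_nonneg _),
    norm_sub_sq_real, F.norm_normal, inner_smul_right, hv, norm_smul, norm_vertex,
    Real.norm_eq_abs, mul_one, sq_abs]
  ring

/-- The norm in the definition of `normalAt` is the same at every vertex of `F`. All the normals of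
`F` are therefore projections of one vector, which makes different vertices comparable. -/
lemma Face.normalAt_eq {F : P.Face} {v : P.vertices} (hv : F.Contains v) :
    F.normalAt v = F.conormal - ⟪F.conormal, (v : E3)⟫ • (v : E3) := by
  rw [Face.normalAt, Face.norm_sub_level hv, Face.conormal, real_inner_smul_left, hv, smul_sub,
    smul_smul]

lemma Face.norm_normalAt {F : P.Face} {v : P.vertices} (hv : F.Contains v) :
    ‖F.normalAt v‖ = 1 := by
  rw [Face.normalAt, norm_smul, norm_inv, norm_norm]
  apply inv_mul_cancel₀
  rw [Face.norm_sub_level hv]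
  exact F.sqrt_pos.ne'

lemma Face.inner_normalAt {F : P.Face} {v : P.vertices} (hv : F.Contains v) :
    ⟪F.normalAt v, (v : E3)⟫ = 0 := by
  rw [Face.normalAt_eq hv, inner_sub_left, real_inner_smul_left, inner_vertex_self]
  ring

lemma Face.conormal_eq {F : P.Face} {v : P.vertices} (hv : F.Contains v) :
    F.conormal = F.normalAt v + ⟪F.conormal, (v : E3)⟫ • (v : E3) := by
  rw [Face.normalAt_eq hv, sub_add_cancel]

lemma Face.slope_normalAt {F : P.Face} {v z : P.vertices} (hv : F.Contains v) (hz : z ≠ v) :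
    slope v (F.normalAt v) z ≤ ⟪F.conormal, (v : E3)⟫ := by
  have := (F.conormal_mem_normalCone_iff v).2 hv
  rw [Face.conormal_eq hv, add_smul_mem_normalCone_iff] at this
  exact this z hz

lemma Face.slope_normalAt_eq_iff {F : P.Face} {v z : P.vertices} (hv : F.Contains v) (hz : z ≠ v) :
    slope v (F.normalAt v) z = ⟪F.conormal, (v : E3)⟫ ↔ F.Contains z := by
  rw [← F.conormal_mem_normalCone_iff]
  have := (F.conormal_mem_normalCone_iff v).2 hv
  nth_rewrite 2 [Face.conormal_eq hv]
  rw [Face.conormal_eq hv] at this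
  rw [add_smul_mem_normalCone_iff_slope_eq hz this]

/-- A face at a vertex is determined by its normal there. -/
lemma Face.normalAt_injective {F G : P.Face} {v : P.vertices} (hF : F.Contains v)
    (hG : G.Contains v) (h : F.normalAt v = G.normalAt v) : F = G := by
  have key : ∀ {F G : P.Face}, F.Contains v → G.Contains v → F.normalAt v = G.normalAt v →
      ⟪F.conormal, (v : E3)⟫ ≤ ⟪G.conormal, (v : E3)⟫ := by
    intro F G hF hG h
    obtain ⟨z, hz, hzv, -⟩ := F.exists_contains_ne v v
    rw [← (Face.slope_normalAt_eq_iff hF hzv).2 hz, h]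
    exact Face.slope_normalAt hG hzv
  have h1 : F.conormal = G.conormal := by
    rw [Face.conormal_eq hF, Face.conormal_eq hG, h,
      le_antisymm (key hF hG h) (key hG hF h.symm)]
  exact Face.eq_of_smul_eq (inv_pos.2 F.sqrt_pos) (inv_pos.2 G.sqrt_pos) h1

/-- The angle between the normals of two faces at a common vertex does not depend on the vertex. -/
lemma Face.angle_normalAt {F G : P.Face} {v : P.vertices} (hF : F.Contains v)
    (hG : G.Contains v) : angle (F.normalAt v) (G.normalAt v) = exteriorDihedralAngle F G := by
  rw [angle, Face.norm_normalAt hF, Face.norm_normalAt hG, mul_one, div_one,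
    exteriorDihedralAngle, Face.normalAt, Face.normalAt, Face.norm_sub_level hF,
    Face.norm_sub_level hG]
  congr 1
  -- Since `v` is a unit vector with `⟪F.normal, v⟫ = F.level` and `⟪G.normal, v⟫ = G.level`, the
  -- product of the unnormalised normals at `v` is the Lorentz product, and `v` drops out.
  rw [real_inner_smul_left, real_inner_smul_right, inner_sub_left, inner_sub_right,
    inner_sub_right, real_inner_smul_left, real_inner_smul_left, real_inner_smul_right,
    real_inner_smul_right, inner_vertex_self, hF, real_inner_comm G.normal (v : E3), hG]
  field_simp
  ring

lemma exteriorDihedralAngle_comm (F G : P.Face) :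
    exteriorDihedralAngle F G = exteriorDihedralAngle G F := by
  rw [exteriorDihedralAngle, exteriorDihedralAngle, real_inner_comm, mul_comm F.level,
    mul_comm (√(1 - F.level ^ 2))]

namespace EdgeWith

variable {F G : P.Face} {v w z : P.vertices}

lemma conormals_independent (h : EdgeWith F G v w) (s t : ℝ)
    (hst : s • F.conormal + t • G.conormal = 0) : s = 0 ∧ t = 0 := by
  rw [Face.conormal, Face.conormal, smul_smul, smul_smul] at hst
  obtain ⟨h1, h2⟩ := h.normals_independent _ _ hst
  exact ⟨(mul_eq_zero.1 h1).resolve_right (inv_pos.2 F.sqrt_pos).ne',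
    (mul_eq_zero.1 h2).resolve_right (inv_pos.2 G.sqrt_pos).ne'⟩

/-- A relation between the projections is a relation between the conormals up to a multiple `k • v`.
Pairing with `w - v` kills the conormals but not `v`, so `k = 0`. -/
lemma normalAt_independent (h : EdgeWith F G v w) (s t : ℝ)
    (hst : s • F.normalAt v + t • G.normalAt v = 0) : s = 0 ∧ t = 0 := by
  rw [Face.normalAt_eq h.left_fst, Face.normalAt_eq h.right_fst] at hst
  set k := s * ⟪F.conormal, (v : E3)⟫ + t * ⟪G.conormal, (v : E3)⟫ with hk
  have h1 : s • F.conormal + t • G.conormal = k • (v : E3) := by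
    rw [← sub_eq_zero, ← hst, hk]; module
  have c : ∀ K : P.Face, K.Contains v → K.Contains w → ⟪K.conormal, (w : E3) - v⟫ = 0 := by
    intro K hv hw
    rw [Face.conormal, real_inner_smul_left, Face.inner_sub_eq_zero hv hw, mul_zero]
  have h2 := congrArg (fun x => ⟪x, (w : E3) - v⟫) h1
  simp only [inner_add_left, real_inner_smul_left, c F h.left_fst h.left_snd,
    c G h.right_fst h.right_snd, mul_zero, add_zero] at h2
  rw [inner_sub_right, inner_vertex_self] at h2
  have h3 := inner_vertex_lt_one h.vertex_ne
  have h4 : k = 0 := (mul_eq_zero.1 h2.symm).resolve_right (by linarith)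
  rw [h4, zero_smul] at h1
  exact h.conormals_independent s t h1

lemma angle_eq (h : EdgeWith F G v w) :
    angle (F.normalAt v) (G.normalAt v) = exteriorDihedralAngle F G :=
  Face.angle_normalAt h.left_fst h.right_fst

lemma norm_left (h : EdgeWith F G v w) : ‖F.normalAt v‖ = 1 := Face.norm_normalAt h.left_fst

lemma norm_right (h : EdgeWith F G v w) : ‖G.normalAt v‖ = 1 := Face.norm_normalAt h.right_fst

lemma exterior_pos (h : EdgeWith F G v w) : 0 < exteriorDihedralAngle F G := by
  rw [← h.angle_eq]
  refine lt_of_le_of_ne (angle_nonneg _ _) fun h0 => ?_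
  have h1 := (angle_eq_zero_of_norm_eq_one h.norm_left h.norm_right).1 h0.symm
  have := h.normalAt_independent 1 (-1) (by rw [h1]; module)
  linarith [this.1]

lemma exterior_lt_pi (h : EdgeWith F G v w) : exteriorDihedralAngle F G < Real.pi := by
  rw [← h.angle_eq]
  refine lt_of_le_of_ne (angle_le_pi _ _) fun h0 => ?_
  have h1 := (angle_eq_pi_of_norm_eq_one h.norm_left h.norm_right).1 h0
  have := h.normalAt_independent 1 1 (by rw [h1]; module)
  linarith [this.1]

lemma angle_pos (h : EdgeWith F G v w) : 0 < angle (F.normalAt v) (G.normalAt v) := by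
  rw [h.angle_eq]; exact h.exterior_pos

lemma angle_lt_pi (h : EdgeWith F G v w) : angle (F.normalAt v) (G.normalAt v) < Real.pi := by
  rw [h.angle_eq]; exact h.exterior_lt_pi

lemma mem_dualSide_iff (h : EdgeWith F G v w) {x : E3} :
    x ∈ dualSide F G v ↔ ‖x‖ = 1 ∧ ∃ s t : ℝ, 0 ≤ s ∧ 0 ≤ t ∧
      x = s • F.normalAt v + t • G.normalAt v :=
  mem_sphericalArc_iff h.angle_lt_pi.ne

lemma dualSide_subset_equator (h : EdgeWith F G v w) : dualSide F G v ⊆ equator (v : E3) := by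
  intro x hx
  obtain ⟨h1, s, t, -, -, rfl⟩ := h.mem_dualSide_iff.1 hx
  refine ⟨h1, ?_⟩
  rw [inner_add_right, inner_smul_right, inner_smul_right, real_inner_comm,
    Face.inner_normalAt h.left_fst, real_inner_comm, Face.inner_normalAt h.right_fst]
  ring

/-- The edge in Minkowski space: lifting a combination of the normals at a vertex. -/
lemma combination_normalAt (h : EdgeWith F G v w) (s t : ℝ) :
    s • F.conormal + t • G.conormal = (s • F.normalAt v + t • G.normalAt v) +
      ⟪s • F.conormal + t • G.conormal, (v : E3)⟫ • (v : E3) := by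
  rw [Face.normalAt_eq h.left_fst, Face.normalAt_eq h.right_fst, inner_add_left,
    real_inner_smul_left, real_inner_smul_left]
  module

lemma conormal_combination_mem (h : EdgeWith F G v w) {s t : ℝ} (hs : 0 ≤ s) (ht : 0 ≤ t) :
    s • F.conormal + t • G.conormal ∈ P.normalCone v := by
  rw [Face.conormal, Face.conormal, smul_smul, smul_smul]
  exact h.combination_mem (mul_nonneg hs (inv_pos.2 F.sqrt_pos).le)
    (mul_nonneg ht (inv_pos.2 G.sqrt_pos).le)

lemma exists_conormal_combination (h : EdgeWith F G v w) {p : E3} (hv : p ∈ P.normalCone v)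
    (hw : p ∈ P.normalCone w) :
    ∃ s t : ℝ, 0 ≤ s ∧ 0 ≤ t ∧ p = s • F.conormal + t • G.conormal := by
  obtain ⟨s, t, hs, ht, hp⟩ := h.exists_nonneg_combination hv hw
  refine ⟨s * √(1 - F.level ^ 2), t * √(1 - G.level ^ 2), mul_nonneg hs F.sqrt_pos.le,
    mul_nonneg ht G.sqrt_pos.le, ?_⟩
  rw [Face.conormal, Face.conormal, smul_smul, smul_smul, mul_assoc, mul_assoc,
    mul_inv_cancel₀ F.sqrt_pos.ne', mul_inv_cancel₀ G.sqrt_pos.ne', mul_one, mul_one, hp]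

lemma eq_or_eq_of_conormal_mem (h : EdgeWith F G v w) {s t : ℝ} (hs : 0 < s) (ht : 0 < t)
    (hz : s • F.conormal + t • G.conormal ∈ P.normalCone z) : z = v ∨ z = w := by
  rw [Face.conormal, Face.conormal, smul_smul, smul_smul] at hz
  exact h.eq_or_eq_of_mem (mul_pos hs (inv_pos.2 F.sqrt_pos)) (mul_pos ht (inv_pos.2 G.sqrt_pos)) hz

end EdgeWith

end IdealPolyhedron

/-! ### Normalisation of vectors -/

lemma norm_normalize_sub_le {E : Type*} [NormedAddCommGroup E] [NormedSpace ℝ E] {x y : E} {δ : ℝ}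
    (hδ : 0 < δ) (hx : δ ≤ ‖x‖) (hy : δ ≤ ‖y‖) :
    ‖‖x‖⁻¹ • x - ‖y‖⁻¹ • y‖ ≤ 2 / δ * ‖x - y‖ := by
  have hx0 : 0 < ‖x‖ := hδ.trans_le hx
  have hy0 : 0 < ‖y‖ := hδ.trans_le hy
  have h1 : ‖x‖⁻¹ • x - ‖y‖⁻¹ • y = ‖x‖⁻¹ • (x - y) + (‖x‖⁻¹ * (‖y‖ - ‖x‖) * ‖y‖⁻¹) • y := by
    have : ‖x‖⁻¹ * (‖y‖ - ‖x‖) * ‖y‖⁻¹ = ‖x‖⁻¹ - ‖y‖⁻¹ := by field_simp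
    rw [this]; module
  have h2 : |‖y‖ - ‖x‖| ≤ ‖x - y‖ := by
    rw [norm_sub_rev]; exact abs_norm_sub_norm_le y x
  have h3 : ‖x‖⁻¹ ≤ δ⁻¹ := inv_anti₀ hδ hx
  calc _ ≤ ‖‖x‖⁻¹ • (x - y)‖ + ‖(‖x‖⁻¹ * (‖y‖ - ‖x‖) * ‖y‖⁻¹) • y‖ := by rw [h1]; exact norm_add_le _ _
    _ = ‖x‖⁻¹ * ‖x - y‖ + ‖x‖⁻¹ * |‖y‖ - ‖x‖| := by
        rw [norm_smul, norm_smul, norm_mul, norm_mul, norm_inv, norm_inv, norm_norm, norm_norm,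
          Real.norm_eq_abs, mul_assoc, mul_assoc, inv_mul_cancel₀ hy0.ne', mul_one]
    _ ≤ δ⁻¹ * ‖x - y‖ + δ⁻¹ * ‖x - y‖ := by gcongr
    _ = _ := by ring

namespace IdealPolyhedron

variable {P : IdealPolyhedron}

/-! ### Lifting half-spaces to normal cones -/

/-- The vertices different from `v`. -/
noncomputable def others (v : P.vertices) : Finset P.vertices := Finset.univ.erase v

lemma mem_others {v z : P.vertices} : z ∈ others v ↔ z ≠ v := by simp [others]

lemma others_nonempty (v : P.vertices) : (others v).Nonempty := by
  obtain ⟨z, hz, -⟩ := exists_vertex_ne v v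
  exact ⟨z, mem_others.2 hz⟩

/-- The height by which `lift v` translates `y` in the direction `v`. -/
noncomputable def liftHeight (v : P.vertices) (y : E3) : ℝ :=
  (others v).sup' (others_nonempty v) fun z => ⟪y, (z : E3)⟫ / (1 - ⟪(v : E3), (z : E3)⟫)

/-- A homeomorphism from the half-space `0 ≤ ⟪y, v⟫` onto the normal cone at `v`, which is the
identity modulo `v`. -/
noncomputable def lift (v : P.vertices) (y : E3) : E3 := y + liftHeight v y • (v : E3)

/-- The largest value of `⟪x, ·⟫` on the vertices different from `v`. -/
noncomputable def flatHeight (v : P.vertices) (x : E3) : ℝ :=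
  (others v).sup' (others_nonempty v) fun z => ⟪x, (z : E3)⟫

/-- The inverse of `lift v`. -/
noncomputable def flat (v : P.vertices) (x : E3) : E3 := x - flatHeight v x • (v : E3)

section lift

variable {v w z : P.vertices} {x y : E3}

lemma le_liftHeight (hz : z ≠ v) (y : E3) :
    ⟪y, (z : E3)⟫ ≤ liftHeight v y * (1 - ⟪(v : E3), (z : E3)⟫) := by
  have h1 := inner_vertex_lt_one hz.symm
  rw [← div_le_iff₀ (by linarith)]
  exact Finset.le_sup' (fun z : P.vertices => ⟪y, (z : E3)⟫ / (1 - ⟪(v : E3), (z : E3)⟫))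
    (mem_others.2 hz)

lemma exists_eq_liftHeight (v : P.vertices) (y : E3) :
    ∃ z, z ≠ v ∧ ⟪y, (z : E3)⟫ = liftHeight v y * (1 - ⟪(v : E3), (z : E3)⟫) := by
  obtain ⟨z, hz, h⟩ := Finset.exists_mem_eq_sup' (others_nonempty v)
    (fun z => ⟪y, (z : E3)⟫ / (1 - ⟪(v : E3), (z : E3)⟫))
  rw [mem_others] at hz
  have h1 := inner_vertex_lt_one hz.symm
  refine ⟨z, hz, ?_⟩
  rw [liftHeight, h, div_mul_cancel₀]
  linarith

lemma le_flatHeight (hz : z ≠ v) (x : E3) : ⟪x, (z : E3)⟫ ≤ flatHeight v x :=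
  Finset.le_sup' (fun z : P.vertices => ⟪x, (z : E3)⟫) (mem_others.2 hz)

lemma exists_eq_flatHeight (v : P.vertices) (x : E3) :
    ∃ z, z ≠ v ∧ ⟪x, (z : E3)⟫ = flatHeight v x := by
  obtain ⟨z, hz, h⟩ := Finset.exists_mem_eq_sup' (others_nonempty v) (fun z => ⟪x, (z : E3)⟫)
  exact ⟨z, mem_others.1 hz, h.symm⟩

/-- The bounds `⟪x, z⟫ ≤ c` say the same as `⟪x - c • v, z⟫ ≤ c * (1 - ⟪v, z⟫)`. Hence the suprema
defining `flatHeight` at `x` and `liftHeight` at `flat v x` coincide and are attained at the same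
vertices. -/
lemma lift_flat (v : P.vertices) (x : E3) : lift v (flat v x) = x := by
  have h : liftHeight v (flat v x) = flatHeight v x := by
    have e : ∀ z : P.vertices, ⟪flat v x, (z : E3)⟫ = ⟪x, (z : E3)⟫ -
        flatHeight v x * ⟪(v : E3), (z : E3)⟫ := by
      intro z; rw [flat, inner_sub_left, real_inner_smul_left]
    apply le_antisymm
    · obtain ⟨z, hz, h⟩ := exists_eq_liftHeight v (flat v x)
      have h1 := inner_vertex_lt_one hz.symm
      have h2 := le_flatHeight hz x
      rw [e] at h
      nlinarith
    · obtain ⟨z, hz, h⟩ := exists_eq_flatHeight v x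
      have h1 := inner_vertex_lt_one hz.symm
      have h2 := le_liftHeight hz (flat v x)
      rw [e, h] at h2
      nlinarith
  rw [lift, h, flat, sub_add_cancel]

lemma flat_lift (v : P.vertices) (y : E3) : flat v (lift v y) = y := by
  have h : flatHeight v (lift v y) = liftHeight v y := by
    have e : ∀ z : P.vertices, ⟪lift v y, (z : E3)⟫ = ⟪y, (z : E3)⟫ +
        liftHeight v y * ⟪(v : E3), (z : E3)⟫ := by
      intro z; rw [lift, inner_add_left, real_inner_smul_left]
    apply le_antisymm
    · obtain ⟨z, hz, h⟩ := exists_eq_flatHeight v (lift v y)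
      have h2 := le_liftHeight hz y
      rw [e] at h
      linarith
    · obtain ⟨z, hz, h⟩ := exists_eq_liftHeight v y
      have h2 := le_flatHeight hz (lift v y)
      rw [e, h] at h2
      linarith
  rw [flat, h, lift, add_sub_cancel_right]

lemma liftHeight_smul {c : ℝ} (hc : 0 ≤ c) (v : P.vertices) (y : E3) :
    liftHeight v (c • y) = c * liftHeight v y := by
  apply le_antisymm
  · obtain ⟨z, hz, h⟩ := exists_eq_liftHeight v (c • y)
    have h1 := inner_vertex_lt_one hz.symm
    have h2 := le_liftHeight hz y
    rw [real_inner_smul_left] at h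
    have h3 := mul_le_mul_of_nonneg_left h2 hc
    rw [h] at h3
    have : (liftHeight v (c • y) - c * liftHeight v y) * (1 - ⟪(v : E3), (z : E3)⟫) ≤ 0 := by
      linarith
    by_contra! h4
    nlinarith
  · obtain ⟨z, hz, h⟩ := exists_eq_liftHeight v y
    have h1 := inner_vertex_lt_one hz.symm
    have h2 := le_liftHeight hz (c • y)
    rw [real_inner_smul_left, h] at h2
    have : (c * liftHeight v y - liftHeight v (c • y)) * (1 - ⟪(v : E3), (z : E3)⟫) ≤ 0 := by
      linarith
    by_contra! h4
    nlinarith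

lemma lift_smul {c : ℝ} (hc : 0 ≤ c) (v : P.vertices) (y : E3) :
    lift v (c • y) = c • lift v y := by
  rw [lift, liftHeight_smul hc, lift, smul_add, smul_smul]

lemma inner_lift (v : P.vertices) (y : E3) (z : P.vertices) :
    ⟪lift v y, (z : E3)⟫ = ⟪y, (z : E3)⟫ + liftHeight v y * ⟪(v : E3), (z : E3)⟫ := by
  rw [lift, inner_add_left, real_inner_smul_left]

lemma lift_mem_normalCone (hy : 0 ≤ ⟪y, (v : E3)⟫) : lift v y ∈ P.normalCone v := by
  intro z
  by_cases hz : z = v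
  · rw [hz]
  · rw [inner_lift, inner_lift, inner_vertex_self]
    linarith [le_liftHeight hz y]

/-- With `H` the height, `⟪lift v y, z⟫ = ⟪y, z⟫ + H * ⟪v, z⟫ ≤ H ≤ H + ⟪y, v⟫ = ⟪lift v y, v⟫`. A
second normal cone is reached only with equality in both places, so only from the boundary plane of
the half-space. -/
lemma lift_mem_normalCone_iff (hy : 0 ≤ ⟪y, (v : E3)⟫) (hz : z ≠ v) :
    lift v y ∈ P.normalCone z ↔ ⟪y, (v : E3)⟫ = 0 ∧
      ⟪y, (z : E3)⟫ = liftHeight v y * (1 - ⟪(v : E3), (z : E3)⟫) := by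
  have h1 := le_liftHeight hz y
  constructor
  · intro h
    have h2 := inner_eq_of_mem_normalCone h (lift_mem_normalCone hy)
    rw [inner_lift, inner_lift, inner_vertex_self] at h2
    constructor <;> linarith
  · rintro ⟨h2, h3⟩ w
    refine (lift_mem_normalCone hy w).trans ?_
    rw [inner_lift, inner_lift, inner_vertex_self]
    linarith

lemma inner_flat (hx : x ∈ P.normalCone v) : 0 ≤ ⟪flat v x, (v : E3)⟫ := by
  rw [flat, inner_sub_left, real_inner_smul_left, inner_vertex_self]
  obtain ⟨z, hz, h⟩ := exists_eq_flatHeight v x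
  linarith [hx z]

/-- A translate of `y` in the direction `v` that lies on the boundary of the normal cone. -/
lemma lift_eq_of_mem {k : ℝ} (hy : ⟪y, (v : E3)⟫ = 0) (hz : z ≠ v)
    (h1 : y + k • (v : E3) ∈ P.normalCone v) (h2 : y + k • (v : E3) ∈ P.normalCone z) :
    lift v y = y + k • (v : E3) := by
  have h3 := lift_mem_normalCone (v := v) (y := y) hy.ge
  rw [lift]
  congr 2
  rw [add_smul_mem_normalCone_iff_slope_eq hz h1] at h2
  have e : ∀ z : P.vertices, slope v y z = ⟪y, (z : E3)⟫ / (1 - ⟪(v : E3), (z : E3)⟫) := by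
    intro z; rw [slope, inner_sub_right, hy, sub_zero]
  rw [add_smul_mem_normalCone_iff] at h1
  apply le_antisymm
  · refine Finset.sup'_le _ _ fun u hu => ?_
    rw [← e]
    exact h1 u (mem_others.1 hu)
  · rw [← h2, e]
    exact Finset.le_sup' (fun z : P.vertices => ⟪y, (z : E3)⟫ / (1 - ⟪(v : E3), (z : E3)⟫))
      (mem_others.2 hz)

lemma lift_normalAt {F : P.Face} (hv : F.Contains v) : lift v (F.normalAt v) = F.conormal := by
  obtain ⟨z, hz, hzv, -⟩ := F.exists_contains_ne v v
  rw [lift_eq_of_mem (k := ⟪F.conormal, (v : E3)⟫) (Face.inner_normalAt hv) hzv, ← Face.conormal_eq hv]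
  · rw [← Face.conormal_eq hv]; exact (F.conormal_mem_normalCone_iff v).2 hv
  · rw [← Face.conormal_eq hv]; exact (F.conormal_mem_normalCone_iff z).2 hz

/-- The right-hand side does not depend on the endpoint of the edge. This is why the lifts from the
two endpoints agree on points that are glued. -/
lemma EdgeWith.lift_combination {F G : P.Face} (h : EdgeWith F G v w) {s t : ℝ} (hs : 0 ≤ s)
    (ht : 0 ≤ t) : lift v (s • F.normalAt v + t • G.normalAt v) =
      s • F.conormal + t • G.conormal := by
  have h1 : ⟪s • F.normalAt v + t • G.normalAt v, (v : E3)⟫ = 0 := by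
    rw [inner_add_left, real_inner_smul_left, real_inner_smul_left,
      Face.inner_normalAt h.left_fst, Face.inner_normalAt h.right_fst]
    ring
  rw [lift_eq_of_mem h1 h.vertex_ne.symm, ← h.combination_normalAt]
  · rw [← h.combination_normalAt]; exact h.conormal_combination_mem hs ht
  · rw [← h.combination_normalAt]; exact h.swap_vertices.conormal_combination_mem hs ht

/-- A nonzero vector in two normal cones belongs to an edge or is normal to a face. -/
lemma edge_or_face_of_mem (hx : x ≠ 0) (hvw : v ≠ w) (hv : x ∈ P.normalCone v)
    (hw : x ∈ P.normalCone w) :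
    (∃ F G : P.Face, EdgeWith F G v w ∧
      ∃ s t : ℝ, 0 < s ∧ 0 < t ∧ x = s • F.conormal + t • G.conormal) ∨
    ∃ F : P.Face, F.Contains v ∧ F.Contains w ∧ ∃ s : ℝ, 0 < s ∧ x = s • F.conormal := by
  by_cases h : ∀ z, x ∈ P.normalCone z → z = v ∨ z = w
  · left
    obtain ⟨F, G, hFG, s, t, hs, ht, hst⟩ := exists_edgeWith hvw hv hw h
    refine ⟨F, G, hFG, s * √(1 - F.level ^ 2), t * √(1 - G.level ^ 2), mul_pos hs F.sqrt_pos,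
      mul_pos ht G.sqrt_pos, ?_⟩
    rw [Face.conormal, Face.conormal, smul_smul, smul_smul, mul_assoc, mul_assoc,
      mul_inv_cancel₀ F.sqrt_pos.ne', mul_inv_cancel₀ G.sqrt_pos.ne', mul_one, mul_one, hst]
  · right
    push Not at h
    obtain ⟨z, hz, hzv, hzw⟩ := h
    obtain ⟨F, hF⟩ := exists_face_of_mem_normalCone hx hvw.symm hzv hzw.symm hv hw hz
    have hF' : x = (‖x‖ * √(1 - F.level ^ 2)) • F.conormal := by
      rw [Face.conormal, smul_smul, mul_assoc, mul_inv_cancel₀ F.sqrt_pos.ne', mul_one, ← hF]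
    have hpos : 0 < ‖x‖ * √(1 - F.level ^ 2) := mul_pos (norm_pos_iff.2 hx) F.sqrt_pos
    rw [hF', smul_mem_normalCone_iff hpos, F.conormal_mem_normalCone_iff] at hv hw
    exact ⟨F, hv, hw, _, hpos, hF'⟩

/-- A vanishing lift means `y = -r • v`, with `r < 0` because `y` is a unit vector of the
hemisphere. The bound defining `r`, taken at any other vertex, then reads `0 ≤ r`. -/
lemma lift_ne_zero (hy : y ∈ closedHemisphere (v : E3)) : lift v y ≠ 0 := by
  intro h
  have h1 : y = -(liftHeight v y) • (v : E3) := by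
    rw [neg_smul]; exact eq_neg_of_add_eq_zero_left h
  set r := liftHeight v y
  have h2 := hy.2
  rw [h1, inner_smul_right, inner_vertex_self] at h2
  have hr : r ≠ 0 := by
    intro h0
    have := hy.1
    rw [h1, h0] at this
    simp at this
  have hr' : r < 0 := lt_of_le_of_ne (by linarith) hr
  obtain ⟨z, hz, -⟩ := exists_vertex_ne v v
  have h3 := le_liftHeight hz y
  rw [h1, real_inner_smul_left, ← h1] at h3
  have h4 := inner_vertex_lt_one hz.symm
  change -r * _ ≤ r * _ at h3
  nlinarith

/-- The lift is Lipschitz. -/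
lemma exists_lift_lipschitz (v : P.vertices) :
    ∃ K : ℝ, 0 ≤ K ∧ ∀ y y' : E3, ‖lift v y - lift v y'‖ ≤ K * ‖y - y'‖ := by
  set k := (others v).sup' (others_nonempty v) fun z => 1 / (1 - ⟪(v : E3), (z : E3)⟫) with hk
  have hle : ∀ z, z ≠ v → 1 / (1 - ⟪(v : E3), (z : E3)⟫) ≤ k := fun z hz =>
    Finset.le_sup' (fun z : P.vertices => 1 / (1 - ⟪(v : E3), (z : E3)⟫)) (mem_others.2 hz)
  have hk0 : 0 ≤ k := by
    obtain ⟨z, hz, -⟩ := exists_vertex_ne v v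
    have := inner_vertex_lt_one (Ne.symm hz)
    exact le_trans (div_nonneg zero_le_one (by linarith)) (hle z hz)
  -- A maximum of linear forms is Lipschitz with the largest of their constants; the numerators are
  -- Lipschitz with constant one since the vertices are unit vectors.
  have key : ∀ y y' : E3, liftHeight v y ≤ liftHeight v y' + k * ‖y - y'‖ := by
    intro y y'
    refine Finset.sup'_le _ _ fun z hz => ?_
    rw [mem_others] at hz
    have h1 := inner_vertex_lt_one hz.symm
    have h2 : ⟪y - y', (z : E3)⟫ ≤ ‖y - y'‖ := by
      have := real_inner_le_norm (y - y') (z : E3)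
      rwa [norm_vertex, mul_one] at this
    have h3 := le_liftHeight hz y'
    have h4 := hle z hz
    rw [div_le_iff₀ (by linarith)] at h4
    rw [div_le_iff₀ (by linarith)]
    rw [inner_sub_left] at h2
    nlinarith [norm_nonneg (y - y')]
  refine ⟨1 + k, by linarith, fun y y' => ?_⟩
  have h1 : |liftHeight v y - liftHeight v y'| ≤ k * ‖y - y'‖ := by
    rw [abs_le]
    have h2 := key y y'
    have h3 := key y' y
    rw [norm_sub_rev] at h3
    constructor <;> linarith
  have h2 : lift v y - lift v y' = (y - y') + (liftHeight v y - liftHeight v y') • (v : E3) := by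
    rw [lift, lift]; module
  rw [h2]
  refine (norm_add_le _ _).trans ?_
  rw [norm_smul, norm_vertex, mul_one, Real.norm_eq_abs]
  linarith

lemma continuous_lift (v : P.vertices) : Continuous (lift v) := by
  obtain ⟨K, hK, h⟩ := exists_lift_lipschitz v
  exact (LipschitzWith.of_dist_le_mul (K := ⟨K, hK⟩) (fun x y => by
    rw [dist_eq_norm, dist_eq_norm]; exact h x y)).continuous

end lift

lemma isCompact_closedHemisphere (a : E3) : IsCompact (closedHemisphere a) := by
  have : closedHemisphere a = Metric.sphere 0 1 ∩ {u | 0 ≤ ⟪a, u⟫} := by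
    ext u; simp [closedHemisphere]
  rw [this]
  exact (isCompact_sphere _ _).inter_right (isClosed_le continuous_const (by fun_prop))

/-- The direction of the lift of a point of the hemisphere centred at `v`. -/
noncomputable def unitLift (v : P.vertices) (y : E3) : E3 := ‖lift v y‖⁻¹ • lift v y

section unitLift

variable {v w z : P.vertices} {x y : E3}

lemma norm_unitLift (hy : y ∈ closedHemisphere (v : E3)) : ‖unitLift v y‖ = 1 := by
  rw [unitLift, norm_smul, norm_inv, norm_norm, inv_mul_cancel₀ (norm_ne_zero_iff.2 (lift_ne_zero hy))]

lemma inner_nonneg_of_mem (hy : y ∈ closedHemisphere (v : E3)) : 0 ≤ ⟪y, (v : E3)⟫ := by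
  rw [real_inner_comm]; exact hy.2

lemma unitLift_mem_iff (hy : y ∈ closedHemisphere (v : E3)) :
    unitLift v y ∈ P.normalCone z ↔ lift v y ∈ P.normalCone z :=
  smul_mem_normalCone_iff (inv_pos.2 (norm_pos_iff.2 (lift_ne_zero hy)))

lemma unitLift_mem (hy : y ∈ closedHemisphere (v : E3)) : unitLift v y ∈ P.normalCone v :=
  (unitLift_mem_iff hy).2 (lift_mem_normalCone (inner_nonneg_of_mem hy))

lemma unitLift_eq_of_lift_eq {c : ℝ} (hc : 0 < c) (hx : ‖x‖ = 1) (h : lift v y = c • x) :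
    unitLift v y = x := by
  rw [unitLift, h, norm_smul, hx, Real.norm_of_nonneg hc.le, mul_one, smul_smul,
    inv_mul_cancel₀ hc.ne', one_smul]

/-- The lift is injective and positively homogeneous, so equal directions of lifts come from
proportional points, and these are unit vectors. -/
lemma unitLift_injOn (v : P.vertices) : InjOn (unitLift v) (closedHemisphere (v : E3)) := by
  intro y hy y' hy' h
  have h1 : 0 < ‖lift v y‖ := norm_pos_iff.2 (lift_ne_zero hy)
  have h2 : 0 < ‖lift v y'‖ := norm_pos_iff.2 (lift_ne_zero hy')
  have h3 : lift v y = (‖lift v y‖ * ‖lift v y'‖⁻¹) • lift v y' := by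
    rw [mul_smul]
    change lift v y = ‖lift v y‖ • unitLift v y'
    rw [← h, unitLift, smul_smul, mul_inv_cancel₀ h1.ne', one_smul]
  have hc : 0 < ‖lift v y‖ * ‖lift v y'‖⁻¹ := mul_pos h1 (inv_pos.2 h2)
  rw [← lift_smul hc.le] at h3
  have h4 := congrArg (flat v) h3
  rw [flat_lift, flat_lift] at h4
  have h5 := congrArg norm h4
  rw [norm_smul, hy.1, hy'.1, mul_one, Real.norm_of_nonneg hc.le] at h5
  rwa [← h5, one_smul] at h4

lemma exists_unitLift_eq (hx : ‖x‖ = 1) (hv : x ∈ P.normalCone v) :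
    ∃ y ∈ closedHemisphere (v : E3), unitLift v y = x := by
  have h0 : flat v x ≠ 0 := by
    intro h
    have h1 := lift_flat v x
    rw [h, ← zero_smul ℝ (0 : E3), lift_smul le_rfl, zero_smul] at h1
    rw [← h1] at hx
    simp at hx
  have hn : 0 < ‖flat v x‖ := norm_pos_iff.2 h0
  refine ⟨‖flat v x‖⁻¹ • flat v x, ⟨?_, ?_⟩, ?_⟩
  · rw [norm_smul, norm_inv, norm_norm, inv_mul_cancel₀ hn.ne']
  · rw [inner_smul_right, real_inner_comm]
    exact mul_nonneg (inv_nonneg.2 hn.le) (inner_flat hv)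
  · refine unitLift_eq_of_lift_eq (inv_pos.2 hn) hx ?_
    rw [lift_smul (inv_nonneg.2 hn.le), lift_flat]

/-- The lift is Lipschitz and does not vanish on the compact hemisphere, so its norm is bounded
below and normalising keeps it Lipschitz. Chords are no longer than arcs. -/
lemma exists_unitLift_lipschitz (v : P.vertices) :
    ∃ L : ℝ, 0 ≤ L ∧ ∀ y ∈ closedHemisphere (v : E3), ∀ y' ∈ closedHemisphere (v : E3),
      ‖unitLift v y - unitLift v y'‖ ≤ L * angle y y' := by
  obtain ⟨K, hK0, hK⟩ := exists_lift_lipschitz v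
  obtain ⟨y₀, hy₀, hmin⟩ := (isCompact_closedHemisphere (v : E3)).exists_isMinOn
    ⟨v, norm_vertex v, by rw [inner_vertex_self]; exact zero_le_one⟩
    (continuous_lift v).norm.continuousOn
  have hδ : 0 < ‖lift v y₀‖ := norm_pos_iff.2 (lift_ne_zero hy₀)
  refine ⟨2 / ‖lift v y₀‖ * K, by positivity, fun y hy y' hy' => ?_⟩
  refine (norm_normalize_sub_le hδ (hmin hy) (hmin hy')).trans ?_
  rw [mul_assoc]
  refine mul_le_mul_of_nonneg_left ?_ (by positivity)
  exact (hK y y').trans (mul_le_mul_of_nonneg_left (norm_sub_le_angle hy.1 hy'.1) hK0)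

end unitLift

/-! ### The circle at a vertex -/

/-- A point of the equator at `v` that is not normal to a face is an inner point of the side
corresponding to an edge, whose other endpoint has the largest slope. -/
lemma exists_dualSide_of_generic {v : P.vertices} {y : E3} (hy : y ∈ equator (v : E3))
    (hne : ∀ F : P.Face, F.Contains v → y ≠ F.normalAt v) :
    ∃ F G w, EdgeWith F G v w ∧ y ∈ dualSide F G v ∧
      ∀ z, z ≠ v → z ≠ w → ⟪y, (z : E3)⟫ / (1 - ⟪(v : E3), (z : E3)⟫) <
        ⟪y, (w : E3)⟫ / (1 - ⟪(v : E3), (w : E3)⟫) := by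
  have hyv : ⟪y, (v : E3)⟫ = 0 := by rw [real_inner_comm]; exact hy.2
  have hy' : y ∈ closedHemisphere (v : E3) := ⟨hy.1, hy.2.ge⟩
  obtain ⟨w, hw, hwmax⟩ := exists_eq_liftHeight v y
  have hv1 := lift_mem_normalCone (v := v) hyv.ge
  have hw1 := (lift_mem_normalCone_iff hyv.ge hw).2 ⟨hyv, hwmax⟩
  -- A point of the equator is recovered from its lift by orthogonal projection along `v`.
  have proj : ∀ {p : E3}, lift v y = p → y = p - ⟪p, (v : E3)⟫ • (v : E3) := by
    rintro p rfl
    rw [inner_lift, hyv, inner_vertex_self, lift]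
    module
  have noface : ∀ F : P.Face, F.Contains v → ∀ s : ℝ, 0 < s → lift v y ≠ s • F.conormal := by
    intro F hF s hs h
    apply hne F hF
    have h1 := proj h
    rw [real_inner_smul_left, mul_smul, ← smul_sub, ← Face.normalAt_eq hF] at h1
    have h2 := congrArg norm h1
    rw [norm_smul, hy.1, Face.norm_normalAt hF, mul_one, Real.norm_of_nonneg hs.le] at h2
    rwa [← h2, one_smul] at h1
  rcases edge_or_face_of_mem (lift_ne_zero hy') hw.symm hv1 hw1 with
    ⟨F, G, hFG, s, t, hs, ht, hst⟩ | ⟨F, hF, -, s, hs, hst⟩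
  · refine ⟨F, G, w, hFG, ?_, ?_⟩
    · rw [hFG.mem_dualSide_iff]
      refine ⟨hy.1, s, t, hs.le, ht.le, ?_⟩
      rw [proj hst, Face.normalAt_eq hFG.left_fst, Face.normalAt_eq hFG.right_fst, inner_add_left,
        real_inner_smul_left, real_inner_smul_left]
      module
    · intro z hz hzw
      have h1 := inner_vertex_lt_one hz.symm
      have h2 := inner_vertex_lt_one hw.symm
      rw [hwmax, mul_div_cancel_right₀ _ (by linarith), div_lt_iff₀ (by linarith)]
      -- The lift is an inner point of the cone of the edge, so it lies in no normal cone besides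
      -- those of the two endpoints; this makes the slope inequality strict.
      refine lt_of_le_of_ne (le_liftHeight hz y) fun h3 => ?_
      have h4 := (lift_mem_normalCone_iff hyv.ge hz).2 ⟨hyv, h3⟩
      rw [hst] at h4
      exact (hFG.eq_or_eq_of_conormal_mem hs ht h4).elim hz hzw
  · exact absurd hst (noface F hF s hs)

/-- The equator at `v` is covered by the sides of the dual polygon. -/
lemma exists_dualSide {v : P.vertices} {y : E3} (hy : y ∈ equator (v : E3)) :
    ∃ F G w, EdgeWith F G v w ∧ y ∈ dualSide F G v := by
  by_cases h : ∃ F : P.Face, F.Contains v ∧ y = F.normalAt v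
  · obtain ⟨F, hF, rfl⟩ := h
    obtain ⟨G, x, -, -, hG, -⟩ := Face.exists_two_edges hF
    exact ⟨F, G, x, hG, left_mem_sphericalArc hy.1 _⟩
  · push Not at h
    obtain ⟨F, G, w, h1, h2, -⟩ := exists_dualSide_of_generic hy h
    exact ⟨F, G, w, h1, h2⟩

/-- The lift of such a point is `H.conormal` and belongs to the normal cone of the other endpoint
`w` too. Thus `H` contains both ends of the edge. -/
lemma EdgeWith.eq_or_eq_of_normalAt_mem {F G H : P.Face} {v w : P.vertices}
    (h : EdgeWith F G v w) (hH : H.Contains v) (hmem : H.normalAt v ∈ dualSide F G v) :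
    H = F ∨ H = G := by
  obtain ⟨-, s, t, hs, ht, hst⟩ := h.mem_dualSide_iff.1 hmem
  have h1 := lift_normalAt hH
  rw [hst, h.lift_combination hs ht] at h1
  have h2 := h.swap_vertices.conormal_combination_mem hs ht
  rw [h1, H.conormal_mem_normalCone_iff] at h2
  exact h.face_eq_or_eq hH h2

end IdealPolyhedron

/-! ### Arcs covering a great circle -/

lemma exists_orthonormal_pair (a : E3) : ∃ b c : E3, ‖b‖ = 1 ∧ ‖c‖ = 1 ∧
    ⟪a, b⟫ = 0 ∧ ⟪a, c⟫ = 0 ∧ ⟪b, c⟫ = 0 := by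
  have unit : ∀ m : E3, m ≠ 0 → ‖‖m‖⁻¹ • m‖ = 1 := by
    intro m hm
    rw [norm_smul, norm_inv, norm_norm, inv_mul_cancel₀ (norm_ne_zero_iff.2 hm)]
  obtain ⟨b, hb0, hab, -⟩ := exists_ne_zero_orthogonal_pair a 0
  obtain ⟨c, hc0, hac, hbc⟩ := exists_ne_zero_orthogonal_pair a b
  refine ⟨_, _, unit b hb0, unit c hc0, ?_, ?_, ?_⟩
  · rw [inner_smul_right, hab, mul_zero]
  · rw [inner_smul_right, hac, mul_zero]
  · rw [inner_smul_right, real_inner_smul_left, hbc, mul_zero, mul_zero]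

lemma AddCircle.norm_two_pi (x : ℝ) :
    ‖(x : AddCircle (2 * Real.pi))‖ = Real.arccos (Real.cos x) := by
  have h1 := AddCircle.norm_eq (2 * Real.pi) (x := x)
  have h2 := AddCircle.norm_le_half_period (2 * Real.pi) (x := (x : AddCircle (2 * Real.pi)))
    Real.two_pi_pos.ne'
  rw [abs_of_pos Real.two_pi_pos] at h2
  have h3 : Real.cos ‖(x : AddCircle (2 * Real.pi))‖ = Real.cos x := by
    rw [h1, Real.cos_abs]
    exact Real.cos_sub_int_mul_two_pi x _
  rw [← h3, Real.arccos_cos (norm_nonneg _) (by linarith)]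

/-- The unit circle orthogonal to a unit vector, parametrised isometrically. -/
lemma exists_circle_parametrization {a : E3} (ha : ‖a‖ = 1) :
    ∃ c : AddCircle (2 * Real.pi) → E3, Continuous c ∧ (∀ τ, ‖c τ‖ = 1 ∧ ⟪a, c τ⟫ = 0) ∧
      (∀ τ σ, angle (c τ) (c σ) = ‖τ - σ‖) ∧ ∀ x, ‖x‖ = 1 → ⟪a, x⟫ = 0 → ∃ τ, c τ = x := by
  obtain ⟨b, d, hb, hd, hab, had, hbd⟩ := exists_orthonormal_pair a
  have hbb : ⟪b, b⟫ = 1 := by rw [real_inner_self_eq_norm_sq, hb]; norm_num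
  have hdd : ⟪d, d⟫ = 1 := by rw [real_inner_self_eq_norm_sq, hd]; norm_num
  have hdb : ⟪d, b⟫ = 0 := by rw [real_inner_comm]; exact hbd
  set f : ℝ → E3 := fun t => Real.cos t • b + Real.sin t • d with hf
  have hper : Function.Periodic f (2 * Real.pi) := by
    intro t
    simp only [hf, Real.cos_add_two_pi, Real.sin_add_two_pi]
  have hcont : Continuous f := by fun_prop
  have hinner : ∀ s t, ⟪f s, f t⟫ = Real.cos (s - t) := by
    intro s t
    simp only [hf, inner_add_left, inner_add_right, real_inner_smul_left, real_inner_smul_right,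
      hbb, hdd, hbd, hdb, Real.cos_sub]
    ring
  have hnorm : ∀ t, ‖f t‖ = 1 := by
    intro t
    have := hinner t t
    rw [sub_self, Real.cos_zero, real_inner_self_eq_norm_sq] at this
    exact (pow_eq_one_iff_of_nonneg (norm_nonneg _) two_ne_zero).1 this
  refine ⟨hper.lift, ?_, ?_, ?_, ?_⟩
  · exact continuous_coinduced_dom.2 hcont
  · intro τ
    obtain ⟨t, rfl⟩ := QuotientAddGroup.mk_surjective τ
    refine ⟨hnorm t, ?_⟩
    change ⟪a, f t⟫ = 0
    simp only [hf, inner_add_right, real_inner_smul_right, hab, had]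
    ring
  · intro τ σ
    obtain ⟨t, rfl⟩ := QuotientAddGroup.mk_surjective τ
    obtain ⟨s, rfl⟩ := QuotientAddGroup.mk_surjective σ
    change angle (f t) (f s) = ‖((t - s : ℝ) : AddCircle (2 * Real.pi))‖
    rw [AddCircle.norm_two_pi, angle, hnorm, hnorm, hinner, mul_one, div_one]
  · intro x hx hax
    have ha0 : a ≠ 0 := inner_eq_zero_iff_ne ha
    obtain ⟨s, t, hst⟩ := exists_combination_of_orthogonal ha0 (a := b) (b := d) (by
      intro s t h
      have h1 := congrArg (fun y => ⟪b, y⟫) h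
      have h2 := congrArg (fun y => ⟪d, y⟫) h
      simp only [inner_add_right, real_inner_smul_right, hbb, hdd, hbd, hdb, inner_zero_right]
        at h1 h2
      constructor <;> linarith) hab had hax
    have h1 : s ^ 2 + t ^ 2 = 1 := by
      have h2 : ⟪x, x⟫ = 1 := by rw [real_inner_self_eq_norm_sq, hx]; norm_num
      rw [hst] at h2
      simp only [inner_add_left, inner_add_right, real_inner_smul_left, real_inner_smul_right,
        hbb, hdd, hbd, hdb] at h2
      linarith
    have hz : ‖(⟨s, t⟩ : ℂ)‖ = 1 := by
      rw [Complex.norm_def, Complex.normSq_mk, ← sq, ← sq, h1, Real.sqrt_one]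
    refine ⟨((Complex.arg ⟨s, t⟩ : ℝ) : AddCircle (2 * Real.pi)), ?_⟩
    change f (Complex.arg ⟨s, t⟩) = x
    have h0 : (⟨s, t⟩ : ℂ) ≠ 0 := norm_ne_zero_iff.1 (by rw [hz]; exact one_ne_zero)
    simp only [hf, Complex.cos_arg h0, Complex.sin_arg, hz, div_one]
    exact hst.symm

instance : Fact (0 < 2 * Real.pi) := ⟨Real.two_pi_pos⟩

section cover

variable {ι : Type*} {a : E3} {s : Finset ι} {m : ι → E3} {θ : ι → ℝ} {B : Set E3}

/-- Finitely many arcs that cover a great circle have total length at least `2π`; the total length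
is larger than `2π` if the arcs other than `i₀` cover an open part of the arc `i₀`. -/
lemma two_pi_le_sum_of_cover (ha : ‖a‖ = 1) (hm : ∀ i ∈ s, ‖m i‖ = 1 ∧ ⟪a, m i⟫ = 0)
    (hθ : ∀ i ∈ s, 0 ≤ θ i) (hB : B.Finite)
    (hcov : ∀ x, ‖x‖ = 1 → ⟪a, x⟫ = 0 → x ∉ B → ∃ i ∈ s, angle x (m i) ≤ θ i / 2) :
    2 * Real.pi ≤ ∑ i ∈ s, θ i ∧
    ∀ i₀ ∈ s, ∀ U : Set E3, IsOpen U → (∃ x ∈ U, ‖x‖ = 1 ∧ ⟪a, x⟫ = 0 ∧ angle x (m i₀) < θ i₀ / 2) →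
      (∀ x ∈ U, ‖x‖ = 1 → ⟪a, x⟫ = 0 → x ∉ B → ∃ i ∈ s, i ≠ i₀ ∧ angle x (m i) ≤ θ i / 2) →
      2 * Real.pi < ∑ i ∈ s, θ i := by
  classical
  obtain ⟨c, hc, hc1, hang, hsurj⟩ := exists_circle_parametrization ha
  have hinj : Function.Injective c := by
    intro τ σ h
    have := hang τ σ
    rw [h, angle_self (inner_eq_zero_iff_ne (hc1 σ).1)] at this
    rwa [eq_comm, norm_eq_zero, sub_eq_zero] at this
  have hchoose : ∀ i, ∃ σ, i ∈ s → c σ = m i := by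
    intro i
    by_cases hi : i ∈ s
    · obtain ⟨σ, h⟩ := hsurj (m i) (hm i hi).1 (hm i hi).2
      exact ⟨σ, fun _ => h⟩
    · exact ⟨0, fun h => absurd h hi⟩
  choose σ hσ using hchoose
  have hball : ∀ i ∈ s, ∀ τ, angle (c τ) (m i) = dist τ (σ i) := by
    intro i hi τ
    rw [← hσ i hi, hang, dist_eq_norm]
  have hfin : (c ⁻¹' B).Finite := hB.preimage hinj.injOn
  -- The exceptional set is finite, hence null, and does not disturb the comparison of lengths.
  have hnull : volume (c ⁻¹' B) = 0 := by
    have hpt : ∀ x : AddCircle (2 * Real.pi), volume {x} = 0 := by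
      intro x
      have := AddCircle.volume_closedBall (2 * Real.pi) (x := x) 0
      rwa [Metric.closedBall_zero, mul_zero, min_eq_right Real.two_pi_pos.le,
        ENNReal.ofReal_zero] at this
    rw [← biUnion_of_singleton (c ⁻¹' B)]
    exact (measure_biUnion_null_iff hfin.countable).2 fun x _ => hpt x
  have hvol : ∀ i, volume (Metric.closedBall (σ i) (θ i / 2)) ≤ ENNReal.ofReal (θ i) := by
    intro i
    rw [AddCircle.volume_closedBall]
    apply ENNReal.ofReal_le_ofReal
    refine (min_le_right _ _).trans (by linarith)
  have huniv := AddCircle.measure_univ (2 * Real.pi)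
  constructor
  · have h1 : (univ : Set (AddCircle (2 * Real.pi))) ⊆
        (c ⁻¹' B) ∪ ⋃ i ∈ s, Metric.closedBall (σ i) (θ i / 2) := by
      intro τ _
      by_cases hτ : c τ ∈ B
      · exact Or.inl hτ
      · right
        obtain ⟨i, hi, h⟩ := hcov (c τ) (hc1 τ).1 (hc1 τ).2 hτ
        rw [hball i hi] at h
        exact mem_iUnion₂.2 ⟨i, hi, h⟩
    have h2 : ENNReal.ofReal (2 * Real.pi) ≤ ENNReal.ofReal (∑ i ∈ s, θ i) := by
      rw [← huniv, ENNReal.ofReal_sum_of_nonneg hθ]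
      refine (measure_mono h1).trans ((measure_union_le _ _).trans ?_)
      rw [hnull, zero_add]
      exact (measure_biUnion_finset_le _ _).trans (Finset.sum_le_sum fun i _ => hvol i)
    exact (ENNReal.ofReal_le_ofReal_iff (Finset.sum_nonneg hθ)).1 h2
  · intro i₀ hi₀ U hU hne hcov'
    -- An open piece of the arc `i₀` that the other arcs cover as well, up to `B`. Removing it from
    -- the arc `i₀` leaves a cover, and its positive measure is the gain in the strict inequality.
    set O := Metric.ball (σ i₀) (θ i₀ / 2) ∩ c ⁻¹' U with hO
    have hOopen : IsOpen O := Metric.isOpen_ball.inter (hU.preimage hc)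
    have hOne : O.Nonempty := by
      obtain ⟨x, hxU, hx1, hx2, hx3⟩ := hne
      obtain ⟨τ, rfl⟩ := hsurj x hx1 hx2
      rw [hball i₀ hi₀] at hx3
      exact ⟨τ, hx3, hxU⟩
    have hOpos : 0 < volume O := hOopen.measure_pos volume hOne
    have h1 : (univ : Set (AddCircle (2 * Real.pi))) ⊆
        ((c ⁻¹' B) ∪ ⋃ i ∈ s.erase i₀, Metric.closedBall (σ i) (θ i / 2)) ∪
          (Metric.closedBall (σ i₀) (θ i₀ / 2) \ O) := by
      intro τ _
      by_cases hτ : c τ ∈ B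
      · exact Or.inl (Or.inl hτ)
      · have key : ∀ i ∈ s, i ≠ i₀ → angle (c τ) (m i) ≤ θ i / 2 → τ ∈ ((c ⁻¹' B) ∪
            ⋃ i ∈ s.erase i₀, Metric.closedBall (σ i) (θ i / 2)) := by
          intro i hi hne h
          rw [hball i hi] at h
          exact Or.inr (mem_iUnion₂.2 ⟨i, Finset.mem_erase.2 ⟨hne, hi⟩, h⟩)
        by_cases hτO : τ ∈ O
        · obtain ⟨i, hi, hne, h⟩ := hcov' (c τ) hτO.2 (hc1 τ).1 (hc1 τ).2 hτ
          exact Or.inl (key i hi hne h)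
        · obtain ⟨i, hi, h⟩ := hcov (c τ) (hc1 τ).1 (hc1 τ).2 hτ
          by_cases hii : i = i₀
          · subst hii
            rw [hball i hi] at h
            exact Or.inr ⟨h, hτO⟩
          · exact Or.inl (key i hi hii h)
    have hsub : O ⊆ Metric.closedBall (σ i₀) (θ i₀ / 2) :=
      inter_subset_left.trans Metric.ball_subset_closedBall
    have h2 : volume (Metric.closedBall (σ i₀) (θ i₀ / 2) \ O) + volume O ≤
        ENNReal.ofReal (θ i₀) := by
      rw [measure_sdiff hsub hOopen.measurableSet.nullMeasurableSet (measure_ne_top _ _),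
        tsub_add_cancel_of_le (measure_mono hsub)]
      exact hvol i₀
    have h3 : ENNReal.ofReal (2 * Real.pi) + volume O ≤ ENNReal.ofReal (∑ i ∈ s, θ i) := by
      rw [← huniv, ENNReal.ofReal_sum_of_nonneg hθ, ← Finset.sum_erase_add _ _ hi₀]
      calc _ ≤ (volume (c ⁻¹' B) + ∑ i ∈ s.erase i₀, ENNReal.ofReal (θ i)) +
            volume (Metric.closedBall (σ i₀) (θ i₀ / 2) \ O) + volume O := by
              gcongr
              refine (measure_mono h1).trans ((measure_union_le _ _).trans ?_)
              gcongr
              refine (measure_union_le _ _).trans ?_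
              gcongr
              exact (measure_biUnion_finset_le _ _).trans (Finset.sum_le_sum fun i _ => hvol i)
        _ ≤ _ := by
              rw [hnull, zero_add, add_assoc]
              gcongr
    have h4 : ENNReal.ofReal (2 * Real.pi) < ENNReal.ofReal (∑ i ∈ s, θ i) :=
      lt_of_lt_of_le (ENNReal.lt_add_right ENNReal.ofReal_ne_top hOpos.ne') h3
    exact (ENNReal.ofReal_lt_ofReal_iff_of_nonneg Real.two_pi_pos.le).1 h4

end cover

namespace IdealPolyhedron
variable {P : IdealPolyhedron}

/-! ### Edges, their weights, and cuts -/

variable (P) in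
open Classical in
/-- The edges of the polyhedron, as unordered pairs of vertices. -/
noncomputable def edges : Finset (Sym2 P.vertices) :=
  Finset.univ.filter fun e => ∃ F G v w, EdgeWith (P := P) F G v w ∧ e = s(v, w)

lemma mem_edges {e : Sym2 P.vertices} : e ∈ P.edges ↔ ∃ F G v w, EdgeWith F G v w ∧ e = s(v, w) := by
  simp [edges]

lemma EdgeWith.mem_edges {F G : P.Face} {v w : P.vertices} (h : EdgeWith F G v w) :
    s(v, w) ∈ P.edges := IdealPolyhedron.mem_edges.2 ⟨F, G, v, w, h, rfl⟩

open Classical in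
/-- The exterior dihedral angle at an edge. -/
noncomputable def weight (e : Sym2 P.vertices) : ℝ :=
  if h : ∃ q : P.Face × P.Face, ∃ v w, EdgeWith q.1 q.2 v w ∧ e = s(v, w)
  then exteriorDihedralAngle h.choose.1 h.choose.2 else 0

lemma EdgeWith.eq_or_swap {F G F' G' : P.Face} {v w v' w' : P.vertices} (h : EdgeWith F G v w)
    (h' : EdgeWith F' G' v' w') (he : s(v, w) = s(v', w')) :
    (F' = F ∧ G' = G) ∨ (F' = G ∧ G' = F) := by
  have h1 : EdgeWith F' G' v w := by
    rcases Sym2.eq_iff.1 he with ⟨rfl, rfl⟩ | ⟨rfl, rfl⟩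
    · exact h'
    · exact h'.swap_vertices
  rcases h.face_eq_or_eq h1.left_fst h1.left_snd with rfl | rfl
  · exact Or.inl ⟨rfl, (h.face_eq_or_eq h1.right_fst h1.right_snd).resolve_left h1.face_ne.symm⟩
  · exact Or.inr ⟨rfl, (h.face_eq_or_eq h1.right_fst h1.right_snd).resolve_right h1.face_ne.symm⟩

/-- The pair of faces picked by choice in `weight` is `(F, G)` up to order, and the exterior angle
is symmetric. -/
lemma EdgeWith.weight_eq {F G : P.Face} {v w : P.vertices} (h : EdgeWith F G v w) :
    weight s(v, w) = exteriorDihedralAngle F G := by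
  have hex : ∃ q : P.Face × P.Face, ∃ v' w', EdgeWith q.1 q.2 v' w' ∧ s(v, w) = s(v', w') :=
    ⟨(F, G), v, w, h, rfl⟩
  rw [weight, dif_pos hex]
  obtain ⟨v', w', h', he⟩ := hex.choose_spec
  rcases h.eq_or_swap h' he with ⟨h1, h2⟩ | ⟨h1, h2⟩
  · rw [h1, h2]
  · rw [h1, h2, exteriorDihedralAngle_comm]

lemma weight_pos {e : Sym2 P.vertices} (he : e ∈ P.edges) : 0 < weight e := by
  obtain ⟨F, G, v, w, h, rfl⟩ := mem_edges.1 he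
  rw [h.weight_eq]; exact h.exterior_pos

open Classical in
/-- The edges with one end in `A` and the other end outside. -/
noncomputable def cut (A : Set P.vertices) : Finset (Sym2 P.vertices) :=
  P.edges.filter fun e => ∃ v w, v ∈ A ∧ w ∉ A ∧ e = s(v, w)

lemma mem_cut {A : Set P.vertices} {e : Sym2 P.vertices} :
    e ∈ cut A ↔ e ∈ P.edges ∧ ∃ v w, v ∈ A ∧ w ∉ A ∧ e = s(v, w) := by
  simp [cut]

lemma mk_mem_cut {A : Set P.vertices} {v w : P.vertices} :
    s(v, w) ∈ cut A ↔ s(v, w) ∈ P.edges ∧ (v ∈ A ↔ w ∉ A) := by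
  rw [mem_cut]
  refine and_congr_right fun _ => ⟨?_, fun h => ?_⟩
  · rintro ⟨a, b, ha, hb, he⟩
    rcases Sym2.eq_iff.1 he with ⟨rfl, rfl⟩ | ⟨rfl, rfl⟩
    · exact ⟨fun _ => hb, fun _ => ha⟩
    · exact ⟨fun h => absurd h hb, fun h => absurd ha h⟩
  · by_cases hv : v ∈ A
    · exact ⟨v, w, hv, h.1 hv, rfl⟩
    · exact ⟨w, v, not_not.1 (mt h.2 hv), hv, Sym2.eq_swap⟩

lemma cut_compl (A : Set P.vertices) : cut Aᶜ = cut A := by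
  ext e
  induction e with
  | _ v w =>
    rw [mk_mem_cut, mk_mem_cut, mem_compl_iff, mem_compl_iff]
    tauto

/-! ### Reflections exchanging two vertices -/

/-- The reflection of space that exchanges two vertices. -/
noncomputable def exchange (v w : P.vertices) : E3 ≃ₗᵢ[ℝ] E3 := (ℝ ∙ ((w : E3) - v))ᗮ.reflection

lemma exchange_exchange (v w : P.vertices) (x : E3) : exchange v w (exchange v w x) = x :=
  Submodule.reflection_reflection _ _

lemma exchange_left (v w : P.vertices) : exchange v w v = w := by
  have h := Submodule.reflection_sub (v := (w : E3)) (w := (v : E3))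
    (by rw [norm_vertex, norm_vertex])
  have h2 := exchange_exchange v w w
  rw [exchange, h] at h2
  exact h2

lemma exchange_right (v w : P.vertices) : exchange v w w = v :=
  Submodule.reflection_sub (by rw [norm_vertex, norm_vertex])

lemma inner_exchange {v w : P.vertices} (hvw : v ≠ w) {p : E3} (hp : ⟪p, (v : E3)⟫ = 0)
    (x : P.vertices) : ⟪exchange v w p, (x : E3)⟫ =
      ⟪p, (x : E3)⟫ - (⟪(w : E3), (x : E3)⟫ - ⟪(v : E3), (x : E3)⟫) *
        (⟪p, (w : E3)⟫ / (1 - ⟪(v : E3), (w : E3)⟫)) := by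
  have h1 := inner_vertex_lt_one hvw
  have h2 : ‖(w : E3) - v‖ ^ 2 = 2 * (1 - ⟪(v : E3), (w : E3)⟫) := by
    rw [@norm_sub_sq_real, norm_vertex, norm_vertex, real_inner_comm]
    ring
  have h3 : (1 - ⟪(v : E3), (w : E3)⟫) ≠ 0 := by linarith
  rw [exchange, Submodule.reflection_orthogonal_apply, Submodule.reflection_singleton_apply,
    RCLike.ofReal_real_eq_id, id, h2]
  simp only [inner_neg_left, inner_sub_left, two_smul, inner_add_left, real_inner_smul_left]
  rw [real_inner_comm p (w : E3), real_inner_comm p (v : E3), hp]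
  field_simp
  ring

lemma inner_exchange_right {v w : P.vertices} {p : E3} (hp : ⟪p, (v : E3)⟫ = 0) :
    ⟪exchange v w p, (w : E3)⟫ = 0 := by
  rw [← exchange_left v w, LinearIsometryEquiv.inner_map_map, hp]

/-- The comparison of slopes at `w` of the exchanged vector and slopes at `v` of the vector. -/
lemma slope_exchange {v w x : P.vertices} (hvw : v ≠ w) (hxw : x ≠ w) {p : E3}
    (hp : ⟪p, (v : E3)⟫ = 0) :
    (1 - ⟪(w : E3), (x : E3)⟫) * (slope w (exchange v w p) x - slope w (exchange v w p) v) =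
      (1 - ⟪(v : E3), (x : E3)⟫) * (slope v p x - slope v p w) := by
  have h1 := inner_vertex_lt_one hvw
  have h2 := inner_vertex_lt_one hxw.symm
  have h3 : (1 - ⟪(v : E3), (w : E3)⟫) ≠ 0 := by linarith
  have h4 : (1 - ⟪(w : E3), (x : E3)⟫) ≠ 0 := by linarith
  have h5 : slope w (exchange v w p) v = ⟪p, (w : E3)⟫ / (1 - ⟪(v : E3), (w : E3)⟫) := by
    rw [slope, inner_sub_right, inner_exchange_right hp, inner_exchange hvw hp, hp,
      inner_vertex_self, show ⟪(w : E3), (v : E3)⟫ = ⟪(v : E3), (w : E3)⟫ from real_inner_comm _ _]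
    field_simp
    ring
  have h6 : slope v p w = ⟪p, (w : E3)⟫ / (1 - ⟪(v : E3), (w : E3)⟫) := by
    rw [slope, inner_sub_right, hp, sub_zero]
  have h7 : (1 - ⟪(v : E3), (x : E3)⟫) * slope v p x = ⟪p, (x : E3)⟫ := by
    by_cases hxv : x = v
    · subst hxv
      rw [inner_vertex_self, hp]; ring
    · have := inner_vertex_lt_one (Ne.symm hxv)
      rw [slope, mul_div_cancel₀ _ (by linarith), inner_sub_right, hp, sub_zero]
  -- Both sides expand to inner products with `p`; the correction by the reflection is the same
  -- multiple of `⟪p, w⟫` on the left and on the right. As the two factors are nonnegative, this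
  -- preserves the sign of slope differences.
  rw [h5, h6, mul_sub, mul_sub, h7, slope, mul_div_cancel₀ _ h4, inner_sub_right,
    inner_exchange_right hp, inner_exchange hvw hp]
  ring

lemma angle_exchange (v w : P.vertices) (x y : E3) :
    angle (exchange v w x) y = angle x (exchange v w y) := by
  conv_lhs => rw [← exchange_exchange v w y]
  exact (exchange v w).toLinearIsometry.angle_map _ _

/-- The midpoint of a side of a dual polygon. -/
noncomputable def midpointOfSide (F G : P.Face) (v : P.vertices) : E3 :=
  arcPoint (F.normalAt v) (G.normalAt v) (exteriorDihedralAngle F G / 2)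

namespace EdgeWith
variable {F G : P.Face} {v w : P.vertices}

lemma midpoint_mem (h : EdgeWith F G v w) : midpointOfSide F G v ∈ dualSide F G v := by
  have := h.exterior_pos
  apply arcPoint_mem h.norm_left h.norm_right h.angle_pos h.angle_lt_pi
  rw [h.angle_eq]
  constructor <;> linarith

lemma angle_arcPoint_midpoint (h : EdgeWith F G v w) {t : ℝ}
    (ht : t ∈ Icc 0 (exteriorDihedralAngle F G)) :
    angle (arcPoint (F.normalAt v) (G.normalAt v) t) (midpointOfSide F G v) =
      |t - exteriorDihedralAngle F G / 2| := by
  have := h.exterior_pos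
  apply angle_arcPoint h.norm_left h.norm_right h.angle_pos h.angle_lt_pi
  · rwa [h.angle_eq]
  · rw [h.angle_eq]
    constructor <;> linarith

lemma angle_midpoint_le (h : EdgeWith F G v w) {x : E3} (hx : x ∈ dualSide F G v) :
    angle x (midpointOfSide F G v) ≤ exteriorDihedralAngle F G / 2 := by
  have h1 := angle_mem_Icc_of_mem hx
  have h2 := arcPoint_angle_of_mem h.norm_left h.norm_right h.angle_pos h.angle_lt_pi hx
  rw [h.angle_eq] at h1
  rw [← h2, h.angle_arcPoint_midpoint h1, abs_le]
  constructor <;> linarith [h1.1, h1.2]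

lemma midpoint_comm (h : EdgeWith F G v w) : midpointOfSide F G v = midpointOfSide G F v := by
  have h1 := h.swap_faces.midpoint_mem
  have h2 := h.swap_faces.angle_midpoint_le (x := midpointOfSide F G v)
    (by rw [dualSide, sphericalArc_comm]; exact h.midpoint_mem)
  have h3 := arcPoint_angle_of_mem h.norm_left h.norm_right h.angle_pos h.angle_lt_pi
    (by rw [sphericalArc_comm]; exact h1)
  have h4 := h1.2
  have h5 : angle (G.normalAt v) (midpointOfSide G F v) = exteriorDihedralAngle F G / 2 := by
    have := h.exterior_pos
    rw [exteriorDihedralAngle_comm] at this ⊢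
    apply angle_left_arcPoint h.norm_right h.norm_left h.swap_faces.angle_pos
      h.swap_faces.angle_lt_pi
    rw [h.swap_faces.angle_eq]
    constructor <;> linarith
  rw [h5, h.swap_faces.angle_eq, exteriorDihedralAngle_comm G F] at h4
  rw [midpointOfSide, ← h3, angle_comm]
  congr 1
  linarith

end EdgeWith

/-! ### The total exterior angle along a cut -/

section cut_sum

variable {A : Set P.vertices} {v₀ : P.vertices}

/-- The end in `A` of an edge of the cut, with the two faces at the edge. -/
lemma exists_cut_data (e : Sym2 P.vertices) : ∃ d : P.vertices × P.vertices × P.Face × P.Face,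
    e ∈ cut A → d.1 ∈ A ∧ d.2.1 ∉ A ∧ EdgeWith d.2.2.1 d.2.2.2 d.1 d.2.1 ∧ e = s(d.1, d.2.1) := by
  by_cases he : e ∈ cut A
  · obtain ⟨h1, v, w, hv, hw, rfl⟩ := mem_cut.1 he
    obtain ⟨F, G, v', w', h', he'⟩ := mem_edges.1 h1
    refine ⟨(v, w, F, G), fun _ => ⟨hv, hw, ?_, rfl⟩⟩
    rcases Sym2.eq_iff.1 he' with ⟨rfl, rfl⟩ | ⟨rfl, rfl⟩
    · exact h'
    · exact h'.swap_vertices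
  -- Off the cut any edge serves as a default value; one exists because the equator at a vertex is
  -- covered by sides.
  · obtain ⟨F, G, v', w', h'⟩ : ∃ F G v w, EdgeWith (P := P) F G v w := by
      have v : P.vertices := Classical.arbitrary _
      obtain ⟨y, -, hy, -, hvy, -⟩ := exists_orthonormal_pair (v : E3)
      obtain ⟨F, G, w, h, -⟩ := exists_dualSide (y := y) ⟨hy, hvy⟩
      exact ⟨F, G, v, w, h⟩
    exact ⟨(v', w', F, G), fun h => absurd h he⟩

/-- A generic vector orthogonal to `v₀`, exchanged from `v₀` to a vertex `w` of `A` where its slope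
is greatest in `A`, lies in the side dual to an edge that leaves `A` at `w`. -/
lemma exists_cut_edge_of_isMax (hv₀ : v₀ ∉ A) {w : P.vertices} (hw : w ∈ A) {ξ : E3}
    (hξ : ‖ξ‖ = 1) (hξv : ⟪(v₀ : E3), ξ⟫ = 0) (hmax : ∀ x ∈ A, slope v₀ ξ x ≤ slope v₀ ξ w)
    (hgen : ∀ K : P.Face, ξ ≠ exchange v₀ w (K.normalAt w)) :
    ∃ F G b, b ∉ A ∧ EdgeWith F G w b ∧ exchange v₀ w ξ ∈ dualSide F G w := by
  have hvw : v₀ ≠ w := fun h => hv₀ (h ▸ hw)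
  rw [real_inner_comm] at hξv
  have hη0 := inner_exchange_right (w := w) hξv
  obtain ⟨F, G, b, hb, hmem, hstrict⟩ := exists_dualSide_of_generic (v := w)
    (y := exchange v₀ w ξ)
    ⟨by rw [LinearIsometryEquiv.norm_map, hξ], by rw [real_inner_comm]; exact hη0⟩ (by
      intro K _ hK
      apply hgen K
      rw [← hK, exchange_exchange])
  refine ⟨F, G, b, fun hbA => ?_, hb, hmem⟩
  have hbv : b ≠ v₀ := fun h => hv₀ (h ▸ hbA)
  -- If `b` were in `A`, its slope from `v₀` would be at most that of `w`. After the exchange its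
  -- slope from `w` would be at most that of `v₀`, but `b` strictly beats all other vertices there.
  have h1 := slope_exchange hvw hb.vertex_ne.symm hξv
  have h2 := hstrict v₀ hvw hbv.symm
  have h3 : ∀ z : P.vertices, ⟪exchange v₀ w ξ, (z : E3)⟫ / (1 - ⟪(w : E3), (z : E3)⟫) =
      slope w (exchange v₀ w ξ) z := by
    intro z
    rw [slope, inner_sub_right, hη0, sub_zero]
  rw [h3, h3] at h2
  have h4 := inner_vertex_lt_one hb.vertex_ne
  have h5 := inner_vertex_lt_one hbv.symm
  have h6 := hmax b hbA
  nlinarith [mul_pos (sub_pos.2 h4) (sub_pos.2 h2), mul_nonneg (sub_pos.2 h5).le (sub_nonneg.2 h6)]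

/-- Each cut edge contributes its dual side at the endpoint in `A`, moved to the great circle
orthogonal to `v₀` by the reflection exchanging `v₀` with that endpoint. Outside the finite set `B`
a point is covered by an arc belonging to the vertex of `A` with the greatest slope. For strictness,
the arc of the edge `a b` is examined near its end belonging to `F`: there `a'` has a greater slope
than `a`, since `F` contains `a'` but not `v₀`, so these points are covered a second time by an arc
attached to another vertex. -/
lemma cut_sum_aux (hA : A.Nonempty) (hv₀ : v₀ ∉ A) :
    2 * Real.pi ≤ ∑ e ∈ cut A, weight e ∧
    ∀ F G a a' b, EdgeWith F G a b → a ∈ A → b ∉ A → a' ∈ A → a' ≠ a → F.Contains a' →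
      ¬ F.Contains v₀ → 2 * Real.pi < ∑ e ∈ cut A, weight e := by
  choose d hd using exists_cut_data (A := A)
  set m : Sym2 P.vertices → E3 := fun e =>
    exchange v₀ (d e).1 (midpointOfSide (d e).2.2.1 (d e).2.2.2 (d e).1) with hm
  set B : Set E3 := range fun q : P.vertices × P.Face => exchange v₀ q.1 (q.2.normalAt q.1) with hB
  have hdat : ∀ {F G a b}, EdgeWith F G a b → a ∈ A → b ∉ A → s(a, b) ∈ cut A ∧
      (d s(a, b)).1 = a ∧ m s(a, b) = exchange v₀ a (midpointOfSide F G a) := by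
    intro F G a b h ha hb
    have hc : s(a, b) ∈ cut A := mem_cut.2 ⟨h.mem_edges, a, b, ha, hb, rfl⟩
    obtain ⟨h1, h2, h3, h4⟩ := hd _ hc
    have h5 : (d s(a, b)).1 = a := by
      rcases Sym2.eq_iff.1 h4 with ⟨h5, -⟩ | ⟨h5, -⟩
      · exact h5.symm
      · exact absurd (h5 ▸ ha) h2
    refine ⟨hc, h5, ?_⟩
    rw [hm]
    simp only
    rcases h.eq_or_swap h3 h4 with ⟨h6, h7⟩ | ⟨h6, h7⟩
    · rw [h5, h6, h7]
    · rw [h5, h6, h7, h.swap_faces.midpoint_comm]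
  have hcov : ∀ {x : E3} {w : P.vertices}, w ∈ A → ‖x‖ = 1 → ⟪(v₀ : E3), x⟫ = 0 → x ∉ B →
      (∀ z ∈ A, slope v₀ x z ≤ slope v₀ x w) →
      ∃ e ∈ cut A, (d e).1 = w ∧ angle x (m e) ≤ weight e / 2 := by
    intro x w hw hx hxv hxB hmax
    obtain ⟨F, G, b, hb, h, hmem⟩ := exists_cut_edge_of_isMax hv₀ hw hx hxv hmax
      (fun K hK => hxB ⟨(w, K), hK.symm⟩)
    obtain ⟨h1, h2, h3⟩ := hdat h hw hb
    refine ⟨_, h1, h2, ?_⟩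
    rw [h3, ← angle_exchange, h.weight_eq]
    exact h.angle_midpoint_le hmem
  have hmax : ∀ x : E3, ∃ w ∈ A, ∀ z ∈ A, slope v₀ x z ≤ slope v₀ x w := fun x =>
    A.toFinite.exists_maximalFor (slope v₀ x) A hA |>.imp fun w hw =>
      ⟨hw.1, fun z hz => (le_total _ _).elim id (hw.2 hz)⟩
  have key := two_pi_le_sum_of_cover (a := (v₀ : E3)) (s := cut A) (m := m) (θ := weight) (B := B)
    (norm_vertex v₀) (by
      intro e he
      obtain ⟨h1, h2, h3, h4⟩ := hd e he
      have h5 := h3.dualSide_subset_equator h3.midpoint_mem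
      refine ⟨by rw [hm]; simp only [LinearIsometryEquiv.norm_map]; exact h5.1, ?_⟩
      rw [hm]
      simp only
      conv_lhs => rw [← exchange_right v₀ (d e).1]
      rw [LinearIsometryEquiv.inner_map_map]
      exact h5.2) (fun e he => (weight_pos (mem_cut.1 he).1).le) (Set.finite_range _) (by
      intro x hx hxv hxB
      obtain ⟨w, hw, hwmax⟩ := hmax x
      obtain ⟨e, he, -, h⟩ := hcov hw hx hxv hxB hwmax
      exact ⟨e, he, h⟩)
  refine ⟨key.1, fun F G a a' b h ha hb ha' haa' hFa' hFv => ?_⟩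
  obtain ⟨h1, h2, h3⟩ := hdat h ha hb
  have hvne : v₀ ≠ a := fun h => hv₀ (h ▸ ha)
  have hcontS : ∀ z : P.vertices, Continuous fun x => slope v₀ x z := by
    intro z
    unfold slope
    fun_prop
  -- The region where `a` does not have the greatest slope in `A`, so that an arc belonging to a
  -- vertex other than `a` covers.
  set U : Set E3 := {x | slope v₀ x a < slope v₀ x a'} with hU
  have hUo : IsOpen U := isOpen_lt (hcontS a) (hcontS a')
  set γ : ℝ → E3 := fun t => exchange v₀ a (arcPoint (F.normalAt a) (G.normalAt a) t) with hγ
  have hγc : Continuous γ := (exchange v₀ a).continuous.comp (continuous_arcPoint _ _)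
  have hγ0 : γ 0 = exchange v₀ a (F.normalAt a) := by
    rw [hγ]; simp only [arcPoint_zero h.angle_pos h.angle_lt_pi]
  have hperp : ∀ {y}, ⟪(a : E3), y⟫ = 0 → ⟪(v₀ : E3), exchange v₀ a y⟫ = 0 := by
    intro y hy
    conv_lhs => rw [← exchange_right v₀ a]
    rw [LinearIsometryEquiv.inner_map_map, hy]
  have h0U : γ 0 ∈ U := by
    have hFa : ⟪(a : E3), F.normalAt a⟫ = 0 := by
      exact (h.dualSide_subset_equator (left_mem_sphericalArc h.norm_left _)).2
    have hp := hperp hFa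
    rw [real_inner_comm] at hp
    -- Seen from `a`, the normal of `F` has its greatest slope at `a'` and a smaller one at `v₀`.
    -- The exchange turns this into the comparison of `a'` with `a` seen from `v₀`.
    have e1 := slope_exchange hvne haa' hp
    rw [exchange_exchange] at e1
    have e2 := (Face.slope_normalAt_eq_iff h.left_fst haa').2 hFa'
    have e3 := lt_of_le_of_ne (Face.slope_normalAt h.left_fst hvne)
      (mt (Face.slope_normalAt_eq_iff h.left_fst hvne).1 hFv)
    rw [hγ0]
    change slope v₀ _ a < slope v₀ _ a'
    have e4 := inner_vertex_lt_one haa'.symm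
    have e5 : v₀ ≠ a' := fun h => hv₀ (h ▸ ha')
    have e6 := inner_vertex_lt_one e5
    by_contra! hle
    nlinarith [mul_pos (sub_pos.2 e4) (sub_pos.2 (e2 ▸ e3)),
      mul_nonneg (sub_pos.2 e6).le (sub_nonneg.2 hle)]
  refine key.2 _ h1 U hUo ?_ ?_
  · have hpos := h.exterior_pos
    have hev : ∀ᶠ t in 𝓝[>] (0 : ℝ), γ t ∈ U ∧ t ∈ Ioo 0 (exteriorDihedralAngle F G) :=
      ((hγc.continuousAt.eventually (hUo.mem_nhds h0U)).filter_mono nhdsWithin_le_nhds).and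
        (Ioo_mem_nhdsGT hpos)
    obtain ⟨t, ht, ht1⟩ := hev.exists
    have ht2 : t ∈ Icc 0 (angle (F.normalAt a) (G.normalAt a)) := by
      rw [h.angle_eq]; exact ⟨ht1.1.le, ht1.2.le⟩
    have hmem := h.dualSide_subset_equator
      (arcPoint_mem h.norm_left h.norm_right h.angle_pos h.angle_lt_pi ht2)
    refine ⟨γ t, ht, by rw [hγ]; simp only [LinearIsometryEquiv.norm_map]; exact hmem.1,
      hperp hmem.2, ?_⟩
    rw [h3, ← angle_exchange, hγ]
    simp only [exchange_exchange]
    rw [h.angle_arcPoint_midpoint ⟨ht1.1.le, ht1.2.le⟩, h.weight_eq, abs_lt]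
    constructor <;> linarith [ht1.1, ht1.2]
  · intro x hxU hx hxv hxB
    obtain ⟨w, hw, hwmax⟩ := hmax x
    obtain ⟨e, he, hew, hle⟩ := hcov hw hx hxv hxB hwmax
    refine ⟨e, he, ?_, hle⟩
    -- The arc found belongs to a vertex of greatest slope, which is not `a` inside `U`.
    rintro rfl
    rw [h2] at hew
    subst hew
    exact absurd (hwmax a' ha') (not_le.2 hxU)

/-- The exterior dihedral angles along a cut sum up to at least `2π`. -/
lemma two_pi_le_cut_sum (hA : A.Nonempty) (hA' : Aᶜ.Nonempty) :
    2 * Real.pi ≤ ∑ e ∈ cut A, weight e := by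
  obtain ⟨v₀, hv₀⟩ := hA'
  exact (cut_sum_aux hA hv₀).1

/-- The exterior dihedral angles along a cut sum up to more than `2π` if there are at least two
vertices on either side. -/
lemma two_pi_lt_cut_sum (hA : A.Nontrivial) (hA' : Aᶜ.Nontrivial) :
    2 * Real.pi < ∑ e ∈ cut A, weight e := by
  have main : ∀ {A : Set P.vertices}, A.Nontrivial → Aᶜ.Nontrivial → ∀ F G a b z,
      EdgeWith F G a b → a ∈ A → b ∉ A → z ∈ A → z ≠ a → F.Contains z →
      2 * Real.pi < ∑ e ∈ cut A, weight e := by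
    intro A hA hA' F G a b z h ha hb hz hza hFz
    by_cases hv : ∃ v₀, v₀ ∉ A ∧ ¬ F.Contains v₀
    · obtain ⟨v₀, hv₀, hFv⟩ := hv
      exact (cut_sum_aux hA.nonempty hv₀).2 F G a z b h ha hb hz hza hFz hFv
    -- Otherwise the whole complement of `A` lies on `F`. The two sides then change roles: a vertex
    -- off `F` is in `A`, and the complement has a second vertex on `F`.
    · push Not at hv
      obtain ⟨b', hb', hbb'⟩ := hA'.exists_ne b
      obtain ⟨v₀, hv₀⟩ : ∃ v₀, ¬ F.Contains v₀ := by
        obtain ⟨v, -, hv⟩ := h.swap_faces.exists_not_contains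
        exact ⟨v, hv⟩
      have hv₀A : v₀ ∈ A := by
        by_contra hcon
        exact hv₀ (hv v₀ hcon)
      have := (cut_sum_aux (A := Aᶜ) (v₀ := v₀) hA'.nonempty (not_not.2 hv₀A)).2 F G b b' a
        h.swap_vertices hb (not_not.2 ha) hb' hbb' (hv b' hb') hv₀
      rwa [cut_compl] at this
  have hne : (cut A).Nonempty := by
    by_contra hcon
    rw [Finset.not_nonempty_iff_eq_empty] at hcon
    have := two_pi_le_cut_sum hA.nonempty hA'.nonempty
    rw [hcon, Finset.sum_empty] at this
    linarith [Real.pi_pos]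
  obtain ⟨e, he⟩ := hne
  obtain ⟨d, hd⟩ := exists_cut_data (A := A) e
  obtain ⟨ha, hb, h, -⟩ := hd he
  obtain ⟨z, hFz, hza, hzb⟩ := d.2.2.1.exists_contains_ne d.1 d.2.1
  -- A face at a cut edge has a third vertex, which provides the second vertex on one side of the
  -- cut or on the other.
  by_cases hz : z ∈ A
  · exact main hA hA' _ _ _ _ z h ha hb hz hza hFz
  · rw [← cut_compl]
    exact main hA' (by rwa [compl_compl]) _ _ _ _ z h.swap_vertices hb (not_not.2 ha) hz hzb hFz

end cut_sum

end IdealPolyhedron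

namespace IdealPolyhedron
variable {P : IdealPolyhedron}

/-! ### Sets of edges that meet every face evenly -/

/-- Each condition excludes the vectors orthogonal to one nonzero vector, and finitely many
hyperplanes do not cover the space. For the slope conditions the vector is nonzero because `x - v`
and `y - v` are independent. -/
lemma exists_generic_vector : ∃ p : E3,
    (∀ v w : P.vertices, v ≠ w → ⟪p, (v : E3)⟫ ≠ ⟪p, (w : E3)⟫) ∧
    ∀ v x y : P.vertices, x ≠ v → y ≠ v → x ≠ y → slope v p x ≠ slope v p y := by
  set u : {q : P.vertices × P.vertices × P.vertices // q.2.1 ≠ q.1 ∧ q.2.2 ≠ q.1 ∧ q.2.1 ≠ q.2.2} ⊕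
      {q : P.vertices × P.vertices // q.1 ≠ q.2} → E3 :=
    Sum.elim (fun q => (1 - ⟪(q.1.1 : E3), (q.1.2.1 : E3)⟫)⁻¹ • ((q.1.2.1 : E3) - q.1.1) -
      (1 - ⟪(q.1.1 : E3), (q.1.2.2 : E3)⟫)⁻¹ • ((q.1.2.2 : E3) - q.1.1))
      (fun q => (q.1.1 : E3) - q.1.2) with hu
  obtain ⟨p, hp⟩ := Module.Dual.exists_forall_ne_zero_of_forall_exists
    (fun i => innerₗ E3 (u i)) (fun i => ⟨u i, by
      rw [innerₗ_apply_apply, inner_self_ne_zero]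
      rcases i with ⟨⟨v, x, y⟩, hx, hy, hxy⟩ | ⟨⟨v, w⟩, h⟩
      · intro h0
        have h1 := vertex_sub_independent hx hy hxy (1 - ⟪(v : E3), (x : E3)⟫)⁻¹
          (-(1 - ⟪(v : E3), (y : E3)⟫)⁻¹)
          (by rw [neg_smul, ← sub_eq_add_neg]; exact h0)
        have h2 := inner_vertex_lt_one hx.symm
        exact (inv_pos.2 (sub_pos.2 h2)).ne' h1.1
      · intro h0
        exact h (Subtype.ext (sub_eq_zero.1 h0))⟩)
  refine ⟨p, fun v w h h0 => hp (Sum.inr ⟨(v, w), h⟩) ?_, fun v x y hx hy hxy h0 =>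
    hp (Sum.inl ⟨(v, x, y), hx, hy, hxy⟩) ?_⟩
  · simp only [hu, Sum.elim_inr, innerₗ_apply_apply]
    rw [real_inner_comm, inner_sub_right, h0, sub_self]
  · simp only [hu, Sum.elim_inl, innerₗ_apply_apply]
    rw [real_inner_comm, inner_sub_right, real_inner_smul_right, real_inner_smul_right]
    simp only [slope] at h0
    rw [inv_mul_eq_div, inv_mul_eq_div, h0, sub_self]

/-! ### Sides of a face and coboundaries mod 2 -/

open Classical in
/-- The edges of a face. -/
noncomputable def Face.sides (F : P.Face) : Finset (Sym2 P.vertices) :=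
  P.edges.filter fun e => ∀ v ∈ e, F.Contains v

lemma Face.mem_sides {F : P.Face} {v w : P.vertices} :
    s(v, w) ∈ F.sides ↔ ∃ G, EdgeWith F G v w := by
  simp only [Face.sides, Finset.mem_filter, Sym2.mem_iff, forall_eq_or_imp, forall_eq]
  constructor
  · rintro ⟨he, hv, hw⟩
    obtain ⟨F', G, v', w', h, he'⟩ := mem_edges.1 he
    have h' : EdgeWith F' G v w := by
      rcases Sym2.eq_iff.1 he' with ⟨rfl, rfl⟩ | ⟨rfl, rfl⟩
      · exact h
      · exact h.swap_vertices
    rcases h'.face_eq_or_eq hv hw with rfl | rfl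
    · exact ⟨G, h'⟩
    · exact ⟨F', h'.swap_faces⟩
  · rintro ⟨G, h⟩
    exact ⟨h.mem_edges, h.left_fst, h.left_snd⟩

lemma EdgeWith.mem_sides {F G : P.Face} {v w : P.vertices} (h : EdgeWith F G v w) :
    s(v, w) ∈ F.sides := Face.mem_sides.2 ⟨G, h⟩

lemma EdgeWith.sides_filter {F G H : P.Face} {v x y : P.vertices} (h : EdgeWith F G v x)
    (h' : EdgeWith F H v y) (hxy : x ≠ y) [DecidablePred fun e : Sym2 P.vertices => v ∈ e] :
    F.sides.filter (fun e => v ∈ e) = {s(v, x), s(v, y)} := by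
  ext e
  simp only [Finset.mem_filter, Finset.mem_insert, Finset.mem_singleton]
  constructor
  · rintro ⟨he, hv⟩
    obtain ⟨z, rfl⟩ := hv
    obtain ⟨K, hK⟩ := Face.mem_sides.1 he
    rcases h.vertex_eq_or_eq h' hxy hK with rfl | rfl
    · exact Or.inl rfl
    · exact Or.inr rfl
  · rintro (rfl | rfl)
    · exact ⟨h.mem_sides, Sym2.mem_mk_left _ _⟩
    · exact ⟨h'.mem_sides, Sym2.mem_mk_left _ _⟩

/-- The coboundary of a function on the vertices, with values in `ZMod 2`. -/
def coboundary (g : P.vertices → ZMod 2) : Sym2 P.vertices → ZMod 2 :=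
  Sym2.lift ⟨fun v w => g v + g w, fun _ _ => add_comm _ _⟩

/-- Every vertex of a face lies on exactly two of its sides, so each value of `g` is counted twice.
-/
lemma sum_coboundary (g : P.vertices → ZMod 2) (F : P.Face) :
    ∑ e ∈ F.sides, coboundary g e = 0 := by
  classical
  have h1 : ∀ e ∈ F.sides, coboundary g e = ∑ v, if v ∈ e then g v else 0 := by
    intro e he
    induction e with
    | _ v w =>
      obtain ⟨G, h⟩ := Face.mem_sides.1 he
      rw [← Finset.sum_filter, show (Finset.univ.filter fun z => z ∈ s(v, w)) = {v, w} by
        ext z; simp [Sym2.mem_iff], Finset.sum_pair h.vertex_ne]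
      rfl
  rw [Finset.sum_congr rfl h1, Finset.sum_comm]
  refine Finset.sum_eq_zero fun v _ => ?_
  rw [← Finset.sum_filter, Finset.sum_const]
  by_cases hv : F.Contains v
  · obtain ⟨G, x, H, y, h, h', hxy⟩ := Face.exists_two_edges hv
    rw [h.sides_filter h' hxy, Finset.card_pair, two_nsmul, CharTwo.add_self_eq_zero]
    intro h0
    exact hxy (Sym2.congr_right.1 h0)
  · rw [Finset.card_eq_zero.2, zero_smul]
    refine Finset.filter_eq_empty_iff.2 fun e he hve => hv ?_
    obtain ⟨z, rfl⟩ := hve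
    exact (Face.mem_sides.1 he).elim fun _ h => h.left_fst

/-- A vertex whose height is not the greatest has a neighbour of greater height, and the steepest
edge at it is steeper than any other direction. -/
lemma exists_steepest_edge (p : E3) (v : P.vertices) : ∃ x, (∃ F G, EdgeWith F G v x) ∧
    ∀ z, z ≠ v → slope v p z ≤ slope v p x := by
  have hne : {x | ∃ F G, EdgeWith F G v x}.Nonempty := by
    obtain ⟨y, -, hy, -, hvy, -⟩ := exists_orthonormal_pair (v : E3)
    obtain ⟨F, G, w, h, -⟩ := exists_dualSide (y := y) ⟨hy, hvy⟩
    exact ⟨w, F, G, h⟩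
  -- The steepest among the edges at `v` is compared with its neighbours on its two faces only; by
  -- convexity such a local maximum is global.
  obtain ⟨x, hx, hmax⟩ := (toFinite _).exists_maximalFor (slope v p) _ hne
  have hmax' : ∀ {F G y}, EdgeWith F G v y → slope v p y ≤ slope v p x := fun h =>
    (le_total _ _).elim id (hmax ⟨_, _, h⟩)
  refine ⟨x, hx, fun z hz => ?_⟩
  obtain ⟨F, G, h⟩ := hx
  have other : ∀ {F G}, EdgeWith F G v x → ∃ H y, EdgeWith F H v y ∧ y ≠ x := by
    intro F G h
    obtain ⟨H, y, K, z, hy, hz, hyz⟩ := Face.exists_two_edges h.left_fst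
    by_cases hyx : y = x
    · exact ⟨K, z, hz, fun h => hyz (hyx.trans h.symm)⟩
    · exact ⟨H, y, hy, hyx⟩
  obtain ⟨H, y, h1, h2⟩ := other h
  obtain ⟨K, w, h3, h4⟩ := other h.swap_faces
  exact h.slope_le_of_neighbours h1 h2 h3 h4 (hmax' h1) (hmax' h3) hz

lemma slope_pos_iff {v x : P.vertices} (hx : x ≠ v) (p : E3) :
    0 < slope v p x ↔ ⟪p, (v : E3)⟫ < ⟪p, (x : E3)⟫ := by
  have := inner_vertex_lt_one hx.symm
  rw [slope, lt_div_iff₀ (sub_pos.2 this), zero_mul, inner_sub_right, sub_pos]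

/-- Every function on the edges with values in `ZMod 2` that sums to zero over each face is a
coboundary. -/
lemma exists_coboundary_eq {c : Sym2 P.vertices → ZMod 2}
    (hc : ∀ F : P.Face, ∑ e ∈ F.sides, c e = 0) :
    ∃ g : P.vertices → ZMod 2, ∀ e ∈ P.edges, c e = coboundary g e := by
  classical
  obtain ⟨p, hp1, hp2⟩ := exists_generic_vector (P := P)
  choose T hT hTmax using exists_steepest_edge (P := P) p
  let r : P.vertices → P.vertices → Prop := fun a b => ⟪p, (b : E3)⟫ < ⟪p, (a : E3)⟫
  have hwf : WellFounded r := by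
    have : IsTrans _ r := ⟨fun _ _ _ h h' => lt_trans h' h⟩
    have : Std.Irrefl r := ⟨fun _ h => lt_irrefl _ h⟩
    exact Finite.wellFounded_of_trans_of_irrefl r
  -- The function is integrated down the forest of steepest ascending edges, starting with the value
  -- zero where the steepest edge does not ascend. The difference `D` from the coboundary then
  -- vanishes on this forest, and it remains to show that it vanishes on all edges.
  let g : P.vertices → ZMod 2 :=
    hwf.fix fun v ih => if h : r (T v) v then ih (T v) h + c s(v, T v) else 0
  have hg : ∀ v, r (T v) v → g v = g (T v) + c s(v, T v) := by
    intro v h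
    change hwf.fix _ v = _
    rw [hwf.fix_eq, dif_pos h]
  set D : Sym2 P.vertices → ZMod 2 := fun e => c e + coboundary g e with hD
  have hDF : ∀ F : P.Face, ∑ e ∈ F.sides, D e = 0 := by
    intro F
    rw [hD, Finset.sum_add_distrib, hc, sum_coboundary, add_zero]
  have hDT : ∀ v, r (T v) v → D s(v, T v) = 0 := by
    intro v h
    change c s(v, T v) + (g v + g (T v)) = 0
    rw [hg v h, add_right_comm, CharTwo.add_self_eq_zero, zero_add, add_comm,
      CharTwo.add_self_eq_zero]
  refine ⟨g, fun e he => ?_⟩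
  suffices h : D e = 0 by
    rw [← CharTwo.add_eq_zero]
    exact h
  by_contra hne
  -- Lower ends of the edges on which `D` does not vanish. Below, `v` is the highest of them and `x`
  -- the upper end of the steepest such ascending edge at `v`.
  set S : Set P.vertices := {v | ∃ x, (∃ F G, EdgeWith F G v x) ∧ 0 < slope v p x ∧
    D s(v, x) ≠ 0} with hS
  have hup : ∀ {F G v x}, EdgeWith F G v x → D s(v, x) ≠ 0 → (v ∈ S ∧ 0 < slope v p x) ∨
      (x ∈ S ∧ 0 < slope x p v) := by
    intro F G v x h hDe
    rcases lt_or_gt_of_ne (hp1 v x h.vertex_ne) with h1 | h1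
    · rw [← slope_pos_iff h.vertex_ne.symm] at h1
      exact Or.inl ⟨⟨x, ⟨F, G, h⟩, h1, hDe⟩, h1⟩
    · rw [← slope_pos_iff h.vertex_ne] at h1
      exact Or.inr ⟨⟨v, ⟨F, G, h.swap_vertices⟩, h1, Sym2.eq_swap (a := v) ▸ hDe⟩, h1⟩
  have hSne : S.Nonempty := by
    obtain ⟨F, G, v, w, h, rfl⟩ := mem_edges.1 he
    rcases hup h hne with h1 | h1
    · exact ⟨_, h1.1⟩
    · exact ⟨_, h1.1⟩
  obtain ⟨v, hv, hvmax⟩ := S.toFinite.exists_maximalFor (fun v : P.vertices => ⟪p, (v : E3)⟫) S hSne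
  obtain ⟨x, ⟨⟨F, G, h⟩, hx0, hxD⟩, hxmax⟩ := (toFinite {x | (∃ F G, EdgeWith F G v x) ∧
    0 < slope v p x ∧ D s(v, x) ≠ 0}).exists_maximalFor (slope v p) _ hv
  -- The edge to `x` is not the steepest one at `v`, since `D` vanishes on the steepest edge if it
  -- ascends; genericity excludes ties.
  have hxT : slope v p x < slope v p (T v) := by
    obtain ⟨F', G', hT'⟩ := hT v
    refine lt_of_le_of_ne (hTmax v x h.vertex_ne.symm) (hp2 _ _ _ h.vertex_ne.symm
      hT'.vertex_ne.symm fun hxT => ?_)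
    rw [hxT] at hxD hx0
    exact hxD (hDT v ((slope_pos_iff hT'.vertex_ne.symm p).1 hx0))
  -- On either face at the edge `v x`, the other edge at `v` is not steeper. If it were, `D` would
  -- vanish on it by the choice of `x`, and the remaining sides of the face would lie above `v`,
  -- where `D` vanishes by the choice of `v`. The sum of `D` over the face would then be the single
  -- nonzero value at `v x`.
  have key : ∀ {F G}, EdgeWith F G v x → ∃ H y, EdgeWith F H v y ∧ y ≠ x ∧
      slope v p y ≤ slope v p x := by
    intro F G h
    obtain ⟨H, y, hy, hyx⟩ : ∃ H y, EdgeWith F H v y ∧ y ≠ x := by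
      obtain ⟨H, y, K, z, hy, hz, hyz⟩ := Face.exists_two_edges h.left_fst
      by_cases hyx : y = x
      · exact ⟨K, z, hz, fun h => hyz (hyx.trans h.symm)⟩
      · exact ⟨H, y, hy, hyx⟩
    refine ⟨H, y, hy, hyx, ?_⟩
    by_contra! hlt
    have hy0 := hx0.trans hlt
    have hne : s(v, x) ≠ s(v, y) := fun h0 => hyx (Sym2.congr_right.1 h0).symm
    have hDy : D s(v, y) = 0 := by
      by_contra hDy
      exact absurd (hxmax ⟨⟨F, H, hy⟩, hy0, hDy⟩ hlt.le) (not_le.2 hlt)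
    have h0 := hDF F
    rw [Finset.sum_eq_single s(v, x)] at h0
    · exact hxD h0
    · intro e he hex
      by_contra hDe
      have hve : v ∉ e := by
        intro hve
        have h1 : e ∈ F.sides.filter (fun e => v ∈ e) := Finset.mem_filter.2 ⟨he, hve⟩
        rw [h.sides_filter hy hyx.symm, Finset.mem_insert, Finset.mem_singleton] at h1
        rcases h1 with rfl | rfl
        · exact hex rfl
        · exact hDe hDy
      have low : ∀ z ∈ e, F.Contains z → z ∉ S := by
        intro z hz hFz hzS
        have hzv : z ≠ v := fun h => hve (h ▸ hz)
        have hpos := h.inner_corner_pos hy hyx.symm hFz hzv (p := p)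
          (by rw [inner_sub_right, sub_pos]; exact (slope_pos_iff h.vertex_ne.symm p).1 hx0)
          (by rw [inner_sub_right, sub_pos]; exact (slope_pos_iff hy.vertex_ne.symm p).1 hy0)
        rw [inner_sub_right, sub_pos] at hpos
        exact absurd (hvmax hzS hpos.le) (not_le.2 hpos)
      induction e with
      | _ a b =>
        obtain ⟨K, hK⟩ := Face.mem_sides.1 he
        rcases hup hK hDe with h1 | h1
        · exact low a (Sym2.mem_mk_left _ _) hK.left_fst h1.1
        · exact low b (Sym2.mem_mk_right _ _) hK.left_snd h1.1
    · exact fun hns => absurd h.mem_sides hns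
  obtain ⟨H, y, hy, hyx, hys⟩ := key h
  obtain ⟨K, z, hz, hzx, hzs⟩ := key h.swap_faces
  obtain ⟨F', G', hT'⟩ := hT v
  -- Neither neighbour of `x` is steeper, so `x` has the greatest slope of all, contrary to `hxT`.
  exact absurd (h.slope_le_of_neighbours hy hyx hz hzx hys hzs hT'.vertex_ne.symm) (not_le.2 hxT)

open Classical in
/-- A set of edges with an even number of edges in each face is a cut. -/
lemma exists_cut_eq {C : Finset (Sym2 P.vertices)} (hC : C ⊆ P.edges)
    (hF : ∀ F : P.Face, Even (C ∩ F.sides).card) : ∃ A, C = cut A := by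
  obtain ⟨g, hg⟩ := exists_coboundary_eq (c := fun e => if e ∈ C then 1 else 0) (by
    intro F
    rw [Finset.sum_boole, ZMod.natCast_eq_zero_iff_even, Finset.filter_mem_eq_inter,
      Finset.inter_comm]
    exact hF F)
  refine ⟨{v | g v = 1}, ?_⟩
  ext e
  by_cases he : e ∈ P.edges
  · have h1 := hg e he
    induction e with
    | _ v w =>
      rw [mk_mem_cut, mem_ofPred_eq, mem_ofPred_eq]
      change (if _ then _ else _) = g v + g w at h1
      have key : ∀ a b : ZMod 2, a + b = 1 ↔ (a = 1 ↔ b ≠ 1) := by decide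
      rw [← key, ← h1]
      by_cases hC : s(v, w) ∈ C
      · simp [hC, he]
      · simp [hC]
  · exact ⟨fun h => absurd (hC h) he, fun h => absurd (mem_cut.1 h).1 he⟩

end IdealPolyhedron

/-- On a great circle, a minimal arc from a point `x` of the arc from `a` to `b` to a point that is
not in this arc passes through `a` or `b`. -/
lemma angle_eq_add_of_exit {a b x y n : E3} (hn : n ≠ 0)
    (hab : ∀ s t : ℝ, s • a + t • b = 0 → s = 0 ∧ t = 0) (ha1 : ‖a‖ = 1) (hb1 : ‖b‖ = 1)
    (ha : ⟪n, a⟫ = 0) (hb : ⟪n, b⟫ = 0) (hpi : angle a b ≠ Real.pi) (hx : x ∈ sphericalArc a b)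
    (hy1 : ‖y‖ = 1) (hy : ⟪n, y⟫ = 0) (hyab : y ∉ sphericalArc a b) :
    angle x y = angle x a + angle a y ∨ angle x y = angle x b + angle b y := by
  obtain ⟨hx1, α, β, hα, hβ, hxe⟩ := (mem_sphericalArc_iff hpi).1 hx
  obtain ⟨s, t, hye⟩ := exists_combination_of_orthogonal hn hab ha hb hy
  have hst : s < 0 ∨ t < 0 := by
    by_contra! h
    exact hyab ((mem_sphericalArc_iff hpi).2 ⟨hy1, s, t, h.1, h.2, hye⟩)
  have ha0 := inner_eq_zero_iff_ne ha1
  have hb0 := inner_eq_zero_iff_ne hb1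
  -- The sign of this determinant tells in which sense the short arc from `x` to `y` turns. If it is
  -- negative, `b` lies in the cone of `x` and `y`, if positive, `a` does; the coefficients come
  -- from Cramer's rule. If it is zero, the points are antipodal and every point of the circle lies
  -- on a minimal arc.
  rcases lt_trichotomy (β * s - α * t) 0 with h | h | h
  · right
    have hs : s ≤ 0 := by
      by_contra! hs
      rcases hst with h1 | h1 <;> nlinarith [mul_nonneg hβ hs.le, mul_nonneg hα (neg_pos.2 h1).le]
    have hΔ : 0 < α * t - β * s := by linarith
    have hk := mul_inv_cancel₀ hΔ.ne'
    have hk0 := (inv_pos.2 hΔ).le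
    refine angle_eq_add_of_mem_cone hb0 (s := -s * (α * t - β * s)⁻¹)
      (t := α * (α * t - β * s)⁻¹) (mul_nonneg (by linarith) hk0) (mul_nonneg hα hk0) ?_
    rw [hxe, hye]
    match_scalars
    · linear_combination -hk
    · ring
  · have hneg : x = -y := by
      have h1 : β • y = t • x := by
        rw [hxe, hye]
        match_scalars <;> linarith
      have h2 : α • y = s • x := by
        rw [hxe, hye]
        match_scalars <;> linarith
      have hαβ : 0 < α ∨ 0 < β := by
        by_contra! hcon
        rw [le_antisymm hcon.1 hα, le_antisymm hcon.2 hβ] at hxe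
        exact inner_eq_zero_iff_ne hx1 (by rw [hxe]; module)
      have main : ∀ {c r : ℝ}, 0 < c → c • y = r • x → x = y ∨ x = -y := by
        intro c r hc h
        have h3 := congrArg norm h
        rw [norm_smul, norm_smul, hx1, hy1, mul_one, mul_one, Real.norm_of_nonneg hc.le,
          Real.norm_eq_abs] at h3
        rcases abs_choice r with h4 | h4
        · rw [h4] at h3
          rw [← h3] at h
          exact Or.inl (smul_right_injective _ hc.ne' h).symm
        · rw [h4] at h3
          rw [show r = -c by linarith, neg_smul, ← smul_neg] at h
          exact Or.inr (neg_eq_iff_eq_neg.1 (smul_right_injective _ hc.ne' h).symm)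
      have := hαβ.elim (fun hc => main hc h2) fun hc => main hc h1
      exact this.resolve_left fun h => hyab (h ▸ hx)
    left
    rw [hneg, angle_neg_left, angle_neg_left, angle_self (inner_eq_zero_iff_ne hy1), angle_comm y a]
    ring
  · left
    have ht : t ≤ 0 := by
      by_contra! ht
      rcases hst with h1 | h1 <;> nlinarith [mul_nonneg hα ht.le, mul_nonneg hβ (neg_pos.2 h1).le]
    have hΔ : 0 < β * s - α * t := by linarith
    have hk := mul_inv_cancel₀ hΔ.ne'
    have hk0 := (inv_pos.2 hΔ).le
    refine angle_eq_add_of_mem_cone ha0 (s := -t * (β * s - α * t)⁻¹)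
      (t := β * (β * s - α * t)⁻¹) (mul_nonneg (by linarith) hk0) (mul_nonneg hβ hk0) ?_
    rw [hxe, hye]
    match_scalars
    · linear_combination -hk
    · ring

namespace IdealPolyhedron
variable {P : IdealPolyhedron}

/-! ### Chains of edges in the dual graph -/

lemma EdgeWith.angle_eq_add_of_exit {F G : P.Face} {v w : P.vertices} (h : EdgeWith F G v w)
    {x y : E3} (hx : x ∈ dualSide F G v) (hy : y ∈ equator (v : E3)) (hyn : y ∉ dualSide F G v) :
    angle x y = angle x (F.normalAt v) + angle (F.normalAt v) y ∨
      angle x y = angle x (G.normalAt v) + angle (G.normalAt v) y :=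
  _root_.angle_eq_add_of_exit (n := v) (inner_eq_zero_iff_ne (norm_vertex v)) h.normalAt_independent
    h.norm_left h.norm_right (by rw [real_inner_comm]; exact Face.inner_normalAt h.left_fst)
    (by rw [real_inner_comm]; exact Face.inner_normalAt h.right_fst) h.angle_lt_pi.ne hx hy.1 hy.2
    hyn

lemma Face.normalAt_mem_equator {F : P.Face} {v : P.vertices} (h : F.Contains v) :
    F.normalAt v ∈ equator (v : E3) :=
  ⟨Face.norm_normalAt h, by rw [real_inner_comm]; exact Face.inner_normalAt h⟩

lemma slope_combination (v : P.vertices) (s t : ℝ) (p q : E3) (z : P.vertices) :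
    slope v (s • p + t • q) z = s * slope v p z + t * slope v q z := by
  simp only [slope, inner_add_left, real_inner_smul_left]
  ring

/-- The first step along the boundary of the polygon dual to `v`, from `F` to `G`. -/
lemma exists_edge_toward {F G : P.Face} {v : P.vertices} (hF : F.Contains v) (hG : G.Contains v)
    (hFG : F ≠ G) : ∃ H x, EdgeWith F H v x ∧ angle (F.normalAt v) (G.normalAt v) =
      angle (F.normalAt v) (H.normalAt v) + angle (H.normalAt v) (G.normalAt v) := by
  obtain ⟨H₁, x, H₂, y, h₁, h₂, hxy⟩ := Face.exists_two_edges hF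
  -- Between antipodal normals every route is minimal, and any neighbour of `F` serves.
  by_cases hanti : F.normalAt v = -G.normalAt v
  · refine ⟨H₁, x, h₁, ?_⟩
    rw [hanti, angle_neg_left, angle_neg_left, angle_self (inner_eq_zero_iff_ne
      (Face.norm_normalAt hG)), angle_comm (G.normalAt v)]
    ring
  have key : ∀ {H₁ H₂ x y}, EdgeWith F H₁ v x → EdgeWith F H₂ v y → x ≠ y →
      slope v (G.normalAt v) y ≤ slope v (G.normalAt v) x → ∃ H x, EdgeWith F H v x ∧
        angle (F.normalAt v) (G.normalAt v) =
          angle (F.normalAt v) (H.normalAt v) + angle (H.normalAt v) (G.normalAt v) := by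
    intro H₁ H₂ x y h₁ h₂ hxy hle
    refine ⟨H₁, x, h₁, ?_⟩
    obtain ⟨s, t, hst⟩ := exists_combination_of_orthogonal (d := (v : E3)) (x := G.normalAt v)
      (inner_eq_zero_iff_ne (norm_vertex v)) h₁.normalAt_independent
      (Face.normalAt_mem_equator hF).2 (Face.normalAt_mem_equator h₁.right_fst).2
      (Face.normalAt_mem_equator hG).2
    have e1 := (Face.slope_normalAt_eq_iff hF h₁.vertex_ne.symm).2 h₁.left_snd
    have e2 := (Face.slope_normalAt_eq_iff hF h₂.vertex_ne.symm).2 h₂.left_snd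
    have e3 := (Face.slope_normalAt_eq_iff h₁.right_fst h₁.vertex_ne.symm).2 h₁.right_snd
    have e4 := lt_of_le_of_ne (Face.slope_normalAt h₁.right_fst h₂.vertex_ne.symm)
      (mt (Face.slope_normalAt_eq_iff h₁.right_fst h₂.vertex_ne.symm).1
        (h₁.not_contains_of_ne h₂ hxy))
    rw [hst, slope_combination, slope_combination, e1, e2, e3] at hle
    -- The slopes of `F` at `x` and `y` are equal, while that of `H₁` is smaller at `y`; so the
    -- comparison of slopes for `G` decides the sign of `t`, that is, on which side of `F` the
    -- normal of `G` lies.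
    have ht : 0 ≤ t := by nlinarith
    have hn := inner_eq_zero_iff_ne h₁.norm_right
    rcases ht.eq_or_lt with rfl | ht
    · exfalso
      rw [zero_smul, add_zero] at hst
      have := congrArg norm hst
      rw [norm_smul, Face.norm_normalAt hF, Face.norm_normalAt hG, mul_one, Real.norm_eq_abs] at this
      rcases abs_choice s with hs | hs
      · rw [hs] at this
        rw [← this, one_smul] at hst
        exact hFG (Face.normalAt_injective hG hF hst).symm
      · rw [hs] at this
        rw [show s = -1 by linarith, neg_smul, one_smul] at hst
        exact hanti (by rw [hst, neg_neg])
    rcases le_or_gt s 0 with hs | hs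
    · refine angle_eq_add_of_mem_cone hn (s := -s / t) (t := 1 / t)
        (div_nonneg (by linarith) ht.le) (by positivity) ?_
      rw [hst]
      have := ht.ne'
      match_scalars <;> field_simp
      ring
    · have hmem : G.normalAt v ∈ dualSide F H₁ v :=
        h₁.mem_dualSide_iff.2 ⟨Face.norm_normalAt hG, s, t, hs.le, ht.le, hst⟩
      rcases h₁.eq_or_eq_of_normalAt_mem hG hmem with rfl | rfl
      · exact absurd rfl hFG
      · rw [angle_self hn, add_zero]
  rcases le_total (slope v (G.normalAt v) y) (slope v (G.normalAt v) x) with h | h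
  · exact key h₁ h₂ hxy h
  · exact key h₂ h₁ hxy.symm h

/-! ### Joining faces by edges mod 2 -/

open Classical in
/-- The set of edges `C` joins the faces `F` and `G` modulo 2 in the dual graph. -/
def JoinsBy (C : Finset (Sym2 P.vertices)) (F G : P.Face) : Prop :=
  C ⊆ P.edges ∧ ∀ K : P.Face, ∑ e ∈ K.sides, (if e ∈ C then (1 : ZMod 2) else 0) =
    (if K = F then 1 else 0) + if K = G then 1 else 0

lemma joinsBy_empty (F : P.Face) : JoinsBy ∅ F F :=
  ⟨Finset.empty_subset _, fun K => by simp [CharTwo.add_self_eq_zero]⟩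

lemma JoinsBy.symm {C : Finset (Sym2 P.vertices)} {F G : P.Face} (h : JoinsBy C F G) :
    JoinsBy C G F := ⟨h.1, fun K => by rw [h.2, add_comm]⟩

-- Concatenation of chains mod 2: edges used twice cancel.
open Classical in
lemma JoinsBy.trans {C D : Finset (Sym2 P.vertices)} {F G H : P.Face} (h : JoinsBy C F G)
    (h' : JoinsBy D G H) : JoinsBy (symmDiff C D) F H := by
  refine ⟨Finset.symmDiff_subset_union.trans (Finset.union_subset h.1 h'.1), fun K => ?_⟩
  have h1 : ∀ e : Sym2 P.vertices, (if e ∈ symmDiff C D then (1 : ZMod 2) else 0) =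
      (if e ∈ C then 1 else 0) + if e ∈ D then 1 else 0 := by
    intro e
    by_cases hC : e ∈ C <;> by_cases hD : e ∈ D <;>
      simp [Finset.mem_symmDiff, hC, hD, CharTwo.add_self_eq_zero]
  rw [Finset.sum_congr rfl fun e _ => h1 e, Finset.sum_add_distrib, h.2, h'.2, add_assoc,
    ← add_assoc (if K = G then (1 : ZMod 2) else 0), CharTwo.add_self_eq_zero, zero_add]

lemma EdgeWith.joinsBy {F G : P.Face} {v w : P.vertices} (h : EdgeWith F G v w) :
    JoinsBy {s(v, w)} F G := by
  classical
  refine ⟨Finset.singleton_subset_iff.2 h.mem_edges, fun K => ?_⟩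
  simp only [Finset.mem_singleton]
  rw [Finset.sum_ite_eq']
  by_cases hK : s(v, w) ∈ K.sides
  · obtain ⟨H, hH⟩ := Face.mem_sides.1 hK
    rcases h.face_eq_or_eq hH.left_fst hH.left_snd with rfl | rfl
    · rw [if_pos hK, if_pos rfl, if_neg h.face_ne, add_zero]
    · rw [if_pos hK, if_pos rfl, if_neg h.face_ne.symm, zero_add]
  · rw [if_neg hK, if_neg, if_neg, add_zero]
    · rintro rfl; exact hK h.swap_faces.mem_sides
    · rintro rfl; exact hK h.mem_sides

open Classical in
lemma sum_weight_symmDiff_le {C D : Finset (Sym2 P.vertices)} (hC : C ⊆ P.edges)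
    (hD : D ⊆ P.edges) :
    ∑ e ∈ symmDiff C D, weight e ≤ ∑ e ∈ C, weight e + ∑ e ∈ D, weight e := by
  have h1 : ∑ e ∈ symmDiff C D, weight e ≤ ∑ e ∈ C ∪ D, weight e :=
    Finset.sum_le_sum_of_subset_of_nonneg Finset.symmDiff_subset_union
      fun e he _ => (weight_pos (Finset.union_subset hC hD he)).le
  have h2 := Finset.sum_union_inter (s₁ := C) (s₂ := D) (f := weight)
  have h3 : 0 ≤ ∑ e ∈ C ∩ D, weight e :=
    Finset.sum_nonneg fun e he => (weight_pos (hC (Finset.mem_inter.1 he).1)).le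
  linarith

/-- Two faces at a vertex are joined along the boundary of the polygon dual to it. -/
lemma exists_joinsBy {F G : P.Face} {v : P.vertices} (hF : F.Contains v) (hG : G.Contains v) :
    ∃ C, JoinsBy C F G ∧ ∑ e ∈ C, weight e = angle (F.normalAt v) (G.normalAt v) ∧
      ∀ K : P.Face, K.Contains v → ∀ e ∈ C, e ∈ K.sides →
        angle (K.normalAt v) (G.normalAt v) ≤ angle (F.normalAt v) (G.normalAt v) := by
  classical
  let r : P.Face → P.Face → Prop := fun H K =>
    angle (H.normalAt v) (G.normalAt v) < angle (K.normalAt v) (G.normalAt v)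
  have hwf : WellFounded r := by
    have : IsTrans _ r := ⟨fun _ _ _ h h' => lt_trans h h'⟩
    have : Std.Irrefl r := ⟨fun _ h => lt_irrefl _ h⟩
    exact Finite.wellFounded_of_trans_of_irrefl r
  induction F using hwf.induction with
  | _ F ih =>
    by_cases hFG : F = G
    · subst hFG
      exact ⟨∅, joinsBy_empty F, by
        rw [angle_self (inner_eq_zero_iff_ne (Face.norm_normalAt hF)), Finset.sum_empty], by simp⟩
    obtain ⟨H, x, h, hang⟩ := exists_edge_toward hF hG hFG
    have hpos := h.angle_pos
    have hlt : r H F := by change _ < _; linarith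
    obtain ⟨C, hC, hsum, hle⟩ := ih H hlt h.right_fst
    -- This is what the third clause of the induction is for: `F` is farther from `G` than any face
    -- at `v` that has an edge of `C` as a side. So the new edge is not in `C`, nothing cancels, and
    -- lengths add exactly.
    have hnot : s(v, x) ∉ C := fun hmem => by
      have := hle F hF _ hmem h.mem_sides
      change _ < _ at hlt
      linarith
    have hdis : symmDiff {s(v, x)} C = insert s(v, x) C := by
      ext e
      simp only [Finset.mem_symmDiff, Finset.mem_singleton, Finset.mem_insert]
      constructor
      · tauto
      · rintro (rfl | he)
        · exact Or.inl ⟨rfl, hnot⟩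
        · exact Or.inr ⟨he, fun h => hnot (h ▸ he)⟩
    refine ⟨_, h.joinsBy.trans hC, ?_, ?_⟩
    · rw [hdis, Finset.sum_insert hnot, hsum, hang, h.weight_eq, h.angle_eq]
    · rw [hdis]
      intro K hK e he heK
      rcases Finset.mem_insert.1 he with rfl | he
      · obtain ⟨L, hL⟩ := Face.mem_sides.1 heK
        rcases h.face_eq_or_eq hL.left_fst hL.left_snd with rfl | rfl
        · exact le_rfl
        · exact hlt.le
      · exact (hle K hK e he heK).trans hlt.le

open Classical in
/-- The length of a chain of edges joining two faces at `v` is at least their distance in the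
polygon dual to `v`. -/
lemma JoinsBy.angle_le {C : Finset (Sym2 P.vertices)} {F G : P.Face} (h : JoinsBy C F G)
    {v : P.vertices} (hF : F.Contains v) (hG : G.Contains v) :
    angle (F.normalAt v) (G.normalAt v) ≤ ∑ e ∈ C, weight e := by
  obtain ⟨D, hD, hsum, -⟩ := exists_joinsBy hF hG
  have hCD := h.trans hD.symm
  -- The given chain and the boundary arc `D` together form a cycle mod 2, hence a cut. If it is
  -- nonempty its length is at least `2π`; as `D` has length at most `π`, the chain has length at
  -- least `π`.
  obtain ⟨A, hA⟩ := exists_cut_eq hCD.1 (fun K => by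
    rw [← ZMod.natCast_eq_zero_iff_even, Finset.inter_comm, ← Finset.filter_mem_eq_inter,
      ← Finset.sum_boole, hCD.2, CharTwo.add_self_eq_zero])
  by_cases h0 : symmDiff C D = ∅
  · rw [← Finset.bot_eq_empty, symmDiff_eq_bot] at h0
    rw [h0, hsum]
  · obtain ⟨e, he⟩ := Finset.nonempty_iff_ne_empty.2 h0
    rw [hA] at he
    obtain ⟨-, a, b, ha, hb, -⟩ := mem_cut.1 he
    have h1 := two_pi_le_cut_sum ⟨a, ha⟩ ⟨b, hb⟩
    have h2 := sum_weight_symmDiff_le h.1 hD.1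
    rw [hA, hsum] at h2
    have h3 := angle_le_pi (F.normalAt v) (G.normalAt v)
    linarith

end IdealPolyhedron

namespace IdealPolyhedron
variable {P : IdealPolyhedron}

/-! ### The polygons embed isometrically in the Gaussian image -/

/-- The points `p` and `q` of the polygons dual to `v` and `w` are identified along the sides dual
to the edge between `F` and `G`. -/
structure Matched (F G : P.Face) (v w : P.vertices) (p q : E3) : Prop where
  edge : EdgeWith F G v w
  left_mem : p ∈ dualSide F G v
  right_mem : q ∈ dualSide F G w
  angle_eq : angle (F.normalAt v) p = angle (F.normalAt w) q

lemma glued_iff {p q : P.DualPieces} :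
    Glued p q ↔ ∃ F G, Matched F G p.vertex q.vertex p.point q.point := by
  constructor
  · rintro ⟨hne, F, G, h1, h2, h3, h4, h5⟩
    exact ⟨F, G, ⟨h1.1, hne, h1.2.1, h2.2.1, h1.2.2.1, h2.2.2.1⟩, h3, h4, h5⟩
  · rintro ⟨F, G, h1, h2, h3, h4⟩
    exact ⟨h1.vertex_ne, F, G, h1.isEdgeAt, h1.swap_vertices.isEdgeAt, h2, h3, h4⟩

namespace Matched
variable {F G : P.Face} {v w : P.vertices} {p q p' q' : E3}

lemma swap_vertices (h : Matched F G v w p q) : Matched F G w v q p :=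
  ⟨h.edge.swap_vertices, h.right_mem, h.left_mem, h.angle_eq.symm⟩

lemma swap_faces (h : Matched F G v w p q) : Matched G F v w p q := by
  refine ⟨h.edge.swap_faces, ?_, ?_, ?_⟩
  · rw [dualSide, sphericalArc_comm]; exact h.left_mem
  · rw [dualSide, sphericalArc_comm]; exact h.right_mem
  · have h1 := h.left_mem.2
    have h2 := h.right_mem.2
    rw [h.edge.angle_eq] at h1
    rw [h.edge.swap_vertices.angle_eq] at h2
    rw [angle_comm, angle_comm _ q]
    linarith [h.angle_eq]

lemma angle_eq_snd (h : Matched F G v w p q) : angle (G.normalAt v) p = angle (G.normalAt w) q :=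
  h.swap_faces.angle_eq

lemma arcPoint_left (h : Matched F G v w p q) :
    arcPoint (F.normalAt v) (G.normalAt v) (angle (F.normalAt v) p) = p :=
  arcPoint_angle_of_mem h.edge.norm_left h.edge.norm_right h.edge.angle_pos h.edge.angle_lt_pi
    h.left_mem

lemma angle_eq_abs (h : Matched F G v w p q) (h' : Matched F G v w p' q') :
    angle p p' = |angle (F.normalAt v) p - angle (F.normalAt v) p'| := by
  nth_rewrite 1 [← h.arcPoint_left, ← h'.arcPoint_left]
  exact angle_arcPoint h.edge.norm_left h.edge.norm_right h.edge.angle_pos h.edge.angle_lt_pi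
    (angle_mem_Icc_of_mem h.left_mem) (angle_mem_Icc_of_mem h'.left_mem)

lemma angle_congr (h : Matched F G v w p q) (h' : Matched F G v w p' q') :
    angle p p' = angle q q' := by
  rw [h.angle_eq_abs h', h.swap_vertices.angle_eq_abs h'.swap_vertices, h.angle_eq, h'.angle_eq]

end Matched

/-- An arc in `v^*` from a point of the side between `F` and `G` to the vertex of another face
passes through an end of this side. -/
lemma EdgeWith.angle_normalAt_eq_add {F G H : P.Face} {v w : P.vertices} (h : EdgeWith F G v w)
    {x : E3} (hx : x ∈ dualSide F G v) (hH : H.Contains v) :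
    angle x (H.normalAt v) = angle x (F.normalAt v) + angle (F.normalAt v) (H.normalAt v) ∨
      angle x (H.normalAt v) = angle x (G.normalAt v) + angle (G.normalAt v) (H.normalAt v) := by
  by_cases hmem : H.normalAt v ∈ dualSide F G v
  · rcases h.eq_or_eq_of_normalAt_mem hH hmem with rfl | rfl
    · exact Or.inl (by rw [angle_self (inner_eq_zero_iff_ne h.norm_left), add_zero])
    · exact Or.inr (by rw [angle_self (inner_eq_zero_iff_ne h.norm_right), add_zero])
  · exact h.angle_eq_add_of_exit hx (Face.normalAt_mem_equator hH) hmem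

/-- An arc between two points of different sides passes through an end of either side. -/
lemma EdgeWith.exists_angle_eq_add {F G F' G' : P.Face} {v w w' : P.vertices}
    (h : EdgeWith F G v w) (h' : EdgeWith F' G' v w') (hne : w ≠ w') {x y : E3}
    (hx : x ∈ dualSide F G v) (hy : y ∈ dualSide F' G' v) :
    ∃ K L : P.Face, (K = F ∨ K = G) ∧ (L = F' ∨ L = G') ∧ angle x y = angle x (K.normalAt v) +
      angle (K.normalAt v) (L.normalAt v) + angle (L.normalAt v) y := by
  have key : ∃ K : P.Face, (K = F ∨ K = G) ∧
      angle x y = angle x (K.normalAt v) + angle (K.normalAt v) y := by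
    by_cases hmem : y ∈ dualSide F G v
    · obtain ⟨hy1, s, t, hs, ht, hst⟩ := h.mem_dualSide_iff.1 hmem
      rcases hs.eq_or_lt with rfl | hs
      · rw [zero_smul, zero_add] at hst
        have h1 : y = G.normalAt v := by
          have := congrArg norm hst
          rw [norm_smul, hy1, h.norm_right, mul_one, Real.norm_of_nonneg ht] at this
          rw [hst, ← this, one_smul]
        exact ⟨G, Or.inr rfl, by rw [h1, angle_self (inner_eq_zero_iff_ne h.norm_right), add_zero]⟩
      rcases ht.eq_or_lt with rfl | ht
      · rw [zero_smul, add_zero] at hst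
        have h1 : y = F.normalAt v := by
          have := congrArg norm hst
          rw [norm_smul, hy1, h.norm_left, mul_one, Real.norm_of_nonneg hs.le] at this
          rw [hst, ← this, one_smul]
        exact ⟨F, Or.inl rfl, by rw [h1, angle_self (inner_eq_zero_iff_ne h.norm_left), add_zero]⟩
      -- An inner point of the side belongs to no other side: its lift would lie in the normal cone
      -- of a third vertex `w'`.
      exfalso
      obtain ⟨-, s', t', hs', ht', hst'⟩ := h'.mem_dualSide_iff.1 hy
      have e1 := lift_combination h hs.le ht.le
      have e2 := lift_combination h' hs' ht'
      rw [← hst] at e1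
      rw [← hst', e1] at e2
      have h2 : s • F.conormal + t • G.conormal ∈ P.normalCone w' := by
        rw [e2]
        exact add_mem_normalCone
          (smul_mem_normalCone ((F'.conormal_mem_normalCone_iff w').2 h'.left_snd) hs')
          (smul_mem_normalCone ((G'.conormal_mem_normalCone_iff w').2 h'.right_snd) ht')
      rcases h.eq_or_eq_of_conormal_mem hs ht h2 with h3 | h3
      · exact h'.vertex_ne h3.symm
      · exact hne h3.symm
    · rcases h.angle_eq_add_of_exit hx (h'.dualSide_subset_equator hy) hmem with h1 | h1
      · exact ⟨F, Or.inl rfl, h1⟩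
      · exact ⟨G, Or.inr rfl, h1⟩
  obtain ⟨K, hK, h1⟩ := key
  have hKv : K.Contains v := by
    rcases hK with rfl | rfl
    · exact h.left_fst
    · exact h.right_fst
  rcases h'.angle_normalAt_eq_add hy hKv with h2 | h2
  · refine ⟨K, F', hK, Or.inl rfl, ?_⟩
    rw [h1, angle_comm _ y, h2, angle_comm y, angle_comm (F'.normalAt v) (K.normalAt v)]
    ring
  · refine ⟨K, G', hK, Or.inr rfl, ?_⟩
    rw [h1, angle_comm _ y, h2, angle_comm y, angle_comm (G'.normalAt v) (K.normalAt v)]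
    ring

/-! ### A normal form for chains -/

/-- The point `p` can be joined to the point `s` by a path of length at most `r` that consists of an
arc in the polygon of `p`, an arc in the polygon of `s`, and edges in between. -/
def Reach (s : P.DualPieces) (w : P.vertices) (p : E3) (r : ℝ) : Prop :=
  (w = s.vertex ∧ angle p s.point ≤ r) ∨
  (∃ F G z z', Matched F G w s.vertex z z' ∧ angle p z + angle z' s.point ≤ r) ∨
  ∃ F G : P.Face, F.Contains w ∧ G.Contains s.vertex ∧ ∃ C, JoinsBy C F G ∧
    angle p (F.normalAt w) + ∑ e ∈ C, weight e + angle (G.normalAt s.vertex) s.point ≤ r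

lemma Reach.add_angle {s : P.DualPieces} {w : P.vertices} {q : E3} {r : ℝ} (h : Reach s w q r)
    (p : E3) : Reach s w p (angle p q + r) := by
  have tri : ∀ z, angle p z ≤ angle p q + angle q z := angle_le_angle_add_angle p q
  rcases h with ⟨h1, h2⟩ | ⟨F, G, z, z', h1, h2⟩ | ⟨F, G, h1, h2, C, h3, h4⟩
  · exact Or.inl ⟨h1, by linarith [tri s.point]⟩
  · exact Or.inr (Or.inl ⟨F, G, z, z', h1, by linarith [tri z]⟩)
  · exact Or.inr (Or.inr ⟨F, G, h1, h2, C, h3, by linarith [tri (F.normalAt w)]⟩)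

/-- Prolonging a chain of edges by an arc of the boundary of the polygon dual to `v`. -/
lemma JoinsBy.exists_prepend {C : Finset (Sym2 P.vertices)} {F G H : P.Face} {v : P.vertices}
    (hH : H.Contains v) (hF : F.Contains v) (h : JoinsBy C F G) : ∃ D, JoinsBy D H G ∧
      ∑ e ∈ D, weight e ≤ angle (H.normalAt v) (F.normalAt v) + ∑ e ∈ C, weight e := by
  classical
  obtain ⟨D, hD, hsum, -⟩ := exists_joinsBy hH hF
  exact ⟨_, hD.trans h, by rw [← hsum]; exact sum_weight_symmDiff_le hD.1 h.1⟩

/-- The three forms of `Reach` are stable under prepending a gluing. A return across the same edge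
is undone, since the gluing is isometric. In the other nontrivial cases the arc in the polygon of
`u` can be routed through an end of the glued side, which is the normal of a face; the rest of that
arc is pushed to the boundary and added to the chain of edges. -/
lemma Reach.of_matched {s : P.DualPieces} {F G : P.Face} {w u : P.vertices} {p q : E3} {r : ℝ}
    (hm : Matched F G w u p q) (h : Reach s u q r) : Reach s w p r := by
  have hpne : p ≠ 0 :=
    inner_eq_zero_iff_ne (hm.edge.dualSide_subset_equator hm.left_mem).1
  have hcontains : ∀ {K : P.Face}, K = F ∨ K = G → K.Contains w ∧ K.Contains u ∧
      angle p (K.normalAt w) = angle q (K.normalAt u) := by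
    rintro K (rfl | rfl)
    · exact ⟨hm.edge.left_fst, hm.edge.left_snd, by rw [angle_comm, hm.angle_eq, angle_comm]⟩
    · exact ⟨hm.edge.right_fst, hm.edge.right_snd, by rw [angle_comm, hm.angle_eq_snd, angle_comm]⟩
  rcases h with ⟨rfl, h2⟩ | ⟨F', G', z, z', h1, h2⟩ | ⟨F', G', h1, h2, C, h3, h4⟩
  · exact Or.inr (Or.inl ⟨F, G, p, q, hm, by rw [angle_self hpne, zero_add]; exact h2⟩)
  · by_cases hw : w = s.vertex
    · refine Or.inl ⟨hw, ?_⟩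
      subst hw
      have hm' : Matched F G s.vertex u z' z := by
        rcases hm.edge.face_eq_or_eq h1.edge.left_snd h1.edge.left_fst with hF | hF
        · have hG := (hm.edge.face_eq_or_eq h1.edge.right_snd h1.edge.right_fst).resolve_left
            (hF ▸ h1.edge.face_ne.symm)
          subst hF hG
          exact h1.swap_vertices
        · have hG := (hm.edge.face_eq_or_eq h1.edge.right_snd h1.edge.right_fst).resolve_right
            (hF ▸ h1.edge.face_ne.symm)
          subst hF hG
          exact h1.swap_vertices.swap_faces
      have := hm.angle_congr hm'
      linarith [angle_le_angle_add_angle p z' s.point]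
    · obtain ⟨K, L, hK, hL, hang⟩ := hm.edge.swap_vertices.exists_angle_eq_add h1.edge hw
        hm.right_mem h1.left_mem
      obtain ⟨hKw, hKu, hKp⟩ := hcontains hK
      have hLc : L.Contains u ∧ L.Contains s.vertex ∧
          angle (L.normalAt u) z = angle (L.normalAt s.vertex) z' := by
        rcases hL with rfl | rfl
        · exact ⟨h1.edge.left_fst, h1.edge.left_snd, h1.angle_eq⟩
        · exact ⟨h1.edge.right_fst, h1.edge.right_snd, h1.angle_eq_snd⟩
      obtain ⟨D, hD, hDsum⟩ := (joinsBy_empty L).exists_prepend hKu hLc.1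
      rw [Finset.sum_empty, add_zero] at hDsum
      refine Or.inr (Or.inr ⟨K, L, hKw, hLc.2.1, D, hD, ?_⟩)
      linarith [angle_le_angle_add_angle (L.normalAt s.vertex) z' s.point, hLc.2.2]
  · have key : ∃ K : P.Face, (K = F ∨ K = G) ∧ angle q (F'.normalAt u) =
        angle q (K.normalAt u) + angle (K.normalAt u) (F'.normalAt u) := by
      rcases hm.edge.swap_vertices.angle_normalAt_eq_add hm.right_mem h1 with h5 | h5
      · exact ⟨F, Or.inl rfl, h5⟩
      · exact ⟨G, Or.inr rfl, h5⟩
    obtain ⟨K, hK, hang⟩ := key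
    obtain ⟨hKw, hKu, hKp⟩ := hcontains hK
    obtain ⟨D, hD, hDsum⟩ := h3.exists_prepend hKu h1
    exact Or.inr (Or.inr ⟨K, G', hKw, h2, D, hD, by linarith⟩)

/-- For two points of one polygon the middle form does not occur, because a gluing joins different
vertices. In the third form the chain of edges is at least as long as the angle between its ends, by
`JoinsBy.angle_le`. -/
lemma Reach.angle_le {s : P.DualPieces} {p : E3} {r : ℝ} (h : Reach s s.vertex p r) :
    angle p s.point ≤ r := by
  rcases h with ⟨-, h⟩ | ⟨F, G, z, z', h, -⟩ | ⟨F, G, h1, h2, C, h3, h4⟩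
  · exact h
  · exact absurd rfl h.edge.vertex_ne
  · have h5 := h3.angle_le h1 h2
    linarith [angle_le_angle_add_angle p (F.normalAt s.vertex) s.point,
      angle_le_angle_add_angle (F.normalAt s.vertex) (G.normalAt s.vertex) s.point]

lemma HasChain.reach {p s : P.DualPieces} {r : ℝ≥0∞} (h : HasChain p s r) (hs : s.point ≠ 0)
    (hr : r ≠ ⊤) : Reach s p.vertex p.point r.toReal := by
  induction h with
  | refl p => exact Or.inl ⟨rfl, by rw [angle_self hs, ENNReal.toReal_zero]⟩
  | @step p q s r h ih =>
    obtain ⟨h1, h2⟩ := ENNReal.add_ne_top.1 hr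
    have ih := ih hs h2
    rw [ENNReal.toReal_add h1 h2]
    unfold stepCost at h1 ⊢
    split_ifs at h1 ⊢ with hg hv
    · obtain ⟨F, G, hm⟩ := glued_iff.1 hg
      rw [ENNReal.toReal_zero, zero_add]
      exact ih.of_matched hm
    · rw [ENNReal.toReal_ofReal (angle_nonneg _ _), hv]
      exact ih.add_angle _
    · exact absurd rfl h1

lemma DualPieces.point_ne_zero (p : P.DualPieces) : p.point ≠ 0 := inner_eq_zero_iff_ne p.mem.1

lemma HasChain.angle_le {p s : P.DualPieces} {r : ℝ≥0∞} (h : HasChain p s r)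
    (hv : p.vertex = s.vertex) : ENNReal.ofReal (angle p.point s.point) ≤ r := by
  by_cases hr : r = ⊤
  · rw [hr]; exact le_top
  · refine ENNReal.ofReal_le_of_le_toReal ?_
    have := h.reach s.point_ne_zero hr
    rw [hv] at this
    exact this.angle_le

/-- The quotient metric restricts to the spherical metric on every polygon. -/
lemma edist_eq_angle {p q : P.DualPieces} (hv : p.vertex = q.vertex) :
    edist p q = ENNReal.ofReal (angle p.point q.point) := by
  apply le_antisymm
  · refine sInf_le ?_
    have h := HasChain.step p (HasChain.refl q)
    rw [add_zero, stepCost, if_neg (fun h => h.1 hv), if_pos hv] at h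
    exact h
  · exact le_sInf fun r h => HasChain.angle_le h hv

lemma edist_eq_zero_of_glued {p q : P.DualPieces} (h : Glued p q) : edist p q = 0 := by
  refine le_antisymm (sInf_le ?_) bot_le
  have h' := HasChain.step p (HasChain.refl q)
  rw [add_zero, stepCost, if_pos h] at h'
  exact h'

end IdealPolyhedron

namespace IdealPolyhedron
variable {P : IdealPolyhedron}

/-! ### Links of ideal vertices -/

/-- The convex hull of the vertices lies in a circular cone at each vertex. -/
lemma exists_cone_bound (v : P.vertices) : ∃ K : ℝ, 0 ≤ K ∧
    ∀ x ∈ convexHull ℝ (P.vertices : Set E3), ‖x - v‖ ≤ K * (1 - ⟪(v : E3), x⟫) := by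
  have hbdd : ∃ K : ℝ, 0 ≤ K ∧ ∀ w : P.vertices,
      ‖(w : E3) - v‖ / (1 - ⟪(v : E3), (w : E3)⟫) ≤ K := by
    obtain ⟨w, hw⟩ := Finite.exists_max
      (fun w : P.vertices => ‖(w : E3) - v‖ / (1 - ⟪(v : E3), (w : E3)⟫))
    refine ⟨_, ?_, hw⟩
    refine le_trans (le_of_eq ?_) (hw v)
    rw [sub_self, norm_zero, zero_div]
  obtain ⟨K, hK0, hK⟩ := hbdd
  refine ⟨K, hK0, fun x hx => ?_⟩
  have hconv : Convex ℝ {x : E3 | ‖x - v‖ ≤ K * (1 - ⟪(v : E3), x⟫)} := by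
    intro x hx y hy a b ha hb hab
    simp only [mem_ofPred_eq] at hx hy ⊢
    have h1 : a • x + b • y - v = a • (x - v) + b • (y - v) := by
      rw [show b = 1 - a by linarith]; module
    rw [h1, inner_add_right, real_inner_smul_right, real_inner_smul_right]
    have h2 := norm_add_le (a • (x - (v : E3))) (b • (y - (v : E3)))
    rw [norm_smul, norm_smul, Real.norm_of_nonneg ha, Real.norm_of_nonneg hb] at h2
    have h3 := mul_le_mul_of_nonneg_left hx ha
    have h4 := mul_le_mul_of_nonneg_left hy hb
    have h5 : K * (1 - (a * ⟪(v : E3), x⟫ + b * ⟪(v : E3), y⟫)) =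
        a * (K * (1 - ⟪(v : E3), x⟫)) + b * (K * (1 - ⟪(v : E3), y⟫)) := by
      rw [show b = 1 - a by linarith]; ring
    linarith
  refine convexHull_min (fun w hw => ?_) hconv hx
  by_cases hwv : (⟨w, hw⟩ : P.vertices) = v
  · simp only [mem_ofPred_eq, ← hwv, sub_self, norm_zero, real_inner_self_eq_norm_sq,
      P.norm_vertices w hw]
    norm_num
  · exact (div_le_iff₀ (sub_pos.2 (inner_vertex_lt_one (Ne.symm hwv)))).1 (hK ⟨w, hw⟩)

/-- With `X = μ⁻¹ • y` in the projective model, `‖y - v‖ ^ 2 = 2 * μ * (1 - ⟪v, X⟫)`, while `‖X - v‖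
≤ K * (1 - ⟪v, X⟫)`. So `y - v` differs from a nonpositive multiple of `v` by a term quadratic in
`‖y - v‖`, and its unit direction tends to `-v`. -/
lemma exists_direction_bound (v : P.vertices) : ∃ K : ℝ, 0 ≤ K ∧ ∀ y ∈ P.ballModel,
    ‖‖y - (v : E3)‖⁻¹ • (y - (v : E3)) - -(v : E3)‖ ≤ K * ‖y - v‖ := by
  obtain ⟨K, hK0, hK⟩ := exists_cone_bound v
  refine ⟨K, hK0, fun y hy => ?_⟩
  obtain ⟨hy1, hy2⟩ := hy
  set d := ‖y - (v : E3)‖ with hd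
  set μ := (1 + ‖y‖ ^ 2) / 2 with hμ
  have hv1 := norm_vertex v
  have hd0 : 0 < d := by
    rw [hd, norm_pos_iff, sub_ne_zero]
    rintro rfl
    exact absurd hv1 hy1.ne
  have hμ0 : 0 < μ := by positivity
  have hμ1 : μ < 1 := by
    have := pow_lt_one₀ (norm_nonneg y) hy1 two_ne_zero
    rw [hμ]; linarith
  have hX : (2 / (1 + ‖y‖ ^ 2)) = μ⁻¹ := by rw [hμ, inv_div]
  rw [hX] at hy2
  have h1 := hK _ hy2
  have hd2 : d ^ 2 = 2 * μ - 2 * ⟪(v : E3), y⟫ := by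
    rw [hd, norm_sub_sq_real, hv1, real_inner_comm, hμ]; ring
  have h2 : ‖(y - (v : E3)) + (1 - μ) • (v : E3)‖ ≤ K * (d ^ 2 / 2) := by
    have e1 : (y - (v : E3)) + (1 - μ) • (v : E3) = μ • (μ⁻¹ • y - (v : E3)) := by
      rw [smul_sub, smul_smul, mul_inv_cancel₀ hμ0.ne']; module
    rw [e1, norm_smul, Real.norm_of_nonneg hμ0.le]
    calc μ * ‖μ⁻¹ • y - (v : E3)‖ ≤ μ * (K * (1 - ⟪(v : E3), μ⁻¹ • y⟫)) :=
          mul_le_mul_of_nonneg_left h1 hμ0.le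
      _ = K * (d ^ 2 / 2) := by
          rw [hd2, real_inner_smul_right]
          field_simp
  have h3 : ‖d⁻¹ • (y - (v : E3)) + ((1 - μ) / d) • (v : E3)‖ ≤ K * d / 2 := by
    have e1 : d⁻¹ • (y - (v : E3)) + ((1 - μ) / d) • (v : E3) =
        d⁻¹ • ((y - (v : E3)) + (1 - μ) • (v : E3)) := by
      rw [smul_add, smul_smul, div_eq_inv_mul]
    rw [e1, norm_smul, norm_inv, Real.norm_of_nonneg hd0.le, inv_mul_le_iff₀ hd0]
    linarith
  have h4 : |1 - (1 - μ) / d| ≤ K * d / 2 := by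
    have e1 : ‖d⁻¹ • (y - (v : E3))‖ = 1 := by
      rw [norm_smul, norm_inv, Real.norm_of_nonneg hd0.le, ← hd, inv_mul_cancel₀ hd0.ne']
    have e2 : ‖-(((1 - μ) / d) • (v : E3))‖ = (1 - μ) / d := by
      rw [norm_neg, norm_smul, hv1, mul_one, Real.norm_of_nonneg (div_nonneg (by linarith) hd0.le)]
    have := abs_norm_sub_norm_le (d⁻¹ • (y - (v : E3))) (-(((1 - μ) / d) • (v : E3)))
    rw [e1, e2, sub_neg_eq_add] at this
    exact this.trans h3
  have h5 : d⁻¹ • (y - (v : E3)) - -(v : E3) = (d⁻¹ • (y - (v : E3)) + ((1 - μ) / d) • (v : E3)) +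
      (1 - (1 - μ) / d) • (v : E3) := by module
  rw [h5]
  refine (norm_add_le _ _).trans ?_
  rw [norm_smul, hv1, mul_one, Real.norm_eq_abs]
  linarith

/-- The point `v` is approached along the geodesic to another vertex: `X` runs on the chord, and `y`
is its image in the ball model. Without this the link could be empty. -/
lemma mem_closure_ballModel (v : P.vertices) : (v : E3) ∈ closure P.ballModel := by
  obtain ⟨w, hw, -⟩ := exists_vertex_ne v v
  set X : ℝ → E3 := fun ε => (1 - ε) • (v : E3) + ε • (w : E3) with hX
  set y : ℝ → E3 := fun ε => (1 + √(1 - ‖X ε‖ ^ 2))⁻¹ • X ε with hy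
  have hpos : ∀ ε, 1 + √(1 - ‖X ε‖ ^ 2) ≠ 0 := fun ε => by
    have := Real.sqrt_nonneg (1 - ‖X ε‖ ^ 2)
    linarith
  have hcX : Continuous X := by fun_prop
  have hcy : Continuous y := by
    refine Continuous.smul (Continuous.inv₀ ?_ hpos) hcX
    fun_prop
  have h0 : y 0 = v := by simp [hy, hX, norm_vertex]
  have ht : Tendsto y (𝓝[>] 0) (𝓝 (v : E3)) := by
    have := hcy.tendsto 0
    rw [h0] at this
    exact this.mono_left nhdsWithin_le_nhds
  refine mem_closure_of_tendsto ht ?_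
  filter_upwards [Ioo_mem_nhdsGT (zero_lt_one (α := ℝ))] with ε hε
  have hc := inner_vertex_lt_one hw.symm
  have hn : ‖X ε‖ ^ 2 = 1 - 2 * ε * (1 - ε) * (1 - ⟪(v : E3), (w : E3)⟫) := by
    rw [hX]
    simp only
    rw [norm_add_sq_real, norm_smul, norm_smul, norm_vertex, norm_vertex, Real.norm_eq_abs,
      Real.norm_eq_abs, mul_one, mul_one, sq_abs, sq_abs, real_inner_smul_left,
      real_inner_smul_right]
    ring
  set s := √(1 - ‖X ε‖ ^ 2) with hs
  have hlt : 0 < 1 - ‖X ε‖ ^ 2 := by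
    rw [hn]
    have := mul_pos (mul_pos hε.1 (sub_pos.2 hε.2)) (sub_pos.2 hc)
    linarith
  have hs0 : 0 < s := Real.sqrt_pos.2 hlt
  have hs2 : s ^ 2 = 1 - ‖X ε‖ ^ 2 := Real.sq_sqrt hlt.le
  have hy2 : ‖y ε‖ ^ 2 = (1 - s) / (1 + s) := by
    change ‖(1 + s)⁻¹ • X ε‖ ^ 2 = _
    rw [norm_smul, norm_inv, Real.norm_of_nonneg (by linarith : (0 : ℝ) ≤ 1 + s), mul_pow,
      show ‖X ε‖ ^ 2 = (1 - s) * (1 + s) by linarith]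
    have : 1 + s ≠ 0 := by linarith
    field_simp
  refine ⟨?_, ?_⟩
  · rw [← sq_lt_one_iff₀ (norm_nonneg _), hy2, div_lt_one (by linarith)]
    linarith
  · have h1 : 2 / (1 + ‖y ε‖ ^ 2) = 1 + s := by
      rw [hy2]
      have : 1 + s ≠ 0 := by linarith
      field_simp
      ring
    rw [h1]
    change (1 + s) • (1 + s)⁻¹ • X ε ∈ _
    rw [smul_smul, mul_inv_cancel₀ (by linarith), one_smul]
    exact convex_convexHull ℝ _ (subset_convexHull ℝ _ v.2) (subset_convexHull ℝ _ w.2)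
      (by linarith [hε.2]) hε.1.le (by ring)

/-- The link of an ideal vertex is a single point, the direction of the geodesics that end in the
vertex. -/
lemma link_eq (v : P.vertices) : P.link v = {-(v : E3)} := by
  have hne : (𝓝[P.ballModel] (v : E3)).NeBot :=
    mem_closure_iff_nhdsWithin_neBot.1 (mem_closure_ballModel v)
  have ht : Tendsto (fun x => ‖x - (v : E3)‖⁻¹ • (x - (v : E3))) (𝓝[P.ballModel] (v : E3))
      (𝓝 (-(v : E3))) := by
    obtain ⟨K, -, hK⟩ := exists_direction_bound v
    rw [tendsto_iff_norm_sub_tendsto_zero]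
    refine squeeze_zero' (Eventually.of_forall fun _ => norm_nonneg _)
      (eventually_nhdsWithin_of_forall hK) ?_
    have h1 : Tendsto (fun y : E3 => K * ‖y - (v : E3)‖) (𝓝 (v : E3)) (𝓝 (K * ‖(v : E3) - v‖)) :=
      Continuous.tendsto (by fun_prop) _
    rw [sub_self, norm_zero, mul_zero] at h1
    exact h1.mono_left nhdsWithin_le_nhds
  ext u
  rw [mem_singleton_iff]
  constructor
  · intro h
    have h' : ClusterPt u (𝓝 (-(v : E3))) := ClusterPt.mono h ht
    exact eq_of_nhds_neBot h'
  · rintro rfl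
    exact ht.mapClusterPt

lemma vertexDual_eq (v : P.vertices) : P.vertexDual v = closedHemisphere (v : E3) := by
  ext u
  simp only [vertexDual, closedHemisphere, link_eq, mem_ofPred_eq, mem_singleton_iff, forall_eq,
    inner_neg_right, neg_nonpos]
  rw [real_inner_comm]

lemma EdgeWith.dualSide_subset {F G : P.Face} {v w : P.vertices} (h : EdgeWith F G v w) :
    dualSide F G v ⊆ P.vertexDual v := by
  intro x hx
  rw [vertexDual_eq]
  exact ⟨(h.dualSide_subset_equator hx).1, (h.dualSide_subset_equator hx).2.ge⟩

end IdealPolyhedron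

namespace IdealPolyhedron
variable {P : IdealPolyhedron}

/-! ### The Gaussian image is a sphere -/

section pieceMap

/-- The map of the polygon dual to `v` into the Gaussian image. -/
noncomputable def pieceMap (v : P.vertices) (y : E3) : P.GaussianImage :=
  open Classical in if h : y ∈ P.vertexDual v then SeparationQuotient.mk ⟨v, y, h⟩
  -- Outside the polygon the value is a default, the class of its centre.
  else SeparationQuotient.mk ⟨v, v, by
    rw [vertexDual_eq]; exact ⟨norm_vertex v, (inner_vertex_self v).symm ▸ zero_le_one⟩⟩

variable {v w : P.vertices} {y y' : E3} {F G : P.Face}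

lemma pieceMap_of_mem (h : y ∈ P.vertexDual v) :
    pieceMap v y = SeparationQuotient.mk (⟨v, y, h⟩ : P.DualPieces) := dif_pos h

lemma edist_pieceMap (hy : y ∈ closedHemisphere (v : E3)) (hy' : y' ∈ closedHemisphere (v : E3)) :
    edist (pieceMap v y) (pieceMap v y') = ENNReal.ofReal (angle y y') := by
  rw [← vertexDual_eq] at hy hy'
  rw [pieceMap_of_mem hy, pieceMap_of_mem hy']
  exact edist_eq_angle rfl

lemma exists_eq_pieceMap (q : P.GaussianImage) :
    ∃ v : P.vertices, ∃ y ∈ closedHemisphere (v : E3), q = pieceMap v y := by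
  obtain ⟨⟨v, y, h⟩, rfl⟩ := SeparationQuotient.surjective_mk q
  exact ⟨v, y, by rwa [vertexDual_eq] at h, (pieceMap_of_mem h).symm⟩

lemma continuousOn_pieceMap (v : P.vertices) : ContinuousOn (pieceMap v) (closedHemisphere (v : E3)) := by
  intro y hy
  rw [ContinuousWithinAt, EMetric.tendsto_nhds]
  intro ε hε
  have h1 : ContinuousAt (fun z => ENNReal.ofReal (angle z y)) y :=
    ENNReal.continuous_ofReal.continuousAt.comp
      (ContinuousAt.comp (f := fun z : E3 => (z, y))
        (continuousAt_angle (inner_eq_zero_iff_ne hy.1) (inner_eq_zero_iff_ne hy.1))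
        (by fun_prop))
  have h2 : ∀ᶠ z in 𝓝[closedHemisphere (v : E3)] y, ENNReal.ofReal (angle z y) < ε := by
    refine (h1.tendsto.mono_left nhdsWithin_le_nhds).eventually_lt_const ?_
    rwa [angle_self (inner_eq_zero_iff_ne hy.1), ENNReal.ofReal_zero]
  filter_upwards [h2, self_mem_nhdsWithin] with z hz hzm
  rwa [edist_pieceMap hzm hy]

/-- The normals of `F` and `G` have the same inner products at both endpoints, so equal coefficients
give corresponding points: the gluing is linear in these coordinates. -/
lemma EdgeWith.matched_combination (h : EdgeWith F G v w) {s t : ℝ} (hs : 0 ≤ s) (ht : 0 ≤ t)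
    (hn : ‖s • F.normalAt v + t • G.normalAt v‖ = 1) :
    Matched F G v w (s • F.normalAt v + t • G.normalAt v)
      (s • F.normalAt w + t • G.normalAt w) := by
  have hin : ⟪F.normalAt v, G.normalAt v⟫ = ⟪F.normalAt w, G.normalAt w⟫ := by
    rw [← cos_angle_of_norm_eq_one h.norm_left h.norm_right, h.angle_eq,
      ← h.swap_vertices.angle_eq,
      cos_angle_of_norm_eq_one h.swap_vertices.norm_left h.swap_vertices.norm_right]
  have hnw : ‖s • F.normalAt w + t • G.normalAt w‖ = 1 := by
    rw [← sq_eq_sq₀ (norm_nonneg _) zero_le_one, one_pow, ← one_pow 2, ← hn, norm_add_sq_real,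
      norm_add_sq_real]
    simp only [norm_smul, real_inner_smul_left, real_inner_smul_right, hin, h.norm_left,
      h.norm_right, h.swap_vertices.norm_left, h.swap_vertices.norm_right]
  refine ⟨h, h.mem_dualSide_iff.2 ⟨hn, s, t, hs, ht, rfl⟩,
    h.swap_vertices.mem_dualSide_iff.2 ⟨hnw, s, t, hs, ht, rfl⟩, ?_⟩
  rw [angle, angle, hn, hnw, h.norm_left, h.swap_vertices.norm_left, inner_add_right,
    inner_add_right, inner_smul_right, inner_smul_right, inner_smul_right, inner_smul_right, hin,
    real_inner_self_eq_norm_sq, real_inner_self_eq_norm_sq, h.norm_left, h.swap_vertices.norm_left]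

lemma Matched.pieceMap_eq {p q : E3} (h : Matched F G v w p q) : pieceMap v p = pieceMap w q := by
  rw [pieceMap_of_mem (h.edge.dualSide_subset h.left_mem),
    pieceMap_of_mem (h.edge.swap_vertices.dualSide_subset h.right_mem),
    SeparationQuotient.mk_eq_mk, EMetric.inseparable_iff]
  exact edist_eq_zero_of_glued (glued_iff.2 ⟨F, G, h⟩)

lemma EdgeWith.pieceMap_normalAt_eq (h : EdgeWith F G v w) :
    pieceMap v (F.normalAt v) = pieceMap w (F.normalAt w) := by
  have := (h.matched_combination (s := 1) (t := 0) zero_le_one le_rfl (by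
    rw [one_smul, zero_smul, add_zero, h.norm_left])).pieceMap_eq
  simpa using this

/-- The vertices of a face are connected by edges of the face; so the vertices of the dual polygons
that correspond to the face are all identified. -/
lemma Face.pieceMap_normalAt_eq (hv : F.Contains v) (hw : F.Contains w) :
    pieceMap v (F.normalAt v) = pieceMap w (F.normalAt w) := by
  let r : P.vertices → P.vertices → Prop := fun a b => ⟪(w : E3), (b : E3)⟫ < ⟪(w : E3), (a : E3)⟫
  have hwf : WellFounded r := by
    have : IsTrans _ r := ⟨fun _ _ _ h h' => lt_trans h' h⟩
    have : Std.Irrefl r := ⟨fun _ h => lt_irrefl _ h⟩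
    exact Finite.wellFounded_of_trans_of_irrefl r
  induction v using hwf.induction with
  | _ v ih =>
    by_cases hvw : v = w
    · rw [hvw]
    obtain ⟨G, x, H, y, hx, hy, hxy⟩ := Face.exists_two_edges hv
    -- As `w - v` is a nonnegative combination of the two edge directions at `v`, one of the two
    -- neighbours is closer to `w`, and the induction proceeds to it.
    obtain ⟨s, t, hs, ht, hst⟩ := hx.exists_corner_combination hy hxy hw
    have h1 := congrArg (fun z => ⟪(w : E3), z⟫) hst
    simp only [inner_sub_right, inner_add_right, real_inner_smul_right, inner_vertex_self] at h1
    have h2 := inner_vertex_lt_one (Ne.symm hvw)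
    by_cases hxw : ⟪(w : E3), (v : E3)⟫ < ⟪(w : E3), (x : E3)⟫
    · rw [hx.pieceMap_normalAt_eq, ih x hxw hx.left_snd]
    by_cases hyw : ⟪(w : E3), (v : E3)⟫ < ⟪(w : E3), (y : E3)⟫
    · rw [hy.pieceMap_normalAt_eq, ih y hyw hy.left_snd]
    exfalso
    nlinarith [mul_nonneg hs (sub_nonneg.2 (not_lt.1 hxw)),
      mul_nonneg ht (sub_nonneg.2 (not_lt.1 hyw))]

end pieceMap

section gaussMap

variable {v w : P.vertices} {y y' x : E3} {F G : P.Face}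

lemma DualPieces.mem_closedHemisphere (p : P.DualPieces) :
    p.point ∈ closedHemisphere (p.vertex : E3) := by
  have := p.mem
  rwa [vertexDual_eq] at this

lemma Matched.unitLift_eq {p q : E3} (h : Matched F G v w p q) : unitLift v p = unitLift w q := by
  have h1 := h.arcPoint_left
  have h2 := h.swap_vertices.arcPoint_left
  have hI := angle_mem_Icc_of_mem h.left_mem
  rw [h.edge.angle_eq] at hI
  rw [arcPoint, h.edge.angle_eq] at h1
  rw [arcPoint, h.edge.swap_vertices.angle_eq, ← h.angle_eq] at h2
  have hs := arcFst_nonneg h.edge.exterior_lt_pi hI.1 hI.2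
  have ht := arcSnd_nonneg h.edge.exterior_lt_pi hI.1 hI.2
  rw [unitLift, unitLift, ← h1, ← h2, h.edge.lift_combination hs ht,
    h.edge.swap_vertices.lift_combination hs ht]

lemma exists_lipschitz_unitLift : ∃ L : NNReal, 0 < L ∧ ∀ (v : P.vertices),
    ∀ y ∈ closedHemisphere (v : E3), ∀ y' ∈ closedHemisphere (v : E3),
      ‖unitLift v y - unitLift v y'‖ ≤ L * angle y y' := by
  choose L hL0 hL using exists_unitLift_lipschitz (P := P)
  obtain ⟨v₀, hv₀⟩ := Finite.exists_max L
  refine ⟨⟨L v₀ + 1, by linarith [hL0 v₀]⟩, NNReal.coe_pos.1 (by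
    change 0 < L v₀ + 1
    linarith [hL0 v₀]), fun v y hy y' hy' => (hL v y hy y' hy').trans ?_⟩
  exact mul_le_mul_of_nonneg_right ((hv₀ v).trans (by
    change L v₀ ≤ L v₀ + 1
    linarith)) (angle_nonneg _ _)

/-- A gluing step does not change the unit lift, and a step inside one polygon changes it by at most
a fixed multiple of its cost; this is summed along chains. -/
lemma exists_lipschitzWith_unitLift :
    ∃ L : NNReal, LipschitzWith L fun p : P.DualPieces => unitLift p.vertex p.point := by
  obtain ⟨L, hL0, hL⟩ := exists_lipschitz_unitLift (P := P)
  refine ⟨L, fun p q => ?_⟩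
  have key : ∀ {p q : P.DualPieces} {r : ℝ≥0∞}, HasChain p q r → r ≠ ⊤ →
      ‖unitLift p.vertex p.point - unitLift q.vertex q.point‖ ≤ L * r.toReal := by
    intro p q r h
    induction h with
    | refl p => intro _; simp
    | @step p q s r h ih =>
      intro hr
      obtain ⟨h1, h2⟩ := ENNReal.add_ne_top.1 hr
      rw [ENNReal.toReal_add h1 h2, mul_add]
      refine (norm_sub_le_norm_sub_add_norm_sub _ (unitLift q.vertex q.point) _).trans
        (add_le_add ?_ (ih h2))
      unfold stepCost at h1 ⊢
      split_ifs at h1 ⊢ with hg hv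
      · obtain ⟨F, G, hm⟩ := glued_iff.1 hg
        rw [hm.unitLift_eq, sub_self, norm_zero, ENNReal.toReal_zero, mul_zero]
      · rw [ENNReal.toReal_ofReal (angle_nonneg _ _)]
        have := p.mem_closedHemisphere
        rw [hv] at this ⊢
        exact hL _ _ this _ q.mem_closedHemisphere
      · exact absurd rfl h1
  change edist _ _ ≤ _ * sInf {r | HasChain p q r}
  rw [← ENNReal.div_le_iff' (ENNReal.coe_ne_zero.2 hL0.ne') ENNReal.coe_ne_top]
  refine le_sInf fun r hr => ?_
  by_cases hrt : r = ⊤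
  · rw [hrt]; exact le_top
  · rw [ENNReal.div_le_iff' (ENNReal.coe_ne_zero.2 hL0.ne') ENNReal.coe_ne_top, edist_dist,
      dist_eq_norm]
    refine (ENNReal.ofReal_le_ofReal (key hr hrt)).trans ?_
    rw [ENNReal.ofReal_mul L.coe_nonneg, ENNReal.ofReal_toReal hrt, ENNReal.ofReal_coe_nnreal]

variable (P) in
/-- The map of the Gaussian image to the unit sphere which maps every polygon `v^*` to the set of
normal vectors of the planes that support the polyhedron at `v`. -/
noncomputable def gaussMap : P.GaussianImage → E3 :=
  SeparationQuotient.lift (fun p => unitLift p.vertex p.point) fun p q h => by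
    obtain ⟨L, hL⟩ := exists_lipschitzWith_unitLift (P := P)
    have := hL p q
    rw [EMetric.inseparable_iff.1 h, mul_zero, nonpos_iff_eq_zero] at this
    exact edist_eq_zero.1 this

lemma continuous_gaussMap : Continuous P.gaussMap :=
  SeparationQuotient.continuous_lift exists_lipschitzWith_unitLift.choose_spec.continuous

lemma gaussMap_pieceMap (hy : y ∈ closedHemisphere (v : E3)) :
    P.gaussMap (pieceMap v y) = unitLift v y := by
  rw [pieceMap_of_mem (by rwa [vertexDual_eq])]
  rfl

lemma norm_gaussMap (q : P.GaussianImage) : ‖P.gaussMap q‖ = 1 := by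
  obtain ⟨v, y, hy, rfl⟩ := exists_eq_pieceMap q
  rw [gaussMap_pieceMap hy, norm_unitLift hy]

lemma unitLift_normalAt (hF : F.Contains v) : unitLift v (F.normalAt v) = F.normal :=
  unitLift_eq_of_lift_eq (inv_pos.2 F.sqrt_pos) F.norm_normal (lift_normalAt hF)

lemma Face.normalAt_mem (hF : F.Contains v) : F.normalAt v ∈ closedHemisphere (v : E3) :=
  ⟨(Face.normalAt_mem_equator hF).1, (Face.normalAt_mem_equator hF).2.ge⟩

/-- The points of the side dual to an edge correspond to the normal vectors of planes supporting the
polyhedron along the edge. -/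
lemma EdgeWith.exists_eq_combination (h : EdgeWith F G v w) (hy : y ∈ closedHemisphere (v : E3))
    (hmem : unitLift v y ∈ P.normalCone w) : ∃ s t : ℝ, 0 ≤ s ∧ 0 ≤ t ∧
      y = s • F.normalAt v + t • G.normalAt v ∧
      unitLift v y = ‖lift v y‖⁻¹ • (s • F.conormal + t • G.conormal) := by
  obtain ⟨s, t, hs, ht, hst⟩ := h.exists_conormal_combination (unitLift_mem hy) hmem
  have h1 := h.lift_combination hs ht
  rw [← hst] at h1
  set Y := s • F.normalAt v + t • G.normalAt v with hY
  have hu : unitLift v y ≠ 0 := inner_eq_zero_iff_ne (norm_unitLift hy)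
  have hY0 : Y ≠ 0 := by
    rintro h0
    rw [h0] at h1
    have := lift_smul (P := P) (le_refl (0 : ℝ)) v 0
    rw [smul_zero, zero_smul, h1] at this
    exact hu this
  have hYpos : 0 < ‖Y‖ := norm_pos_iff.2 hY0
  have hmemY : ‖Y‖⁻¹ • Y ∈ closedHemisphere (v : E3) := by
    refine ⟨by rw [norm_smul, norm_inv, norm_norm, inv_mul_cancel₀ hYpos.ne'], le_of_eq ?_⟩
    rw [inner_smul_right, hY, inner_add_right, inner_smul_right, inner_smul_right,
      (Face.normalAt_mem_equator h.left_fst).2, (Face.normalAt_mem_equator h.right_fst).2]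
    ring
  have hyY : y = ‖Y‖⁻¹ • Y := by
    refine unitLift_injOn v hy hmemY (unitLift_eq_of_lift_eq (inv_pos.2 hYpos)
      (norm_unitLift hy) ?_).symm
    rw [lift_smul (inv_pos.2 hYpos).le, h1]
  have hs' : 0 ≤ ‖Y‖⁻¹ * s := mul_nonneg (inv_pos.2 hYpos).le hs
  have ht' : 0 ≤ ‖Y‖⁻¹ * t := mul_nonneg (inv_pos.2 hYpos).le ht
  have hfin : y = (‖Y‖⁻¹ * s) • F.normalAt v + (‖Y‖⁻¹ * t) • G.normalAt v := by
    rw [hyY, hY]; module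
  refine ⟨_, _, hs', ht', hfin, ?_⟩
  rw [unitLift]
  nth_rewrite 2 [hfin]
  rw [h.lift_combination hs' ht']

lemma EdgeWith.pieceMap_eq (h : EdgeWith F G v w) (hy : y ∈ closedHemisphere (v : E3))
    (hmem : unitLift v y ∈ P.normalCone w) : y ∈ dualSide F G v ∧
      ∃ y' ∈ dualSide F G w, pieceMap v y = pieceMap w y' := by
  obtain ⟨s, t, hs, ht, rfl, -⟩ := h.exists_eq_combination hy hmem
  have hm := h.matched_combination hs ht hy.1
  exact ⟨hm.left_mem, _, hm.right_mem, hm.pieceMap_eq⟩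

/-- A point of `v^*` whose normal vector supports the polyhedron at `w` too lies in `w^*`. -/
lemma exists_pieceMap_eq (hy : y ∈ closedHemisphere (v : E3))
    (hmem : unitLift v y ∈ P.normalCone w) :
    ∃ y' ∈ closedHemisphere (w : E3), pieceMap v y = pieceMap w y' := by
  by_cases hvw : v = w
  · subst hvw
    exact ⟨y, hy, rfl⟩
  rcases edge_or_face_of_mem (inner_eq_zero_iff_ne (norm_unitLift hy)) hvw (unitLift_mem hy) hmem
    with ⟨F, G, h, -⟩ | ⟨F, hFv, hFw, s, hs, hst⟩
  · obtain ⟨-, y', hy', he⟩ := h.pieceMap_eq hy hmem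
    refine ⟨y', ?_, he⟩
    rw [← vertexDual_eq]
    exact h.swap_vertices.dualSide_subset hy'
  · have h1 : y = F.normalAt v := by
      refine unitLift_injOn v hy (Face.normalAt_mem hFv) ?_
      refine (unitLift_eq_of_lift_eq (c := s⁻¹) (inv_pos.2 hs) (norm_unitLift hy) ?_).symm
      rw [lift_normalAt hFv, hst, smul_smul, inv_mul_cancel₀ hs.ne', one_smul]
    exact ⟨F.normalAt w, Face.normalAt_mem hFw, by rw [h1]; exact Face.pieceMap_normalAt_eq hFv hFw⟩

/-- A common value supports the polyhedron at `v` and at `w`, so the point of `v^*` is also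
represented in `w^*`, where the unit lift is injective. -/
lemma injective_gaussMap : Function.Injective P.gaussMap := by
  intro q q' h
  obtain ⟨v, y, hy, rfl⟩ := exists_eq_pieceMap q
  obtain ⟨w, y', hy', rfl⟩ := exists_eq_pieceMap q'
  rw [gaussMap_pieceMap hy, gaussMap_pieceMap hy'] at h
  obtain ⟨z, hz, he⟩ := exists_pieceMap_eq hy (h ▸ unitLift_mem hy')
  have h1 := congrArg P.gaussMap he
  rw [gaussMap_pieceMap hy, gaussMap_pieceMap hz, h] at h1
  rw [he, unitLift_injOn w hy' hz h1]

lemma exists_gaussMap_eq (hx : ‖x‖ = 1) : ∃ q, P.gaussMap q = x := by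
  obtain ⟨v, hv⟩ := exists_mem_normalCone (P := P) x
  obtain ⟨y, hy, h⟩ := exists_unitLift_eq hx hv
  exact ⟨pieceMap v y, by rw [gaussMap_pieceMap hy, h]⟩

instance : CompactSpace P.GaussianImage := by
  refine ⟨?_⟩
  have : (univ : Set P.GaussianImage) = ⋃ v : P.vertices, pieceMap v '' closedHemisphere (v : E3) := by
    symm
    rw [eq_univ_iff_forall]
    intro q
    obtain ⟨v, y, hy, rfl⟩ := exists_eq_pieceMap q
    exact mem_iUnion.2 ⟨v, mem_image_of_mem _ hy⟩
  rw [this]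
  exact isCompact_iUnion fun v =>
    (isCompact_closedHemisphere _).image_of_continuousOn (continuousOn_pieceMap v)

lemma bijective_gaussMap : Function.Bijective fun q : P.GaussianImage =>
    (⟨P.gaussMap q, mem_sphere_zero_iff_norm.2 (norm_gaussMap q)⟩ : Metric.sphere (0 : E3) 1) :=
  ⟨fun _ _ h => injective_gaussMap (congrArg Subtype.val h), fun x => by
    obtain ⟨q, hq⟩ := exists_gaussMap_eq (P := P) (mem_sphere_zero_iff_norm.1 x.2)
    exact ⟨q, Subtype.ext hq⟩⟩

variable (P) in
/-- The Gaussian image is homeomorphic to the sphere. -/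
noncomputable def gaussHomeo : P.GaussianImage ≃ₜ Metric.sphere (0 : E3) 1 :=
  Continuous.homeoOfEquivCompactToT2
    (f := Equiv.ofBijective _ bijective_gaussMap) (continuous_gaussMap.subtype_mk _)

/-- All distances in the Gaussian image are finite. -/
lemma edist_ne_top (q q' : P.GaussianImage) : edist q q' ≠ ⊤ := by
  have hconn : IsPreconnected (univ : Set P.GaussianImage) := by
    have h1 : IsPreconnected (univ : Set (Metric.sphere (0 : E3) 1)) := by
      have : PreconnectedSpace (Metric.sphere (0 : E3) 1) :=
        isPreconnected_iff_preconnectedSpace.1 (isPreconnected_sphere (by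
          rw [← Module.finrank_eq_rank, finrank_E3]; norm_num) _ _)
      exact isPreconnected_univ
    rw [← P.gaussHomeo.symm.range_coe, ← image_univ]
    exact h1.image _ P.gaussHomeo.symm.continuous.continuousOn
  -- Points at finite distance from `q` form an open and closed set, and the Gaussian image is
  -- connected because it is homeomorphic to the sphere.
  have hclopen : IsClopen (Metric.eball q ⊤) := ⟨Metric.isClosed_eball_top, Metric.isOpen_eball⟩
  have : PreconnectedSpace P.GaussianImage := ⟨hconn⟩
  have huniv := hclopen.eq_univ ⟨q, Metric.mem_eball_self ENNReal.zero_lt_top⟩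
  have hq' : q' ∈ Metric.eball q ⊤ := huniv ▸ mem_univ q'
  rw [edist_comm]
  exact (Metric.mem_eball.1 hq').ne

/-! ### The cells -/

lemma gaussVertex_eq (v : P.vertices) :
    P.gaussVertex v = pieceMap v '' closedHemisphere (v : E3) := by
  ext q
  constructor
  · rintro ⟨p, rfl, rfl⟩
    exact ⟨p.point, p.mem_closedHemisphere, pieceMap_of_mem p.mem⟩
  · rintro ⟨y, hy, rfl⟩
    rw [← vertexDual_eq] at hy
    exact ⟨⟨v, y, hy⟩, rfl, pieceMap_of_mem hy⟩

/-- The 2-cells are the preimages of the normal cones; edges and faces are treated in the same way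
below. The cell structure can then be read off from the normal fan. -/
lemma mem_gaussVertex {q : P.GaussianImage} :
    q ∈ P.gaussVertex v ↔ P.gaussMap q ∈ P.normalCone v := by
  rw [gaussVertex_eq]
  constructor
  · rintro ⟨y, hy, rfl⟩
    rw [gaussMap_pieceMap hy]
    exact unitLift_mem hy
  · intro h
    obtain ⟨y, hy, he⟩ := exists_unitLift_eq (norm_gaussMap q) h
    exact ⟨y, hy, injective_gaussMap (by rw [gaussMap_pieceMap hy, he])⟩

lemma EdgeWith.gaussEdge_eq (h : EdgeWith F G v w) :
    gaussEdge F G = pieceMap v '' dualSide F G v := by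
  ext q
  constructor
  · rintro ⟨⟨z, y, hy⟩, hz, hyF, rfl⟩
    simp only at hz hyF
    rcases h.eq_or_eq_of_contains hz.2.1 hz.2.2.1 with rfl | rfl
    · exact ⟨y, hyF, pieceMap_of_mem hy⟩
    · have hy' : y ∈ closedHemisphere (z : E3) := by rwa [vertexDual_eq] at hy
      obtain ⟨-, s, t, hs, ht, hst⟩ := h.swap_vertices.mem_dualSide_iff.1 hyF
      have hm := h.swap_vertices.matched_combination hs ht (hst ▸ hy'.1)
      rw [← hst] at hm
      exact ⟨_, hm.right_mem, by rw [← hm.pieceMap_eq, pieceMap_of_mem hy]⟩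
  · rintro ⟨y, hy, rfl⟩
    exact ⟨⟨v, y, h.dualSide_subset hy⟩, h.isEdgeAt, hy, pieceMap_of_mem (h.dualSide_subset hy)⟩

lemma EdgeWith.mem_gaussEdge (h : EdgeWith F G v w) {q : P.GaussianImage} :
    q ∈ gaussEdge F G ↔ P.gaussMap q ∈ P.normalCone v ∧ P.gaussMap q ∈ P.normalCone w := by
  rw [h.gaussEdge_eq]
  constructor
  · rintro ⟨y, hy, rfl⟩
    have hy' := h.dualSide_subset hy
    rw [vertexDual_eq] at hy'
    rw [gaussMap_pieceMap hy']
    refine ⟨unitLift_mem hy', ?_⟩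
    rw [unitLift_mem_iff hy']
    obtain ⟨-, s, t, hs, ht, rfl⟩ := h.mem_dualSide_iff.1 hy
    rw [h.lift_combination hs ht]
    exact h.swap_vertices.conormal_combination_mem hs ht
  · rintro ⟨hv, hw⟩
    obtain ⟨y, hy, he⟩ := exists_unitLift_eq (norm_gaussMap q) hv
    have hq : q = pieceMap v y := injective_gaussMap (by rw [gaussMap_pieceMap hy, he])
    refine ⟨y, (h.pieceMap_eq hy (he ▸ hw)).1, hq.symm⟩

lemma gaussFace_eq (hF : F.Contains v) : gaussFace F = {pieceMap v (F.normalAt v)} := by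
  ext q
  rw [mem_singleton_iff]
  constructor
  · rintro ⟨⟨z, y, hy⟩, hz, hyF, rfl⟩
    simp only at hz hyF
    subst hyF
    rw [← pieceMap_of_mem hy, Face.pieceMap_normalAt_eq hz hF]
  · rintro rfl
    have hmem : F.normalAt v ∈ P.vertexDual v := by rw [vertexDual_eq]; exact Face.normalAt_mem hF
    exact ⟨⟨v, _, hmem⟩, hF, rfl, pieceMap_of_mem hmem⟩

lemma mem_gaussFace {q : P.GaussianImage} : q ∈ gaussFace F ↔ P.gaussMap q = F.normal := by
  obtain ⟨v, hv, -⟩ := F.exists_contains_ne (Classical.arbitrary _) (Classical.arbitrary _)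
  have h1 : P.gaussMap (pieceMap v (F.normalAt v)) = F.normal := by
    rw [gaussMap_pieceMap (Face.normalAt_mem hv), unitLift_normalAt hv]
  rw [gaussFace_eq hv, mem_singleton_iff, ← h1, injective_gaussMap.eq_iff]

end gaussMap

end IdealPolyhedron

/-! ### Finite CW complexes whose closed cells are embedded -/

/-- The set `c` is an embedded closed `n`-ball with boundary sphere `b`. -/
def IsEmbeddedBall {Q : Type*} [TopologicalSpace Q] (n : ℕ) (c b : Set Q) : Prop :=
  ∃ f : (Fin n → ℝ) → Q, ContinuousOn f (Metric.closedBall 0 1) ∧ InjOn f (Metric.closedBall 0 1) ∧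
    f '' Metric.closedBall 0 1 = c ∧ f '' Metric.sphere 0 1 = b

/-- By compactness of the closed ball, the map is an embedding, so its inverse is continuous. -/
lemma continuousOn_invFunOn_ball {Q : Type*} [TopologicalSpace Q] [T2Space Q] {n : ℕ}
    {f : (Fin n → ℝ) → Q} (hf : ContinuousOn f (Metric.closedBall 0 1))
    (hinj : InjOn f (Metric.closedBall 0 1)) :
    ContinuousOn (Function.invFunOn f (Metric.ball 0 1)) (f '' Metric.ball 0 1) := by
  have hemb : IsEmbedding ((Metric.closedBall (0 : Fin n → ℝ) 1).domRestrict f) := by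
    have : CompactSpace (Metric.closedBall (0 : Fin n → ℝ) 1) :=
      isCompact_iff_compactSpace.1 (isCompact_closedBall _ _)
    exact (hf.domRestrict.isClosedEmbedding (injOn_iff_injective.1 hinj)).isEmbedding
  have hind : IsInducing ((Metric.ball (0 : Fin n → ℝ) 1).domRestrict f) :=
    (hemb.comp (IsEmbedding.inclusion Metric.ball_subset_closedBall)).isInducing
  rw [continuousOn_iff_continuous_domRestrict]
  set inv : f '' Metric.ball 0 1 → Metric.ball (0 : Fin n → ℝ) 1 := fun y =>
    ⟨Function.invFunOn f (Metric.ball 0 1) y, Function.invFunOn_mem y.2⟩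
  have h1 : Continuous inv := by
    rw [hind.continuous_iff]
    have : (Metric.ball (0 : Fin n → ℝ) 1).domRestrict f ∘ inv = Subtype.val := by
      ext y
      exact Function.invFunOn_eq y.2
    rw [this]
    exact continuous_subtype_val
  exact continuous_subtype_val.comp h1

-- Finitely many embedded balls with disjoint interiors, and boundaries in cells of lower dimension,
-- make a CW complex; finiteness disposes of the conditions on the topology.
open Topology.CWComplex in
lemma exists_cwComplex {Q : Type} [TopologicalSpace Q] [T2Space Q] {ι : ℕ → Type}
    (hfin : ∀ n, Finite (ι n)) (hev : ∀ᶠ n in atTop, IsEmpty (ι n)) {c b : ∀ n, ι n → Set Q}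
    (hc : ∀ n i, IsEmbeddedBall n (c n i) (b n i))
    (hdis : ∀ p q : Σ n, ι n, p ≠ q →
      Disjoint (c p.1 p.2 \ b p.1 p.2) (c q.1 q.2 \ b q.1 q.2))
    (hfr : ∀ n i, b n i ⊆ ⋃ (m < n) (j : ι m), c m j) (hun : ∀ q, ∃ n i, q ∈ c n i) :
    ∃ (_ : CWComplex (univ : Set Q)) (e : ∀ n, cell (univ : Set Q) n ≃ ι n),
      ∀ n i, closedCell n i = c n (e n i) ∧ cellFrontier n i = b n (e n i) := by
  choose f hcont hinj hcl hsph using hc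
  have hball : ∀ n i, f n i '' Metric.ball 0 1 = c n i \ b n i := by
    intro n i
    have h1 := (hinj n i).image_sdiff (t := Metric.sphere 0 1)
    rw [inter_eq_right.2 Metric.sphere_subset_closedBall, hcl, hsph,
      Metric.closedBall_sdiff_sphere] at h1
    exact h1
  let map : ∀ n, ι n → PartialEquiv (Fin n → ℝ) Q := fun n i =>
    InjOn.toPartialEquiv (f n i) (Metric.ball 0 1)
      ((hinj n i).mono Metric.ball_subset_closedBall)
  let C : CWComplex (univ : Set Q) := CWComplex.mkFinite univ ι map hev hfin
    (fun n i => rfl) hcont (fun n i => continuousOn_invFunOn_ball (hcont n i) (hinj n i))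
    (fun p _ q _ hpq => by
      change Disjoint (f p.1 p.2 '' Metric.ball 0 1) (f q.1 q.2 '' Metric.ball 0 1)
      rw [hball, hball]
      exact hdis p q hpq)
    (fun n i => by
      rw [mapsTo_iff_image_subset]
      change f n i '' Metric.sphere 0 1 ⊆ ⋃ (m < n) (j : ι m), f m j '' Metric.closedBall 0 1
      simp only [hsph, hcl]
      exact hfr n i)
    (by
      change ⋃ (n : ℕ) (j : ι n), f n j '' Metric.closedBall 0 1 = univ
      simp only [hcl]
      rw [eq_univ_iff_forall]
      exact fun q => by simpa using hun q)
  exact ⟨C, fun n => Equiv.refl (ι n), fun n i => ⟨hcl n i, hsph n i⟩⟩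

/-! ### Points, arcs and hemispheres are embedded balls -/

lemma isEmbeddedBall_singleton {Q : Type*} [TopologicalSpace Q] (q : Q) :
    IsEmbeddedBall 0 {q} (∅ : Set Q) := by
  refine ⟨fun _ => q, continuousOn_const, fun _ _ _ _ _ => Subsingleton.elim _ _, ?_, ?_⟩
  · exact Nonempty.image_const ⟨0, Metric.mem_closedBall_self zero_le_one⟩ _
  · have : Metric.sphere (0 : Fin 0 → ℝ) 1 = ∅ := Metric.sphere_eq_empty_of_subsingleton one_ne_zero
    rw [this, image_empty]

lemma IsEmbeddedBall.image {X Q : Type*} [TopologicalSpace X] [TopologicalSpace Q] {n : ℕ}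
    {c b : Set X} (h : IsEmbeddedBall n c b) {g : X → Q} (hg : ContinuousOn g c) (hi : InjOn g c) :
    IsEmbeddedBall n (g '' c) (g '' b) := by
  obtain ⟨f, hf, hfi, rfl, rfl⟩ := h
  refine ⟨g ∘ f, hg.comp hf (mapsTo_image _ _), fun x hx y hy hxy =>
    hfi hx hy (hi (mem_image_of_mem f hx) (mem_image_of_mem f hy) hxy), ?_, ?_⟩
  · rw [image_comp]
  · rw [image_comp]

lemma isEmbeddedBall_Icc {l : ℝ} (hl : 0 < l) : IsEmbeddedBall 1 (Icc 0 l) {0, l} := by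
  refine ⟨fun x => l * (x 0 + 1) / 2, by fun_prop, ?_, ?_, ?_⟩
  · intro x _ y _ hxy
    ext i
    fin_cases i
    simp only at hxy
    have : l * (x 0 - y 0) = 0 := by linarith
    rcases mul_eq_zero.1 this with h | h
    · exact absurd h hl.ne'
    · exact sub_eq_zero.1 h
  · ext t
    simp only [mem_image, mem_closedBall_zero_iff, mem_Icc]
    constructor
    · rintro ⟨x, hx, rfl⟩
      have := (norm_le_pi_norm x 0).trans hx
      rw [Real.norm_eq_abs, abs_le] at this
      constructor <;> nlinarith
    · rintro ⟨h0, h1⟩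
      refine ⟨fun _ => 2 * t / l - 1, ?_, by field_simp; ring⟩
      rw [pi_norm_le_iff_of_nonneg zero_le_one]
      intro _
      have h2 : 2 * t / l ≤ 2 := by rw [div_le_iff₀ hl]; linarith
      have h3 : 0 ≤ 2 * t / l := by positivity
      rw [Real.norm_eq_abs, abs_le]
      constructor <;> linarith
  · ext t
    simp only [mem_image, mem_sphere_zero_iff_norm, mem_insert_iff, mem_singleton_iff]
    have hnorm : ∀ x : Fin 1 → ℝ, ‖x‖ = |x 0| := by
      intro x
      rw [← Real.norm_eq_abs]
      apply le_antisymm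
      · rw [pi_norm_le_iff_of_nonneg (norm_nonneg _)]
        intro i
        fin_cases i
        exact le_rfl
      · exact norm_le_pi_norm x 0
    constructor
    · rintro ⟨x, hx, rfl⟩
      rw [hnorm, abs_eq zero_le_one] at hx
      rcases hx with hx | hx
      · right; rw [hx]; ring
      · left; rw [hx]; ring
    · rintro (rfl | rfl)
      · exact ⟨fun _ => -1, by rw [hnorm]; simp, by ring⟩
      · exact ⟨fun _ => 1, by rw [hnorm]; simp, by ring⟩

/-- The model ball of a CW complex is the unit ball of the sup norm, here a square. A bounded convex
set with interior points is carried to it by a homeomorphism of the plane. -/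
lemma isEmbeddedBall_disc : IsEmbeddedBall 2 {x : Fin 2 → ℝ | x 0 ^ 2 + x 1 ^ 2 ≤ 1}
    {x : Fin 2 → ℝ | x 0 ^ 2 + x 1 ^ 2 = 1} := by
  set e : EuclideanSpace ℝ (Fin 2) ≃L[ℝ] (Fin 2 → ℝ) := EuclideanSpace.equiv (Fin 2) ℝ
  have hn : ∀ x, ‖e.symm x‖ ^ 2 = x 0 ^ 2 + x 1 ^ 2 := by
    intro x
    rw [EuclideanSpace.norm_sq_eq, Fin.sum_univ_two]
    simp only [Real.norm_eq_abs, sq_abs]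
    rfl
  have h1 : {x : Fin 2 → ℝ | x 0 ^ 2 + x 1 ^ 2 ≤ 1} = e '' Metric.closedBall 0 1 := by
    ext x
    rw [e.image_eq_preimage_symm, mem_preimage, mem_closedBall_zero_iff, mem_ofPred_eq, ← hn,
      sq_le_one_iff₀ (norm_nonneg _)]
  have h2 : {x : Fin 2 → ℝ | x 0 ^ 2 + x 1 ^ 2 = 1} = e '' Metric.sphere 0 1 := by
    ext x
    rw [e.image_eq_preimage_symm, mem_preimage, mem_sphere_zero_iff_norm, mem_ofPred_eq, ← hn,
      pow_eq_one_iff_of_nonneg (norm_nonneg _) two_ne_zero]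
  have h3 : interior {x : Fin 2 → ℝ | x 0 ^ 2 + x 1 ^ 2 ≤ 1} = e '' Metric.ball 0 1 := by
    rw [h1, ← interior_closedBall (0 : EuclideanSpace ℝ (Fin 2)) one_ne_zero]
    exact (e.toHomeomorph.image_interior _).symm
  have h4 : frontier {x : Fin 2 → ℝ | x 0 ^ 2 + x 1 ^ 2 ≤ 1} = e '' Metric.sphere 0 1 := by
    rw [h1, ← frontier_closedBall (0 : EuclideanSpace ℝ (Fin 2)) one_ne_zero]
    exact (e.toHomeomorph.image_frontier _).symm
  obtain ⟨h, -, hcl, hfr⟩ := exists_homeomorph_image_interior_closure_frontier_eq_unitBall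
    (s := {x : Fin 2 → ℝ | x 0 ^ 2 + x 1 ^ 2 ≤ 1})
    (by rw [h1]; exact (convex_closedBall _ _).linear_image e.toLinearMap)
    (by rw [h3]; exact ⟨_, mem_image_of_mem e (Metric.mem_ball_self one_pos)⟩)
    (by
      rw [h1]
      exact ((isCompact_closedBall _ _).image e.continuous).isBounded)
  have hclosed : closure {x : Fin 2 → ℝ | x 0 ^ 2 + x 1 ^ 2 ≤ 1} =
      {x : Fin 2 → ℝ | x 0 ^ 2 + x 1 ^ 2 ≤ 1} := by
    rw [h1]
    exact ((isCompact_closedBall _ _).image e.continuous).isClosed.closure_eq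
  rw [hclosed] at hcl
  refine ⟨h.symm, h.symm.continuous.continuousOn, h.symm.injective.injOn, ?_, ?_⟩
  · rw [← hcl, ← image_comp, h.symm_comp_self, image_id]
  · rw [← hfr, ← image_comp, h.symm_comp_self, image_id, h4, h2]

/-- The hemisphere is the graph of `√(1 - |x|²)` over the unit disc orthogonal to `a`. -/
lemma isEmbeddedBall_hemisphere {a : E3} (ha : ‖a‖ = 1) :
    IsEmbeddedBall 2 (closedHemisphere a) (equator a) := by
  obtain ⟨b, d, hb, hd, hab, had, hbd⟩ := exists_orthonormal_pair a
  have haa : ⟪a, a⟫ = 1 := by rw [real_inner_self_eq_norm_sq, ha]; norm_num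
  have hbb : ⟪b, b⟫ = 1 := by rw [real_inner_self_eq_norm_sq, hb]; norm_num
  have hdd : ⟪d, d⟫ = 1 := by rw [real_inner_self_eq_norm_sq, hd]; norm_num
  have hba : ⟪b, a⟫ = 0 := by rw [real_inner_comm]; exact hab
  have hda : ⟪d, a⟫ = 0 := by rw [real_inner_comm]; exact had
  have hdb : ⟪d, b⟫ = 0 := by rw [real_inner_comm]; exact hbd
  set g : (Fin 2 → ℝ) → E3 := fun x =>
    x 0 • b + x 1 • d + √(1 - (x 0 ^ 2 + x 1 ^ 2)) • a with hg
  have inner_b : ∀ x, ⟪b, g x⟫ = x 0 := by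
    intro x
    simp only [hg, inner_add_right, real_inner_smul_right, hbb, hbd, hba]; ring
  have inner_d : ∀ x, ⟪d, g x⟫ = x 1 := by
    intro x
    simp only [hg, inner_add_right, real_inner_smul_right, hdd, hdb, hda]; ring
  have inner_a : ∀ x, ⟪a, g x⟫ = √(1 - (x 0 ^ 2 + x 1 ^ 2)) := by
    intro x
    simp only [hg, inner_add_right, real_inner_smul_right, hab, had, haa]; ring
  have expand : ∀ s t r : ℝ, ‖s • b + t • d + r • a‖ ^ 2 = s ^ 2 + t ^ 2 + r ^ 2 := by
    intro s t r
    rw [← real_inner_self_eq_norm_sq]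
    simp only [inner_add_left, inner_add_right, real_inner_smul_left, real_inner_smul_right, hab,
      had, haa, hbb, hdd, hbd, hdb, hba, hda]
    ring
  have norm_g : ∀ x : Fin 2 → ℝ, x 0 ^ 2 + x 1 ^ 2 ≤ 1 → ‖g x‖ = 1 := by
    intro x hx
    have h1 := expand (x 0) (x 1) (√(1 - (x 0 ^ 2 + x 1 ^ 2)))
    rw [Real.sq_sqrt (by linarith)] at h1
    refine (pow_eq_one_iff_of_nonneg (norm_nonneg _) two_ne_zero).1 (h1.trans (by ring))
  have surj : ∀ y ∈ closedHemisphere a, ∃ x : Fin 2 → ℝ, x 0 ^ 2 + x 1 ^ 2 ≤ 1 ∧ g x = y ∧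
      (⟪a, y⟫ = 0 → x 0 ^ 2 + x 1 ^ 2 = 1) := by
    intro y hy
    obtain ⟨s, t, r, hst⟩ := exists_combination_of_independent (a := b) (b := d) (c := a) (by
      intro s t r h
      have h1 := expand s t r
      rw [h, norm_zero] at h1
      have hs := sq_nonneg s
      have ht := sq_nonneg t
      have hr := sq_nonneg r
      exact ⟨pow_eq_zero_iff two_ne_zero |>.1 (by linarith),
        pow_eq_zero_iff two_ne_zero |>.1 (by linarith),
        pow_eq_zero_iff two_ne_zero |>.1 (by linarith)⟩) y
    have h1 := expand s t r
    rw [← hst, hy.1] at h1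
    have h2 : ⟪a, y⟫ = r := by
      rw [hst]
      simp only [inner_add_right, real_inner_smul_right, hab, had, haa]; ring
    have hr := hy.2
    rw [h2] at hr
    refine ⟨![s, t], ?_, ?_, ?_⟩
    · simp only [Matrix.cons_val_zero, Matrix.cons_val_one]
      linarith [sq_nonneg r]
    · simp only [hg, Matrix.cons_val_zero, Matrix.cons_val_one]
      rw [show 1 - (s ^ 2 + t ^ 2) = r ^ 2 by linarith, Real.sqrt_sq hr, hst]
    · intro h0
      simp only [Matrix.cons_val_zero, Matrix.cons_val_one]
      rw [h2] at h0
      rw [h0] at h1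
      linarith
  have himg : g '' {x | x 0 ^ 2 + x 1 ^ 2 ≤ 1} = closedHemisphere a := by
    apply Subset.antisymm
    · rintro _ ⟨x, hx, rfl⟩
      exact ⟨norm_g x hx, by rw [inner_a]; exact Real.sqrt_nonneg _⟩
    · intro y hy
      obtain ⟨x, hx, rfl, -⟩ := surj y hy
      exact mem_image_of_mem g hx
  have himg' : g '' {x | x 0 ^ 2 + x 1 ^ 2 = 1} = equator a := by
    apply Subset.antisymm
    · rintro _ ⟨x, hx, rfl⟩
      simp only [mem_ofPred_eq] at hx
      exact ⟨norm_g x hx.le, by rw [inner_a, hx, sub_self, Real.sqrt_zero]⟩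
    · intro y hy
      obtain ⟨x, -, rfl, hx⟩ := surj y ⟨hy.1, hy.2.ge⟩
      exact mem_image_of_mem g (hx hy.2)
  rw [← himg, ← himg']
  refine isEmbeddedBall_disc.image ?_ ?_
  · apply Continuous.continuousOn
    fun_prop
  · intro x _ y _ hxy
    ext i
    fin_cases i
    · change x 0 = y 0
      rw [← inner_b x, ← inner_b y, hxy]
    · change x 1 = y 1
      rw [← inner_d x, ← inner_d y, hxy]

namespace IdealPolyhedron
variable {P : IdealPolyhedron}

/-! ### The cell structure of the Gaussian image -/

variable (P) in
/-- The cells of the Gaussian image: faces, edges and vertices of the polyhedron. -/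
def DualCell : ℕ → Type
  | 0 => P.Face
  | 1 => {e // e ∈ P.edges}
  | 2 => P.vertices
  | _ + 3 => Empty

/-- The vertices of the polyhedron in the face, edge or vertex dual to a cell. -/
def vertexSet : ∀ {n : ℕ}, P.DualCell n → Set P.vertices
  | 0, F => {v | Face.Contains F v}
  | 1, e => {v | v ∈ e.1}
  | 2, v => {v}
  | _ + 3, i => i.elim

/-- The vertices at which the polyhedron is supported by the planes corresponding to a point of the
Gaussian image. -/
def support (q : P.GaussianImage) : Set P.vertices := {v | P.gaussMap q ∈ P.normalCone v}

/-- Duality reverses dimensions: faces have at least three vertices, edges two, and no inclusion is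
strict within one dimension. Hence the vertex set determines the cell, and boundaries consist of
cells of lower dimension. -/
lemma eq_or_lt_of_vertexSet_subset : ∀ {m n : ℕ} {i : P.DualCell m} {j : P.DualCell n},
    vertexSet i ⊆ vertexSet j → (⟨m, i⟩ : Σ n, P.DualCell n) = ⟨n, j⟩ ∨ n < m
  | 0, 0, F, G, h => by
    obtain ⟨v, hv, -⟩ := Face.exists_contains_ne F (Classical.arbitrary _) (Classical.arbitrary _)
    obtain ⟨w, hw, hwv, -⟩ := Face.exists_contains_ne F v v
    obtain ⟨z, hz, hzv, hzw⟩ := Face.exists_contains_ne F v w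
    have : F = G := Face.eq_of_three_common hwv hzv hzw.symm hv hw hz (h hv) (h hw) (h hz)
    exact Or.inl (by rw [this])
  | 0, 1, F, ⟨e, he⟩, h => by
    obtain ⟨F', G, v, w, hvw, rfl⟩ := mem_edges.1 he
    obtain ⟨z, hz, hzv, hzw⟩ := Face.exists_contains_ne F v w
    exact absurd (Sym2.mem_iff.1 (h hz)) (not_or.2 ⟨hzv, hzw⟩)
  | 0, 2, F, v, h => by
    obtain ⟨z, hz, hzv, -⟩ := Face.exists_contains_ne F v v
    exact absurd (h hz) hzv
  | 1, 0, _, _, _ => Or.inr one_pos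
  | 1, 1, ⟨e, he⟩, ⟨e', he'⟩, h => by
    obtain ⟨F, G, v, w, hvw, rfl⟩ := mem_edges.1 he
    have h1 : s(v, w) = e' := by
      rw [eq_comm, ← Sym2.mem_and_mem_iff hvw.vertex_ne]
      exact ⟨h (Sym2.mem_mk_left v w), h (Sym2.mem_mk_right v w)⟩
    subst h1
    exact Or.inl rfl
  | 1, 2, ⟨e, he⟩, z, h => by
    obtain ⟨F, G, v, w, hvw, rfl⟩ := mem_edges.1 he
    have h1 : v = z := h (Sym2.mem_mk_left v w)
    have h2 : w = z := h (Sym2.mem_mk_right v w)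
    exact absurd (h1.trans h2.symm) hvw.vertex_ne
  | 2, 0, _, _, _ => Or.inr two_pos
  | 2, 1, _, _, _ => Or.inr one_lt_two
  | 2, 2, v, w, h => by
    have : v = w := h (mem_singleton v)
    exact Or.inl (by rw [this])
  | _ + 3, _, i, _, _ => i.elim
  | _, _ + 3, _, j, _ => j.elim

lemma eq_of_vertexSet_eq {p q : Σ n, P.DualCell n} (h : vertexSet p.2 = vertexSet q.2) : p = q := by
  rcases eq_or_lt_of_vertexSet_subset h.subset with h1 | h1
  · exact h1
  · rcases eq_or_lt_of_vertexSet_subset h.symm.subset with h2 | h2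
    · exact h2.symm
    · exact absurd h1 h2.not_gt

/-! ### Cells in terms of supports -/

section support

variable {v w : P.vertices} {F G : P.Face} {q : P.GaussianImage} {y : E3}

lemma support_nonempty (q : P.GaussianImage) : (support q).Nonempty := exists_mem_normalCone _

lemma EdgeWith.support_eq (h : EdgeWith F G v w) {s t : ℝ} (hs : 0 < s) (ht : 0 < t)
    (hq : P.gaussMap q = s • F.conormal + t • G.conormal) : support q = {v, w} := by
  ext z
  rw [mem_insert_iff, mem_singleton_iff, support, mem_ofPred_eq, hq]
  refine ⟨h.eq_or_eq_of_conormal_mem hs ht, ?_⟩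
  rintro (rfl | rfl)
  · exact h.conormal_combination_mem hs.le ht.le
  · exact h.swap_vertices.conormal_combination_mem hs.le ht.le

lemma Face.support_eq (hq : P.gaussMap q = F.normal) : support q = {v | F.Contains v} := by
  ext z
  rw [support, mem_ofPred_eq, hq, F.normal_mem_normalCone_iff, mem_ofPred_eq]

lemma Face.gaussMap_eq {s : ℝ} (hs : 0 < s) (hq : P.gaussMap q = s • F.conormal) :
    P.gaussMap q = F.normal := by
  have h1 := norm_gaussMap q
  rw [hq, Face.conormal, smul_smul] at h1 ⊢
  rw [norm_smul, F.norm_normal, mul_one,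
    Real.norm_of_nonneg (mul_pos hs (inv_pos.2 F.sqrt_pos)).le] at h1
  rw [h1, one_smul]

/-- Every point of the Gaussian image lies in the interior of a cell. -/
lemma exists_vertexSet_eq (q : P.GaussianImage) :
    ∃ (n : ℕ) (i : P.DualCell n), vertexSet i = support q := by
  obtain ⟨v, hv⟩ := support_nonempty q
  by_cases h : ∃ w ∈ support q, v ≠ w
  · obtain ⟨w, hw, hvw⟩ := h
    rcases edge_or_face_of_mem (inner_eq_zero_iff_ne (norm_gaussMap q)) hvw hv hw with
      ⟨F, G, h, s, t, hs, ht, hst⟩ | ⟨F, -, -, s, hs, hst⟩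
    · refine ⟨1, ⟨s(v, w), h.mem_edges⟩, ?_⟩
      rw [h.support_eq hs ht hst]
      ext z
      exact Sym2.mem_iff
    · exact ⟨0, F, (Face.support_eq (Face.gaussMap_eq hs hst)).symm⟩
  · push Not at h
    exact ⟨2, v, (eq_singleton_iff_unique_mem.2 ⟨hv, fun w hw => (h w hw).symm⟩).symm⟩

lemma injOn_pieceMap (v : P.vertices) : InjOn (pieceMap v) (closedHemisphere (v : E3)) := by
  intro y hy y' hy' h
  apply unitLift_injOn v hy hy'
  rw [← gaussMap_pieceMap hy, ← gaussMap_pieceMap hy', h]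

/-- A further normal cone is reached exactly from the equator, by `lift_mem_normalCone_iff` and
because the maximum in `liftHeight` is attained. -/
lemma mem_equator_iff (hy : y ∈ closedHemisphere (v : E3)) :
    y ∈ equator (v : E3) ↔ {v} ⊂ support (pieceMap v y) := by
  have hsupp : ∀ z, z ∈ support (pieceMap v y) ↔ lift v y ∈ P.normalCone z := by
    intro z
    rw [support, mem_ofPred_eq, gaussMap_pieceMap hy, unitLift_mem_iff hy]
  have hyv := inner_nonneg_of_mem hy
  have hsub : {v} ⊆ support (pieceMap v y) :=
    singleton_subset_iff.2 ((hsupp v).2 (lift_mem_normalCone hyv))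
  constructor
  · intro h
    obtain ⟨w, hw, hmax⟩ := exists_eq_liftHeight v y
    refine (ssubset_iff_of_subset hsub).2 ⟨w, (hsupp w).2 ?_, hw⟩
    exact (lift_mem_normalCone_iff hyv hw).2 ⟨by rw [real_inner_comm]; exact h.2, hmax⟩
  · intro h
    obtain ⟨w, hw, hwv⟩ := (ssubset_iff_of_subset hsub).1 h
    have := (lift_mem_normalCone_iff hyv hwv).1 ((hsupp w).1 hw)
    exact ⟨hy.1, by rw [real_inner_comm]; exact this.1⟩

lemma gaussVertex_eq_support (v : P.vertices) : P.gaussVertex v = {q | {v} ⊆ support q} := by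
  ext q
  rw [mem_gaussVertex, mem_ofPred_eq, singleton_subset_iff]
  rfl

lemma image_equator (v : P.vertices) :
    pieceMap v '' equator (v : E3) = {q | {v} ⊂ support q} := by
  ext q
  constructor
  · rintro ⟨y, hy, rfl⟩
    exact (mem_equator_iff ⟨hy.1, hy.2.ge⟩).1 hy
  · intro h
    have h1 : q ∈ P.gaussVertex v := by rw [gaussVertex_eq_support]; exact h.1
    rw [gaussVertex_eq] at h1
    obtain ⟨y, hy, rfl⟩ := h1
    exact ⟨y, (mem_equator_iff hy).2 h, rfl⟩

lemma EdgeWith.gaussEdge_eq_support (h : EdgeWith F G v w) :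
    gaussEdge F G = {q | {v, w} ⊆ support q} := by
  ext q
  rw [h.mem_gaussEdge, mem_ofPred_eq, insert_subset_iff, singleton_subset_iff]
  rfl

/-- A support that contains all vertices of `F` is the vertex set of a cell of dimension zero, so it
equals that of `F`. Having three vertices, it does not come from inside an edge; so the Gauss image
is the normal of a face with the same vertices. -/
lemma gaussFace_eq_support (F : P.Face) : gaussFace F = {q | {v | F.Contains v} ⊆ support q} := by
  ext q
  rw [mem_gaussFace]
  constructor
  · intro h
    exact (Face.support_eq h).ge
  · intro h
    obtain ⟨n, i, hi⟩ := exists_vertexSet_eq q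
    rw [mem_ofPred_eq, ← hi] at h
    rcases eq_or_lt_of_vertexSet_subset (m := 0) (i := F) h with h1 | h1
    · cases h1
      obtain ⟨q', hq'⟩ := exists_gaussMap_eq (P := P) F.norm_normal
      obtain ⟨v, hv, -⟩ := F.exists_contains_ne (Classical.arbitrary _) (Classical.arbitrary _)
      obtain ⟨w, hw, hwv, -⟩ := F.exists_contains_ne v v
      have hv' : v ∈ support q := hi ▸ hv
      have hw' : w ∈ support q := hi ▸ hw
      rcases edge_or_face_of_mem (inner_eq_zero_iff_ne (norm_gaussMap q)) hwv.symm hv' hw' with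
        ⟨F', G, h', s, t, hs, ht, hst⟩ | ⟨F', -, -, s, hs, hst⟩
      · obtain ⟨z, hz, hzv, hzw⟩ := F.exists_contains_ne v w
        have hz' : z ∈ support q := hi ▸ hz
        rw [h'.support_eq hs ht hst] at hz'
        exact absurd hz' (not_or.2 ⟨hzv, hzw⟩)
      · have h1 := Face.gaussMap_eq hs hst
        have h2 := Face.support_eq h1
        rw [← hi] at h2
        have h3 : (⟨0, F⟩ : Σ n, P.DualCell n) = ⟨0, F'⟩ := eq_of_vertexSet_eq h2
        cases h3
        exact h1
    · exact absurd h1 (Nat.not_lt_zero _)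

lemma EdgeWith.image_ends (h : EdgeWith F G v w) :
    pieceMap v '' {F.normalAt v, G.normalAt v} = {q | {v, w} ⊂ support q} := by
  have key : ∀ {F G}, EdgeWith F G v w → {v, w} ⊂ support (pieceMap v (F.normalAt v)) := by
    intro F G h
    have h1 : support (pieceMap v (F.normalAt v)) = {v | F.Contains v} := by
      apply Face.support_eq
      rw [gaussMap_pieceMap (Face.normalAt_mem h.left_fst), unitLift_normalAt h.left_fst]
    rw [h1]
    obtain ⟨z, hz, hzv, hzw⟩ := F.exists_contains_ne v w
    refine (ssubset_iff_of_subset ?_).2 ⟨z, hz, not_or.2 ⟨hzv, hzw⟩⟩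
    rw [insert_subset_iff, singleton_subset_iff]
    exact ⟨h.left_fst, h.left_snd⟩
  ext q
  constructor
  · rintro ⟨y, rfl | rfl, rfl⟩
    · exact key h
    · exact key h.swap_faces
  · intro hq
    have h1 : q ∈ gaussEdge F G := by rw [h.gaussEdge_eq_support]; exact hq.1
    obtain ⟨hv, hw⟩ := h.mem_gaussEdge.1 h1
    obtain ⟨s, t, hs, ht, hst⟩ := h.exists_conormal_combination hv hw
    have hne : ∀ c : ℝ, 0 ≤ c → ∀ H : P.Face, P.gaussMap q = c • H.conormal → 0 < c := by
      intro c hc H hH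
      rcases hc.eq_or_lt with rfl | hc
      · rw [zero_smul] at hH
        exact absurd hH (inner_eq_zero_iff_ne (norm_gaussMap q))
      · exact hc
    have hface : ∀ {H : P.Face}, H.Contains v → P.gaussMap q = H.normal →
        q = pieceMap v (H.normalAt v) := by
      intro H hH hq
      rw [← mem_gaussFace, gaussFace_eq hH] at hq
      exact hq
    rcases hs.eq_or_lt with rfl | hs
    · rw [zero_smul, zero_add] at hst
      exact ⟨_, Or.inr rfl, (hface h.right_fst (Face.gaussMap_eq (hne _ ht _ hst) hst)).symm⟩
    rcases ht.eq_or_lt with rfl | ht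
    · rw [zero_smul, add_zero] at hst
      exact ⟨_, Or.inl rfl, (hface h.left_fst (Face.gaussMap_eq (hne _ hs.le _ hst) hst)).symm⟩
    exact absurd (h.support_eq hs ht hst) hq.ne'

lemma EdgeWith.dualSide_eq_image (h : EdgeWith F G v w) : dualSide F G v =
    arcPoint (F.normalAt v) (G.normalAt v) '' Icc 0 (exteriorDihedralAngle F G) := by
  rw [← h.angle_eq]
  apply Subset.antisymm
  · intro y hy
    exact ⟨_, angle_mem_Icc_of_mem hy,
      arcPoint_angle_of_mem h.norm_left h.norm_right h.angle_pos h.angle_lt_pi hy⟩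
  · rintro _ ⟨t, ht, rfl⟩
    exact arcPoint_mem h.norm_left h.norm_right h.angle_pos h.angle_lt_pi ht

lemma EdgeWith.angle_arcPoint (h : EdgeWith F G v w) {s t : ℝ}
    (hs : s ∈ Icc 0 (exteriorDihedralAngle F G)) (ht : t ∈ Icc 0 (exteriorDihedralAngle F G)) :
    angle (arcPoint (F.normalAt v) (G.normalAt v) s) (arcPoint (F.normalAt v) (G.normalAt v) t) =
      |s - t| := by
  rw [← h.angle_eq] at hs ht
  exact _root_.angle_arcPoint h.norm_left h.norm_right h.angle_pos h.angle_lt_pi hs ht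

lemma EdgeWith.isEmbeddedBall (h : EdgeWith F G v w) :
    IsEmbeddedBall 1 (dualSide F G v) {F.normalAt v, G.normalAt v} := by
  have h1 := (isEmbeddedBall_Icc h.exterior_pos).image
    (g := arcPoint (F.normalAt v) (G.normalAt v)) (continuous_arcPoint _ _).continuousOn (by
      intro s hs t ht hst
      have h2 := h.angle_arcPoint hs ht
      rw [hst, h.angle_arcPoint ht ht, sub_self, abs_zero, eq_comm, abs_eq_zero] at h2
      linarith)
  rwa [← h.dualSide_eq_image, image_pair, arcPoint_zero h.angle_pos h.angle_lt_pi, ← h.angle_eq,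
    arcPoint_angle h.angle_pos h.angle_lt_pi] at h1

lemma Face.isEmbeddedBall (F : P.Face) : IsEmbeddedBall 0 {q | {v | F.Contains v} ⊆ support q}
    {q | {v | F.Contains v} ⊂ support q} := by
  obtain ⟨v, hv, -⟩ := F.exists_contains_ne (Classical.arbitrary _) (Classical.arbitrary _)
  have h1 : {q : P.GaussianImage | {v | F.Contains v} ⊂ support q} = ∅ := by
    rw [eq_empty_iff_forall_notMem]
    intro q hq
    have h2 : q ∈ gaussFace F := by rw [gaussFace_eq_support]; exact hq.1
    exact hq.ne' (Face.support_eq (mem_gaussFace.1 h2))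
  rw [h1, ← gaussFace_eq_support, gaussFace_eq hv]
  exact isEmbeddedBall_singleton _

lemma isEmbeddedBall_vertex (v : P.vertices) :
    IsEmbeddedBall 2 {q : P.GaussianImage | {v} ⊆ support q} {q | {v} ⊂ support q} := by
  rw [← gaussVertex_eq_support, ← image_equator, gaussVertex_eq]
  exact (isEmbeddedBall_hemisphere (norm_vertex v)).image (continuousOn_pieceMap v)
    (injOn_pieceMap v)

lemma vertexSet_mk (he : s(v, w) ∈ P.edges) :
    vertexSet (P := P) (n := 1) ⟨s(v, w), he⟩ = {v, w} := by
  ext z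
  exact Sym2.mem_iff

lemma isEmbeddedBall_vertexSet : ∀ {n : ℕ} (i : P.DualCell n),
    IsEmbeddedBall n {q | vertexSet i ⊆ support q} {q | vertexSet i ⊂ support q}
  | 0, F => Face.isEmbeddedBall F
  | 1, ⟨e, he⟩ => by
    obtain ⟨F, G, v, w, h, rfl⟩ := mem_edges.1 he
    rw [vertexSet_mk, ← h.gaussEdge_eq_support, ← h.image_ends, h.gaussEdge_eq]
    have hsub : dualSide F G v ⊆ closedHemisphere (v : E3) := by
      rw [← vertexDual_eq]; exact h.dualSide_subset
    exact h.isEmbeddedBall.image ((continuousOn_pieceMap v).mono hsub) ((injOn_pieceMap v).mono hsub)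
  | 2, v => isEmbeddedBall_vertex v
  | _ + 3, i => i.elim

end support

instance (n : ℕ) : Finite (P.DualCell n) := by
  match n with
  | 0 => exact inferInstanceAs (Finite P.Face)
  | 1 => exact inferInstanceAs (Finite {e // e ∈ P.edges})
  | 2 => exact inferInstanceAs (Finite P.vertices)
  | _ + 3 => exact inferInstanceAs (Finite Empty)

open Topology.CWComplex in
variable (P) in
/-- The cell decomposition of the Gaussian image. -/
lemma exists_gaussComplex : ∃ (_ : CWComplex (univ : Set P.GaussianImage))
    (e : ∀ n, cell (univ : Set P.GaussianImage) n ≃ P.DualCell n), ∀ n i,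
      closedCell n i = {q | vertexSet (e n i) ⊆ support q} ∧
      cellFrontier n i = {q | vertexSet (e n i) ⊂ support q} := by
  refine exists_cwComplex (ι := P.DualCell) (c := fun n i => {q | vertexSet i ⊆ support q})
    (b := fun n i => {q | vertexSet i ⊂ support q}) inferInstance ?_
    (fun _ => isEmbeddedBall_vertexSet) ?_ ?_ ?_
  · filter_upwards [eventually_ge_atTop 3] with n hn
    obtain ⟨m, rfl⟩ := Nat.exists_eq_add_of_le' hn
    exact inferInstanceAs (IsEmpty Empty)
  -- In the interior of a cell the support is exactly the vertex set of the cell.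
  · intro p q hpq
    rw [Set.disjoint_left]
    intro x hx hx'
    have key : ∀ {p : Σ n, P.DualCell n}, x ∈ {q | vertexSet p.2 ⊆ support q} \
        {q | vertexSet p.2 ⊂ support q} → vertexSet p.2 = support x :=
      fun h => h.1.eq_or_ssubset.resolve_right h.2
    exact hpq (eq_of_vertexSet_eq ((key hx).trans (key hx').symm))
  · intro n i q hq
    obtain ⟨m, j, hj⟩ := exists_vertexSet_eq q
    have hlt : m < n := by
      rw [mem_ofPred_eq, ← hj] at hq
      rcases eq_or_lt_of_vertexSet_subset hq.subset with h | h
      · cases h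
        exact absurd rfl hq.ne
      · exact h
    exact mem_iUnion₂.2 ⟨m, hlt, mem_iUnion.2 ⟨j, hj.le⟩⟩
  · intro q
    obtain ⟨m, j, hj⟩ := exists_vertexSet_eq q
    exact ⟨m, j, hj.le⟩

end IdealPolyhedron

lemma IsEmbeddedBall.sdiff_nonempty {Q : Type*} [TopologicalSpace Q] {n : ℕ} {c b : Set Q}
    (h : IsEmbeddedBall n c b) : (c \ b).Nonempty := by
  obtain ⟨f, -, hi, rfl, rfl⟩ := h
  refine ⟨f 0, mem_image_of_mem f (Metric.mem_closedBall_self zero_le_one), ?_⟩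
  rintro ⟨x, hx, hxe⟩
  have := hi (Metric.sphere_subset_closedBall hx) (Metric.mem_closedBall_self zero_le_one) hxe
  rw [this, mem_sphere_zero_iff_norm, norm_zero] at hx
  exact zero_ne_one hx

namespace IdealPolyhedron
variable {P : IdealPolyhedron}

/-! ### The polar polytope -/

section cone

open scoped NNReal

variable {v : P.vertices} {x y : E3}

/-- The cone generated by the normal vectors of the faces at a vertex. -/
noncomputable def faceCone (v : P.vertices) : Submodule ℝ≥0 E3 :=
  Submodule.span ℝ≥0 (Face.normal '' {F : P.Face | F.Contains v})

lemma Face.smul_conormal_mem {F : P.Face} (hF : F.Contains v) {s : ℝ} (hs : 0 ≤ s) :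
    s • F.conormal ∈ faceCone v := by
  rw [Face.conormal, smul_smul]
  exact Submodule.smul_mem _ (⟨s * (√(1 - F.level ^ 2))⁻¹, mul_nonneg hs (inv_pos.2 F.sqrt_pos).le⟩ :
    ℝ≥0) (Submodule.subset_span (mem_image_of_mem _ hF))

lemma smul_mem_faceCone (h : x ∈ faceCone v) {s : ℝ} (hs : 0 ≤ s) : s • x ∈ faceCone v :=
  Submodule.smul_mem _ (⟨s, hs⟩ : ℝ≥0) h

lemma lift_mem_faceCone (hy : ⟪y, (v : E3)⟫ = 0) : lift v y ∈ faceCone v := by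
  by_cases h0 : y = 0
  · have := lift_smul (P := P) (le_refl (0 : ℝ)) v 0
    rw [smul_zero, zero_smul] at this
    rw [h0, this]
    exact Submodule.zero_mem _
  have hpos : 0 < ‖y‖ := norm_pos_iff.2 h0
  obtain ⟨F, G, w, h, hmem⟩ := exists_dualSide (v := v) (y := ‖y‖⁻¹ • y)
    ⟨by rw [norm_smul, norm_inv, norm_norm, inv_mul_cancel₀ hpos.ne'],
      by rw [inner_smul_right, real_inner_comm, hy, mul_zero]⟩
  obtain ⟨-, s, t, hs, ht, hst⟩ := h.mem_dualSide_iff.1 hmem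
  have h1 : y = ‖y‖ • (s • F.normalAt v + t • G.normalAt v) := by
    rw [← hst, smul_smul, mul_inv_cancel₀ hpos.ne', one_smul]
  rw [h1, lift_smul hpos.le, h.lift_combination hs ht]
  exact smul_mem_faceCone (Submodule.add_mem _ (Face.smul_conormal_mem h.left_fst hs)
    (Face.smul_conormal_mem h.right_fst ht)) hpos.le

/-- The lifts of opposite equatorial vectors add up to a multiple `a • v` with `a ≥ 0`. If `a` were
zero, `lift v y` and its negative would both lie in the normal cone, and the corresponding form
would be constant on the vertices. -/
lemma vertex_mem_faceCone (v : P.vertices) : (v : E3) ∈ faceCone v := by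
  obtain ⟨y, -, hy1, -, hvy, -⟩ := exists_orthonormal_pair (v : E3)
  have hy : ⟪y, (v : E3)⟫ = 0 := by rw [real_inner_comm]; exact hvy
  have hy' : ⟪-y, (v : E3)⟫ = 0 := by rw [inner_neg_left, hy, neg_zero]
  have hsum := Submodule.add_mem _ (lift_mem_faceCone hy) (lift_mem_faceCone hy')
  set a := liftHeight v y + liftHeight v (-y) with ha
  have h1 : lift v y + lift v (-y) = a • (v : E3) := by
    rw [lift, lift, ha]; module
  have hN := lift_mem_normalCone (v := v) hy.ge
  have hN' := lift_mem_normalCone (v := v) hy'.ge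
  have ha0 : 0 ≤ a := by
    obtain ⟨w, hw, -⟩ := exists_vertex_ne v v
    have h2 := add_mem_normalCone hN hN' w
    rw [h1, real_inner_smul_left, real_inner_smul_left, inner_vertex_self] at h2
    have h3 := inner_vertex_lt_one hw.symm
    nlinarith
  rcases ha0.eq_or_lt with ha0 | ha0
  · exfalso
    rw [← ha0, zero_smul, add_eq_zero_iff_eq_neg'] at h1
    rw [h1] at hN'
    apply lift_ne_zero (v := v) (y := y) ⟨hy1, hvy.ge⟩
    apply eq_zero_of_inner_vertex_eq (P := P)
    have key : ∀ w : P.vertices, ⟪lift v y, (w : E3)⟫ = ⟪lift v y, (v : E3)⟫ := by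
      intro w
      have h2 := hN w
      have h3 := hN' w
      rw [inner_neg_left, inner_neg_left] at h3
      linarith
    intro w z
    rw [key w, key z]
  · rw [h1] at hsum
    have := smul_mem_faceCone hsum (inv_pos.2 ha0).le
    rwa [smul_smul, inv_mul_cancel₀ ha0.ne', one_smul] at this

/-- The normal cone at a vertex is generated by the normal vectors of the faces. -/
lemma mem_faceCone (h : x ∈ P.normalCone v) : x ∈ faceCone v := by
  set y := x - ⟪x, (v : E3)⟫ • (v : E3) with hy
  have hyv : ⟪y, (v : E3)⟫ = 0 := by
    rw [hy, inner_sub_left, real_inner_smul_left, inner_vertex_self]; ring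
  have hx : x = y + ⟪x, (v : E3)⟫ • (v : E3) := by rw [hy]; module
  have hle : liftHeight v y ≤ ⟪x, (v : E3)⟫ := by
    rw [hx] at h
    obtain ⟨z, hz, hzmax⟩ := exists_eq_liftHeight v y
    have h1 := add_smul_mem_normalCone_iff.1 h z hz
    rw [slope, inner_sub_right, hyv, sub_zero, hzmax,
      mul_div_cancel_right₀ _ (sub_pos.2 (inner_vertex_lt_one hz.symm)).ne'] at h1
    exact h1
  -- A vector of the normal cone lies above the lift of its projection, and the difference is a
  -- nonnegative multiple of `v`.
  have h2 : x = lift v y + (⟪x, (v : E3)⟫ - liftHeight v y) • (v : E3) := by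
    rw [lift]; nth_rewrite 1 [hx]; module
  rw [h2]
  exact Submodule.add_mem _ (lift_mem_faceCone hyv)
    (smul_mem_faceCone (vertex_mem_faceCone v) (sub_nonneg.2 hle))

end cone

variable (P) in
/-- A point in the interior of the polyhedron. -/
noncomputable def center : E3 := (P.vertices.card : ℝ)⁻¹ • ∑ v ∈ P.vertices, v

/-- The maximum of a form exceeds its average unless the form is constant on the vertices. -/
lemma inner_center_lt {u : E3} (hu : u ≠ 0) {v : P.vertices} (hv : u ∈ P.normalCone v) :
    0 < ⟪u, (v : E3) - P.center⟫ := by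
  have hcard : 0 < (P.vertices.card : ℝ) := by
    exact Nat.cast_pos.2 (Finset.card_pos.2 ⟨(v : E3), v.2⟩)
  rw [inner_sub_right, center, inner_smul_right, inner_sum, sub_pos, inv_mul_lt_iff₀ hcard,
    ← nsmul_eq_mul]
  obtain ⟨w, hw⟩ : ∃ w : P.vertices, ⟪u, (w : E3)⟫ ≠ ⟪u, (v : E3)⟫ := by
    by_contra! h
    exact hu (eq_zero_of_inner_vertex_eq fun w z => (h w).trans (h z).symm)
  calc ∑ z ∈ P.vertices, ⟪u, z⟫ < ∑ z ∈ P.vertices, ⟪u, (v : E3)⟫ :=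
        Finset.sum_lt_sum (fun z hz => hv ⟨z, hz⟩) ⟨w, w.2, lt_of_le_of_ne (hv w) hw⟩
    _ = _ := Finset.sum_const _

variable (P) in
/-- The polar of the polyhedron with respect to its center. -/
def polar : Set E3 := {x | ∀ v : P.vertices, ⟪x, (v : E3) - P.center⟫ ≤ 1}

/-- The vertices of the polyhedron that correspond to the facets of the polar through `x`. -/
def tight (x : E3) : Set P.vertices := {v | ⟪x, (v : E3) - P.center⟫ = 1}

lemma convex_polar : Convex ℝ P.polar := by
  intro x hx y hy a b ha hb hab v
  rw [inner_add_left, real_inner_smul_left, real_inner_smul_left]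
  nlinarith [mul_le_mul_of_nonneg_left (hx v) ha, mul_le_mul_of_nonneg_left (hy v) hb]

variable (P) in
open Classical in
/-- The vertices of the polar: one for each face of the polyhedron. -/
noncomputable def polarVertices : Finset E3 :=
  letI := Fintype.ofFinite P.Face
  Finset.univ.image fun F : P.Face => (F.level - ⟪F.normal, P.center⟫)⁻¹ • F.normal

lemma mem_polarVertices {x : E3} : x ∈ P.polarVertices ↔
    ∃ F : P.Face, (F.level - ⟪F.normal, P.center⟫)⁻¹ • F.normal = x := by
  simp [polarVertices]

lemma Face.level_sub_pos (F : P.Face) : 0 < F.level - ⟪F.normal, P.center⟫ := by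
  obtain ⟨v, hv, -⟩ := F.exists_contains_ne (Classical.arbitrary _) (Classical.arbitrary _)
  have := inner_center_lt F.normal_ne_zero ((F.normal_mem_normalCone_iff v).2 hv)
  rwa [inner_sub_right, hv] at this

/-- On the cone at `v` the form `⟪·, v - center⟫` measures the radial coordinate relative to the
polar. Its level one meets the rays of the generators in points of `polarVertices`, and sums in the
cone become convex combinations there. -/
lemma exists_eq_smul_of_mem_faceCone {v : P.vertices} {x : E3} (hx : x ∈ faceCone v) :
    0 ≤ ⟪x, (v : E3) - P.center⟫ ∧ ∃ k ∈ convexHull ℝ (P.polarVertices : Set E3),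
      x = ⟪x, (v : E3) - P.center⟫ • k := by
  obtain ⟨F₀, -⟩ : ∃ F : P.Face, F.Contains v := by
    obtain ⟨y, -, hy, -, hvy, -⟩ := exists_orthonormal_pair (v : E3)
    obtain ⟨F, G, w, h, -⟩ := exists_dualSide (y := y) ⟨hy, hvy⟩
    exact ⟨F, h.left_fst⟩
  have hF₀ := subset_convexHull ℝ (P.polarVertices : Set E3)
    (Finset.mem_coe.2 (mem_polarVertices.2 ⟨F₀, rfl⟩))
  induction hx using Submodule.span_induction with
  | mem x hx =>
    obtain ⟨F, hF, rfl⟩ := hx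
    have h1 := F.level_sub_pos
    have h2 : ⟪F.normal, (v : E3) - P.center⟫ = F.level - ⟪F.normal, P.center⟫ := by
      rw [inner_sub_right, hF]
    rw [h2]
    refine ⟨h1.le, _, subset_convexHull ℝ _ (Finset.mem_coe.2 (mem_polarVertices.2 ⟨F, rfl⟩)), ?_⟩
    rw [smul_smul, mul_inv_cancel₀ h1.ne', one_smul]
  | zero => exact ⟨by rw [inner_zero_left], _, hF₀, by rw [inner_zero_left, zero_smul]⟩
  | add x y _ _ hx hy =>
    obtain ⟨hx0, k, hk, hxk⟩ := hx
    obtain ⟨hy0, k', hk', hyk⟩ := hy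
    rw [inner_add_left]
    set a := ⟪x, (v : E3) - P.center⟫
    set b := ⟪y, (v : E3) - P.center⟫
    refine ⟨add_nonneg hx0 hy0, ?_⟩
    rcases (add_nonneg hx0 hy0).eq_or_lt with h | h
    · have ha : a = 0 := by linarith
      have hb : b = 0 := by linarith
      exact ⟨k, hk, by rw [hxk, hyk, ha, hb]; module⟩
    · refine ⟨(a / (a + b)) • k + (b / (a + b)) • k', convex_convexHull ℝ _ hk hk'
        (div_nonneg hx0 h.le) (div_nonneg hy0 h.le) (by rw [← add_div, div_self h.ne']), ?_⟩
      rw [smul_add, smul_smul, smul_smul, mul_div_cancel₀ _ h.ne', mul_div_cancel₀ _ h.ne', ← hxk,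
        ← hyk]
  | smul r x _ hx =>
    obtain ⟨hx0, k, hk, hxk⟩ := hx
    have h1 : r • x = (r : ℝ) • x := rfl
    rw [h1, real_inner_smul_left]
    refine ⟨mul_nonneg r.coe_nonneg hx0, k, hk, ?_⟩
    rw [mul_smul, ← hxk]

/-- The convex hull contains positive multiples of `x` and of `-x`, hence also the origin between
them. -/
lemma zero_mem_convexHull : (0 : E3) ∈ convexHull ℝ (P.polarVertices : Set E3) := by
  obtain ⟨x, hx0, -⟩ := exists_ne_zero_orthogonal_pair (0 : E3) 0
  have key : ∀ x : E3, x ≠ 0 → ∃ c : ℝ, 0 < c ∧ c • x ∈ convexHull ℝ (P.polarVertices : Set E3) := by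
    intro x hx
    obtain ⟨v, hv⟩ := exists_mem_normalCone (P := P) x
    obtain ⟨-, k, hk, hxk⟩ := exists_eq_smul_of_mem_faceCone (mem_faceCone hv)
    have hpos := inner_center_lt hx hv
    refine ⟨_, inv_pos.2 hpos, ?_⟩
    nth_rewrite 2 [hxk]
    rwa [smul_smul, inv_mul_cancel₀ hpos.ne', one_smul]
  obtain ⟨a, ha, hax⟩ := key x hx0
  obtain ⟨b, hb, hbx⟩ := key (-x) (neg_ne_zero.2 hx0)
  have hab : 0 < a + b := by linarith
  have h := convex_convexHull ℝ _ hax hbx (a := b / (a + b)) (b := a / (a + b))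
    (div_nonneg hb.le hab.le) (div_nonneg ha.le hab.le)
    (by rw [← add_div, add_comm b, div_self hab.ne'])
  convert h using 1
  match_scalars
  ring

/-- A point of the polar lies in the normal cone of some `v`, so it is a multiple of a point of the
hull with factor `⟪x, v - center⟫`, which is in `[0, 1]`. -/
lemma polar_eq_convexHull : P.polar = convexHull ℝ (P.polarVertices : Set E3) := by
  apply Subset.antisymm
  · intro x hx
    obtain ⟨v, hv⟩ := exists_mem_normalCone (P := P) x
    obtain ⟨h0, k, hk, hxk⟩ := exists_eq_smul_of_mem_faceCone (mem_faceCone hv)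
    rw [hxk]
    exact (convex_convexHull ℝ _).smul_mem_of_zero_mem zero_mem_convexHull hk ⟨h0, hx v⟩
  · refine convexHull_min ?_ convex_polar
    intro x hx v
    obtain ⟨F, rfl⟩ := mem_polarVertices.1 (Finset.mem_coe.1 hx)
    have h1 := F.level_sub_pos
    rw [real_inner_smul_left, inv_mul_le_iff₀ h1, inner_sub_right, mul_one]
    linarith [F.inner_le v]

lemma affineSpan_polarVertices : affineSpan ℝ (P.polarVertices : Set E3) = ⊤ := by
  apply affineSpan_eq_top_of_nonempty_interior
  rw [← polar_eq_convexHull]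
  refine ⟨0, mem_interior_iff_mem_nhds.2 ?_⟩
  have : P.polar = ⋂ v : P.vertices, {x | ⟪x, (v : E3) - P.center⟫ ≤ 1} := by
    ext x; simp [polar]
  rw [this, Filter.iInter_mem]
  intro v
  have hc : Continuous fun x : E3 => ⟪x, (v : E3) - P.center⟫ := by fun_prop
  have h1 := hc.tendsto 0
  rw [inner_zero_left] at h1
  exact (h1.eventually_lt_const one_pos).mono fun _ h => h.le

/-! ### The faces of the polar -/

/-- The face of the polar cut out by the facets corresponding to a set of vertices. -/
def polarFace (T : Set P.vertices) : Set E3 := {x | x ∈ P.polar ∧ T ⊆ tight x}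

/-- The sum of the forms belonging to `T` exposes this face, since each is at most one on the polar.
It is proper because the forms vanish at the origin. -/
lemma isProperFace_polarFace {T : Set P.vertices} (hT : T.Nonempty)
    (hne : (polarFace T).Nonempty) : IsProperFace P.polar (polarFace T) := by
  classical
  refine ⟨fun _ => ?_, hne, fun h => ?_⟩
  · set S : Finset P.vertices := T.toFinite.toFinset with hS
    have hSmem : ∀ v, v ∈ S ↔ v ∈ T := fun v => Set.Finite.mem_toFinset _
    refine ⟨innerSL ℝ (∑ v ∈ S, ((v : E3) - P.center)), ?_⟩
    have hval : ∀ x, innerSL ℝ (∑ v ∈ S, ((v : E3) - P.center)) x =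
        ∑ v ∈ S, ⟪x, (v : E3) - P.center⟫ := by
      intro x
      rw [innerSL_apply_apply, real_inner_comm, inner_sum]
    have hle : ∀ x ∈ P.polar, ∑ v ∈ S, ⟪x, (v : E3) - P.center⟫ ≤ ∑ v ∈ S, (1 : ℝ) :=
      fun x hx => Finset.sum_le_sum fun v _ => hx v
    ext x
    constructor
    · rintro ⟨hx, hxT⟩
      refine ⟨hx, fun y hy => ?_⟩
      rw [hval, hval, Finset.sum_congr rfl fun v hv => hxT ((hSmem v).1 hv)]
      exact hle y hy
    · rintro ⟨hx, hmax⟩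
      refine ⟨hx, fun v hv => ?_⟩
      obtain ⟨y, hy, hyT⟩ := hne
      have h1 := hmax y hy
      rw [hval, hval, Finset.sum_congr rfl fun v hv => hyT ((hSmem v).1 hv)] at h1
      exact (Finset.sum_eq_sum_iff_of_le fun v _ => hx v).1 (le_antisymm (hle x hx) h1) v
        ((hSmem v).2 hv)
  · obtain ⟨v, hv⟩ := hT
    have h0 : (0 : E3) ∈ P.polar := by rw [polar_eq_convexHull]; exact zero_mem_convexHull
    rw [← h] at h0
    have := h0.2 hv
    rw [tight, mem_ofPred_eq, inner_zero_left] at this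
    exact zero_ne_one this

/-- A point `x` of the face with minimal tight set plays the part of a relative interior point.
Every constraint tight at `x` is tight on all of `B`, by minimality at the midpoint of `x` and
another point. Conversely, if the constraints tight at `x` are tight at `y`, the segment from `y` to
`x` can be prolonged beyond `x` inside the polar, so the exposing form is as large at `y` as at `x`.
-/
lemma exists_polarFace_eq {B : Set E3} (hB : IsProperFace P.polar B) :
    ∃ x ∈ P.polar, (tight (P := P) x).Nonempty ∧ B = polarFace (P := P) (tight x) := by
  obtain ⟨hexp, hne, hBK⟩ := hB
  obtain ⟨l, hl⟩ := hexp hne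
  obtain ⟨x, hxB, hmin⟩ := exists_minimalFor_of_wellFoundedLT (fun x => x ∈ B)
    (fun x => tight (P := P) x) hne
  have hmem : ∀ {y}, y ∈ B ↔ y ∈ P.polar ∧ ∀ z ∈ P.polar, l z ≤ l y := by
    intro y; rw [hl]; rfl
  obtain ⟨hxK, hxmax⟩ := hmem.1 hxB
  have hsub : B ⊆ polarFace (P := P) (tight x) := by
    intro y hy
    obtain ⟨hyK, hymax⟩ := hmem.1 hy
    refine ⟨hyK, ?_⟩
    set m : E3 := (1 / 2 : ℝ) • x + (1 / 2 : ℝ) • y with hm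
    have hinner : ∀ v : P.vertices, ⟪m, (v : E3) - P.center⟫ =
        (⟪x, (v : E3) - P.center⟫ + ⟪y, (v : E3) - P.center⟫) / 2 := by
      intro v
      rw [hm, inner_add_left, real_inner_smul_left, real_inner_smul_left]; ring
    have hmB : m ∈ B := by
      refine hmem.2 ⟨convex_polar hxK hyK (by norm_num) (by norm_num) (by norm_num), fun z hz => ?_⟩
      rw [hm, map_add, map_smul, map_smul, smul_eq_mul, smul_eq_mul]
      linarith [hxmax z hz, hymax z hz]
    have hmx : tight (P := P) m ⊆ tight x := by
      intro v hv
      have h1 : _ = _ := hv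
      have h2 := hinner v
      have h3 := hxK v
      have h4 := hyK v
      change _ = _
      linarith
    intro v hv
    have h1 : _ = _ := hmin hmB hmx hv
    have h2 := hinner v
    have h3 : _ = _ := hv
    change _ = _
    linarith
  have hsup : polarFace (P := P) (tight x) ⊆ B := by
    rintro y ⟨hyK, hyT⟩
    refine hmem.2 ⟨hyK, fun z hz => ?_⟩
    have hev : ∀ᶠ ε in 𝓝[>] (0 : ℝ), x + ε • (x - y) ∈ P.polar := by
      have : ∀ v : P.vertices, ∀ᶠ ε in 𝓝[>] (0 : ℝ),
          ⟪x + ε • (x - y), (v : E3) - P.center⟫ ≤ 1 := by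
        intro v
        by_cases hv : v ∈ tight x
        · have h1 : _ = _ := hv
          have h2 : _ = _ := hyT hv
          refine Eventually.of_forall fun ε => le_of_eq ?_
          rw [inner_add_left, real_inner_smul_left, inner_sub_left, h1, h2]
          ring
        · have hlt := lt_of_le_of_ne (hxK v) hv
          have hc : Continuous fun ε : ℝ => ⟪x + ε • (x - y), (v : E3) - P.center⟫ := by fun_prop
          have h1 := hc.tendsto 0
          rw [zero_smul, add_zero] at h1
          exact ((h1.mono_left nhdsWithin_le_nhds).eventually_lt_const hlt).mono fun _ h => h.le
      exact eventually_all.2 this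
    obtain ⟨ε, hε, hε0⟩ := (hev.and self_mem_nhdsWithin).exists
    have h1 := hxmax _ hε
    rw [map_add, map_smul, map_sub, smul_eq_mul] at h1
    have h2 : l x ≤ l y := by
      by_contra! h
      have := mul_pos (show (0 : ℝ) < ε from hε0) (sub_pos.2 h)
      linarith
    exact (hxmax z hz).trans h2
  refine ⟨x, hxK, ?_, hsub.antisymm hsup⟩
  by_contra hempty
  rw [not_nonempty_iff_eq_empty] at hempty
  apply hBK
  refine Subset.antisymm (fun y hy => (hmem.1 hy).1) (Subset.trans ?_ hsup)
  rw [hempty]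
  exact fun y hy => ⟨hy, empty_subset _⟩

/-! ### The radial map to the boundary of the polar -/

/-- The radial projection of the Gaussian image to the boundary of the polar. -/
noncomputable def radial (q : P.GaussianImage) : E3 :=
  ⟪P.gaussMap q, ((support_nonempty q).some : E3) - P.center⟫⁻¹ • P.gaussMap q

/-- The vertex chosen in `radial` does not matter: all vertices of the support give the Gauss image
the same inner product. -/
lemma exists_radial_eq (q : P.GaussianImage) : ∃ c : ℝ, 0 < c ∧ radial q = c • P.gaussMap q ∧
    ∀ v ∈ support q, ⟪radial q, (v : E3) - P.center⟫ = 1 := by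
  have hmem := (support_nonempty q).some_mem
  have hpos := inner_center_lt (inner_eq_zero_iff_ne (norm_gaussMap q)) hmem
  refine ⟨_, inv_pos.2 hpos, rfl, fun v hv => ?_⟩
  rw [radial, real_inner_smul_left]
  have : ⟪P.gaussMap q, (v : E3) - P.center⟫ =
      ⟪P.gaussMap q, ((support_nonempty q).some : E3) - P.center⟫ := by
    rw [inner_sub_right, inner_sub_right, inner_eq_of_mem_normalCone hv hmem]
  rw [this, inv_mul_cancel₀ hpos.ne']

lemma injective_radial : Function.Injective (radial (P := P)) := by
  intro q q' h
  obtain ⟨c, hc, hq, -⟩ := exists_radial_eq q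
  obtain ⟨c', hc', hq', -⟩ := exists_radial_eq q'
  rw [hq, hq'] at h
  have h1 := congrArg norm h
  rw [norm_smul, norm_smul, norm_gaussMap, norm_gaussMap, Real.norm_of_nonneg hc.le,
    Real.norm_of_nonneg hc'.le, mul_one, mul_one] at h1
  rw [h1] at h
  exact injective_gaussMap (smul_right_injective _ hc'.ne' h)

lemma mem_normalCone_of_mem_tight {x : E3} (hx : x ∈ P.polar) {v : P.vertices}
    (hv : v ∈ tight x) : x ∈ P.normalCone v := by
  intro w
  have h1 := hx w
  have h2 : _ = _ := hv
  rw [inner_sub_right] at h1 h2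
  linarith

lemma radial_mem_polar (q : P.GaussianImage) : radial q ∈ P.polar := by
  obtain ⟨c, hc, hq, h1⟩ := exists_radial_eq q
  obtain ⟨v, hv⟩ := support_nonempty q
  intro w
  have h2 : radial q ∈ P.normalCone v := by
    rw [hq, smul_mem_normalCone_iff hc]; exact hv
  have h3 := h1 v hv
  have h4 := h2 w
  rw [inner_sub_right] at h3 ⊢
  linarith

lemma tight_radial (q : P.GaussianImage) : tight (radial q) = support q := by
  obtain ⟨c, hc, hq, h1⟩ := exists_radial_eq q
  apply Subset.antisymm
  · intro v hv
    have := mem_normalCone_of_mem_tight (radial_mem_polar q) hv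
    rwa [hq, smul_mem_normalCone_iff hc] at this
  · exact h1

lemma exists_eq_radial {x : E3} (hx : x ∈ P.polar) (hT : (tight (P := P) x).Nonempty) :
    ∃ q : P.GaussianImage, radial q = x := by
  obtain ⟨v, hv⟩ := hT
  have hx0 : x ≠ 0 := by
    rintro rfl
    have h1 : _ = _ := hv
    rw [inner_zero_left] at h1
    exact zero_ne_one h1
  have hpos : 0 < ‖x‖ := norm_pos_iff.2 hx0
  obtain ⟨q, hq⟩ := exists_gaussMap_eq (P := P) (x := ‖x‖⁻¹ • x)
    (by rw [norm_smul, norm_inv, norm_norm, inv_mul_cancel₀ hpos.ne'])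
  refine ⟨q, ?_⟩
  obtain ⟨c, hc, hr, h1⟩ := exists_radial_eq q
  have hvq : v ∈ support q := by
    rw [support, mem_ofPred_eq, hq, smul_mem_normalCone_iff (inv_pos.2 hpos)]
    exact mem_normalCone_of_mem_tight hx hv
  have h2 := h1 v hvq
  have h3 : _ = _ := hv
  rw [hr, hq, smul_smul, real_inner_smul_left, h3, mul_one] at h2
  rw [hr, hq, smul_smul, h2, one_smul]

lemma radial_image {T : Set P.vertices} (hT : T.Nonempty) :
    radial '' {q | T ⊆ support q} = polarFace T := by
  apply Subset.antisymm
  · rintro _ ⟨q, hq, rfl⟩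
    exact ⟨radial_mem_polar q, by rw [tight_radial]; exact hq⟩
  · rintro x ⟨hx, hxT⟩
    obtain ⟨q, rfl⟩ := exists_eq_radial hx (hT.mono hxT)
    exact ⟨q, by rwa [tight_radial] at hxT, rfl⟩

lemma exists_support_eq {n : ℕ} (i : P.DualCell n) : ∃ q, support q = vertexSet i := by
  obtain ⟨q, hq1, hq2⟩ := (isEmbeddedBall_vertexSet i).sdiff_nonempty
  exact ⟨q, (hq1.eq_or_ssubset.resolve_right hq2).symm⟩

lemma vertexSet_nonempty {n : ℕ} (i : P.DualCell n) : (vertexSet i).Nonempty := by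
  obtain ⟨q, hq⟩ := exists_support_eq i
  rw [← hq]
  exact support_nonempty q

/-- The radial map takes the closed cells to the proper faces of the polar. -/
lemma isProperFace_iff {B : Set E3} :
    IsProperFace (convexHull ℝ (P.polarVertices : Set E3)) B ↔
      ∃ (n : ℕ) (i : P.DualCell n), B = radial '' {q | vertexSet i ⊆ support q} := by
  rw [← polar_eq_convexHull]
  constructor
  · intro h
    obtain ⟨x, hx, hT, rfl⟩ := exists_polarFace_eq h
    obtain ⟨q, rfl⟩ := exists_eq_radial hx hT
    obtain ⟨n, i, hi⟩ := exists_vertexSet_eq q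
    exact ⟨n, i, by rw [radial_image (vertexSet_nonempty i), tight_radial, hi]⟩
  · rintro ⟨n, i, rfl⟩
    obtain ⟨q, hq⟩ := exists_support_eq i
    rw [radial_image (vertexSet_nonempty i)]
    refine isProperFace_polarFace (vertexSet_nonempty i) ⟨radial q, radial_mem_polar q, ?_⟩
    rw [tight_radial, hq]

end IdealPolyhedron

lemma IsGeodesicArc.arcLength_eq {Q : Type*} [EMetricSpace Q] {s : Set Q} {l : ℝ}
    (h : IsGeodesicArc s l) : arcLength s = ENNReal.ofReal l := by
  let _ : MeasurableSpace Q := borel Q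
  have : BorelSpace Q := ⟨rfl⟩
  obtain ⟨γ, hγ, rfl⟩ := h
  have h1 : Isometry ((Icc (0 : ℝ) l).domRestrict γ) := fun x y => by
    rw [Set.domRestrict_apply, Set.domRestrict_apply, hγ x x.2 y y.2, Subtype.edist_eq, edist_dist,
      Real.dist_eq]
  have h2 : γ '' Icc 0 l = (Icc (0 : ℝ) l).domRestrict γ '' univ := by
    rw [image_univ, range_domRestrict]
  have h3 : (Measure.hausdorffMeasure 1 : Measure (Icc (0 : ℝ) l)) univ =
      Measure.hausdorffMeasure 1 (Icc (0 : ℝ) l) := by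
    rw [← (isometry_subtype_coe (s := Icc (0 : ℝ) l)).hausdorffMeasure_image
      (Or.inl zero_le_one), image_univ, Subtype.range_coe]
  rw [arcLength, h2, h1.hausdorffMeasure_image (Or.inl zero_le_one), h3, hausdorffMeasure_real,
    Real.volume_Icc, sub_zero]

namespace IdealPolyhedron
variable {P : IdealPolyhedron} {F G : P.Face} {v w : P.vertices}

/-! ### Ideal admissibility -/

lemma isHemisphereWithBoundary (v : P.vertices) :
    IsHemisphereWithBoundary {q : P.GaussianImage | {v} ⊆ support q} {q | {v} ⊂ support q} :=
  ⟨v, pieceMap v, norm_vertex v, fun _ hx _ hy => edist_pieceMap hx hy,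
    by rw [← gaussVertex_eq_support, gaussVertex_eq], image_equator v⟩

lemma EdgeWith.isGeodesicArc (h : EdgeWith F G v w) :
    IsGeodesicArc {q : P.GaussianImage | {v, w} ⊆ support q} (exteriorDihedralAngle F G) := by
  have hmem : ∀ t ∈ Icc 0 (exteriorDihedralAngle F G),
      arcPoint (F.normalAt v) (G.normalAt v) t ∈ closedHemisphere (v : E3) := fun t ht => by
    rw [← vertexDual_eq]
    exact h.dualSide_subset (h.dualSide_eq_image ▸ mem_image_of_mem _ ht)
  refine ⟨fun t => pieceMap v (arcPoint (F.normalAt v) (G.normalAt v) t), fun t ht u hu => ?_, ?_⟩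
  · rw [edist_pieceMap (hmem t ht) (hmem u hu), h.angle_arcPoint ht hu]
  · rw [← h.gaussEdge_eq_support, h.gaussEdge_eq, h.dualSide_eq_image, image_image]

/-- Two different hemispheres are disjoint, or meet in a vertex, or meet along an edge. -/
lemma inter_eq_empty_or (hvw : v ≠ w) :
    {q : P.GaussianImage | {v, w} ⊆ support q} = ∅ ∨
    (∃ F : P.Face, {q : P.GaussianImage | {v, w} ⊆ support q} =
      {q | {z | F.Contains z} ⊆ support q}) ∨
    ∃ F G : P.Face, EdgeWith F G v w := by
  refine or_iff_not_imp_left.2 fun hne => or_iff_not_imp_right.2 fun hedge => ?_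
  push Not at hedge
  have key : ∀ q : P.GaussianImage, {v, w} ⊆ support q → ∃ F : P.Face, F.Contains v ∧
      F.Contains w ∧ support q = {z | F.Contains z} := fun q hq => by
    rcases edge_or_face_of_mem (inner_eq_zero_iff_ne (norm_gaussMap q)) hvw (hq (mem_insert _ _))
      (hq (mem_insert_of_mem _ rfl)) with ⟨F, G, h, -⟩ | ⟨F, hv, hw, s, hs, hst⟩
    · exact absurd h (hedge F G)
    · exact ⟨F, hv, hw, Face.support_eq (Face.gaussMap_eq hs hst)⟩
  obtain ⟨q, hq⟩ := nonempty_iff_ne_empty.2 hne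
  obtain ⟨F, hv, hw, -⟩ := key q hq
  refine ⟨F, Set.ext fun q => ⟨fun hq => ?_, fun hq => ?_⟩⟩
  · obtain ⟨G, hv', hw', hG⟩ := key q hq
    have hFG : F = G := by
      by_contra hFG
      exact hedge F G ⟨hFG, hvw, hv, hw, hv', hw'⟩
    exact hFG ▸ hG.ge
  · exact (pair_subset (show v ∈ {z | F.Contains z} from hv) hw).trans hq

/-- The boundary of a hemisphere is the union of its sides. A corner, where the Gauss image is the
normal of a face, lies on the side of an edge of that face. -/
lemma support_ssubset_iff (v : P.vertices) (q : P.GaussianImage) :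
    {v} ⊂ support q ↔ ∃ w, s(v, w) ∈ P.edges ∧ {v, w} ⊆ support q := by
  constructor
  · intro hq
    obtain ⟨w, hw, hwv⟩ := exists_of_ssubset hq
    have hv : v ∈ support q := hq.1 rfl
    rcases edge_or_face_of_mem (inner_eq_zero_iff_ne (norm_gaussMap q)) (Ne.symm hwv) hv hw with
      ⟨F, G, h, -⟩ | ⟨F, hF, -, s, hs, hst⟩
    · exact ⟨w, h.mem_edges, pair_subset hv hw⟩
    · obtain ⟨G, x, -, -, h, -⟩ := Face.exists_two_edges hF
      refine ⟨x, h.mem_edges, ?_⟩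
      rw [Face.support_eq (Face.gaussMap_eq hs hst)]
      exact pair_subset hF h.left_snd
  · rintro ⟨w, hw, hq⟩
    obtain ⟨F, G, h⟩ : ∃ F G, EdgeWith F G v w := by
      obtain ⟨F, G, v', w', h, he⟩ := mem_edges.1 hw
      rcases Sym2.eq_iff.1 he with ⟨rfl, rfl⟩ | ⟨rfl, rfl⟩
      exacts [⟨F, G, h⟩, ⟨F, G, h.swap_vertices⟩]
    refine (ssubset_iff_exists.2 ⟨singleton_subset_iff.2 (mem_insert _ _), w, ?_, ?_⟩).trans_subset hq
    · exact mem_insert_of_mem _ rfl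
    · exact h.vertex_ne.symm

/-- The ends of the edge dual to an edge `e` are dual to the two faces that have `e` as a side. -/
lemma mem_sides_iff_of_ends {e : Sym2 P.vertices} (he : e ∈ P.edges)
    (hq : {q : P.GaussianImage | {v | v ∈ e} ⊂ support q} =
      {q | {v | F.Contains v} ⊆ support q} ∪ {q | {v | G.Contains v} ⊆ support q}) (K : P.Face) :
    e ∈ K.sides ↔ K = F ∨ K = G := by
  have hsides : e ∈ K.sides ↔ {v | v ∈ e} ⊂ {v | K.Contains v} := by
    classical
    rw [Face.sides, Finset.mem_filter, and_iff_right he]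
    constructor
    · intro h
      refine ⟨h, fun h' => ?_⟩
      rcases @eq_or_lt_of_vertexSet_subset P 0 1 K ⟨e, he⟩ h' with h1 | h1
      · cases h1
      · exact absurd h1 one_pos.not_gt
    · exact fun h => h.1
  obtain ⟨q, hK⟩ := @exists_support_eq P 0 K
  have hle : ∀ {F : P.Face}, {v | F.Contains v} ⊆ support q ↔ K = F := fun {F} => by
    rw [hK]
    constructor
    · intro h
      rcases @eq_or_lt_of_vertexSet_subset P 0 0 F K h with h1 | h1
      · cases h1; rfl
      · exact absurd h1 (lt_irrefl _)
    · rintro rfl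
      exact Subset.rfl
  have := Set.ext_iff.1 hq q
  simp only [mem_union, mem_ofPred_eq, hle] at this
  rw [hsides, ← this, hK]
  rfl

/-- A simple cycle of dual edges that is not the boundary of a hemisphere is longer than `2π`. -/
lemma two_pi_lt_sum_weight {k : ℕ} {x : Fin (k + 2) → P.Face} {e : Fin (k + 2) → Sym2 P.vertices}
    (hx : Function.Injective x) (he : Function.Injective e) (hmem : ∀ i, e i ∈ P.edges)
    (hsides : ∀ i K, e i ∈ Face.sides K ↔ K = x i ∨ K = x (i + 1))
    (hcycle : ¬ ∃ v, {q : P.GaussianImage | {v} ⊂ support q} =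
      ⋃ i, {q | {v | v ∈ e i} ⊆ support q}) :
    2 * Real.pi < ∑ i, weight (e i) := by
  classical
  have heven : ∀ K : P.Face, Even (Finset.univ.image e ∩ K.sides).card := by
    intro K
    have h1 : Finset.univ.image e ∩ K.sides =
        (Finset.univ.filter fun i => K = x i ∨ K = x (i + 1)).image e := by
      ext d
      simp only [Finset.mem_inter, Finset.mem_image, Finset.mem_univ, true_and, Finset.mem_filter,
        ← hsides]
      exact ⟨fun ⟨⟨i, hi⟩, hd⟩ => ⟨i, hi ▸ hd, hi⟩, fun ⟨i, hd, hi⟩ => ⟨⟨i, hi⟩, hi ▸ hd⟩⟩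
    rw [h1, Finset.card_image_of_injective _ he]
    by_cases hK : ∃ j, K = x j
    · obtain ⟨j, rfl⟩ := hK
      -- A face that occurs as the vertex `x j` of the cycle has exactly the sides `e j` and `e (j -
      -- 1)` in it; they differ because the cycle has at least two steps.
      have h2 : (Finset.univ.filter fun i => x j = x i ∨ x j = x (i + 1)) = {j, j - 1} := by
        ext i
        simp only [Finset.mem_filter, Finset.mem_univ, true_and, Finset.mem_insert,
          Finset.mem_singleton, hx.eq_iff, eq_sub_iff_add_eq, eq_comm]
      rw [h2, Finset.card_pair]
      · exact even_two
      · intro h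
        rw [eq_sub_iff_add_eq, add_eq_left] at h
        exact one_ne_zero h
    · push Not at hK
      simp [hK]
  obtain ⟨A, hA⟩ := exists_cut_eq (C := Finset.univ.image e) (by
    intro d hd
    obtain ⟨i, -, rfl⟩ := Finset.mem_image.1 hd
    exact hmem i) heven
  -- An empty side of the cut would leave the cycle without edges, and a side with the single vertex
  -- `v` would make it the boundary of the 2-cell of `v`. The same applies to the complement, so
  -- both have at least two vertices.
  have hne : ∀ A : Set P.vertices, Finset.univ.image e = cut A → A.Nontrivial := by
    intro A hA
    rw [← not_subsingleton_iff]
    intro hsub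
    rcases hsub.eq_empty_or_singleton with rfl | ⟨v, rfl⟩
    · have h1 : e 0 ∈ cut (∅ : Set P.vertices) :=
        hA ▸ Finset.mem_image_of_mem _ (Finset.mem_univ _)
      obtain ⟨-, a, b, ha, -⟩ := mem_cut.1 h1
      exact ha
    · refine hcycle ⟨v, Set.ext fun q => ?_⟩
      simp only [mem_iUnion, mem_ofPred_eq, support_ssubset_iff]
      have hpair : ∀ w, {z | z ∈ s(v, w)} = {v, w} := fun w => Set.ext fun z => Sym2.mem_iff
      constructor
      · rintro ⟨w, hw, hq⟩
        obtain ⟨F, G, v', w', h, he'⟩ := mem_edges.1 hw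
        have hvw : v ≠ w := by
          rintro rfl
          exact h.vertex_ne (Sym2.mk_isDiag_iff.1 (he' ▸ Sym2.mk_isDiag_iff.2 rfl))
        have h1 : s(v, w) ∈ cut {v} := mk_mem_cut.2 ⟨hw, iff_of_true rfl hvw.symm⟩
        rw [← hA] at h1
        obtain ⟨i, -, hi⟩ := Finset.mem_image.1 h1
        exact ⟨i, by rwa [hi, hpair]⟩
      · rintro ⟨i, hq⟩
        have h1 : e i ∈ cut {v} := hA ▸ Finset.mem_image_of_mem _ (Finset.mem_univ _)
        obtain ⟨h2, a, b, rfl, -, hab⟩ := mem_cut.1 h1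
        rw [hab] at h2 hq
        exact ⟨b, h2, hpair b ▸ hq⟩
  rw [← Finset.sum_image (g := e) (f := weight) he.injOn, hA]
  exact two_pi_lt_cut_sum (hne A hA) (hne Aᶜ (hA.trans (cut_compl A).symm))

end IdealPolyhedron

open Topology.CWComplex in
/-- The Gaussian image is ideally admissible, by way of a cell structure whose cells are indexed by
the faces, edges and vertices of the polyhedron. -/
lemma IdealPolyhedron.isIdeallyAdmissible_of_cells {P : IdealPolyhedron}
    [CWComplex (univ : Set P.GaussianImage)]
    (e : ∀ n, cell (univ : Set P.GaussianImage) n ≃ P.DualCell n)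
    (hc : ∀ n i, closedCell n i = {q | vertexSet (e n i) ⊆ support q})
    (hf : ∀ n i, cellFrontier n i = {q | vertexSet (e n i) ⊂ support q}) :
    IsIdeallyAdmissible P.GaussianImage := by
  obtain ⟨e₀, hc₀⟩ : ∃ e₀ : cell (univ : Set P.GaussianImage) 0 ≃ P.Face, ∀ i,
      closedCell 0 i = {q | {v | (e₀ i).Contains v} ⊆ support q} := ⟨e 0, hc 0⟩
  obtain ⟨e₁, hc₁, hf₁⟩ : ∃ e₁ : cell (univ : Set P.GaussianImage) 1 ≃ {d // d ∈ P.edges},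
      (∀ i, closedCell 1 i = {q | {v | v ∈ (e₁ i).1} ⊆ support q}) ∧
      ∀ i, cellFrontier 1 i = {q | {v | v ∈ (e₁ i).1} ⊂ support q} := ⟨e 1, hc 1, hf 1⟩
  obtain ⟨e₂, hc₂, hf₂⟩ : ∃ e₂ : cell (univ : Set P.GaussianImage) 2 ≃ P.vertices,
      (∀ i, closedCell 2 i = {q | {e₂ i} ⊆ support q}) ∧
      ∀ i, cellFrontier 2 i = {q | {e₂ i} ⊂ support q} := ⟨e 2, hc 2, hf 2⟩
  have hpair : ∀ v w : P.vertices, {z | z ∈ s(v, w)} = {v, w} :=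
    fun v w => Set.ext fun z => Sym2.mem_iff
  exact
  { edist_ne_top := edist_ne_top
    homeomorph_sphere := ⟨gaussHomeo P⟩
    dim_le_two := fun n hn => by
      obtain ⟨m, rfl⟩ := Nat.exists_eq_add_of_le' hn
      exact ⟨fun i => (e _ i).elim⟩
    combinatorial := by
      -- The radial map is injective, so taking images reflects inclusions; the images of the closed
      -- cells are exactly the proper faces of the polar.
      let f : ClosedCells P.GaussianImage →
          {B : Set E3 // IsProperFace (convexHull ℝ (P.polarVertices : Set E3)) B} :=
        fun c => ⟨radial '' c.1, by
          obtain ⟨n, i, hi⟩ := c.2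
          exact isProperFace_iff.2 ⟨n, e n i, by rw [hi, hc]⟩⟩
      have hle : ∀ {c d}, f c ≤ f d ↔ c ≤ d := image_subset_image_iff injective_radial
      refine ⟨P.polarVertices, affineSpan_polarVertices,
        ⟨Equiv.ofBijective f ⟨fun c d hcd => ?_, ?_⟩, hle⟩⟩
      · exact le_antisymm (hle.1 hcd.le) (hle.1 hcd.ge)
      · rintro ⟨B, hB⟩
        obtain ⟨n, i, rfl⟩ := isProperFace_iff.1 hB
        exact ⟨⟨closedCell n ((e n).symm i), n, _, rfl⟩,
          Subtype.ext (by simp only [f, hc, Equiv.apply_symm_apply])⟩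
    hemisphere := fun i => by
      rw [hc₂, hf₂]
      exact isHemisphereWithBoundary (e₂ i)
    gluing := fun i j hij => by
      have hinter : closedCell 2 i ∩ closedCell 2 j = {q | {e₂ i, e₂ j} ⊆ support q} := by
        rw [hc₂, hc₂]
        ext q
        exact union_subset_iff.symm
      rw [hinter]
      refine (inter_eq_empty_or (e₂.injective.ne hij)).imp_right (Or.imp ?_ ?_)
      · rintro ⟨F, hF⟩
        exact ⟨e₀.symm F, by rw [hF, hc₀, Equiv.apply_symm_apply]⟩
      · rintro ⟨F, G, h⟩
        have hedge : closedCell 1 (e₁.symm ⟨_, h.mem_edges⟩) =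
            {q | {e₂ i, e₂ j} ⊆ support q} := by
          rw [hc₁, Equiv.apply_symm_apply, hpair]
        refine ⟨_, hedge.symm, ?_, _, h.exterior_pos, h.exterior_lt_pi, ?_⟩
        · rw [hedge, hf₂, hf₂]
          exact fun q hq => ⟨(support_ssubset_iff _ q).2 ⟨_, h.mem_edges, hq⟩,
            (support_ssubset_iff _ q).2 ⟨_, h.swap_vertices.mem_edges, pair_comm (e₂ i) _ ▸ hq⟩⟩
        · rw [hedge]
          exact h.isGeodesicArc
    cycle := fun k x d hx hd => by
      have hlen : ∀ m, arcLength (closedCell 1 (d m)) = ENNReal.ofReal (weight (e₁ (d m)).1) := by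
        intro m
        obtain ⟨F, G, v, w, h, hvw⟩ := mem_edges.1 (e₁ (d m)).2
        rw [hc₁, hvw, hpair, h.isGeodesicArc.arcLength_eq, h.weight_eq]
      simp only [hlen]
      rw [← ENNReal.ofReal_sum_of_nonneg fun m _ => (weight_pos (e₁ (d m)).2).le,
        ENNReal.ofReal_lt_ofReal_iff_of_nonneg Real.two_pi_pos.le]
      refine two_pi_lt_sum_weight (x := fun m => e₀ (x m)) (e₀.injective.comp hx.vertices_injective)
        (Subtype.val_injective.comp (e₁.injective.comp hx.edges_injective))
        (fun m => (e₁ (d m)).2) (fun m => mem_sides_iff_of_ends (e₁ (d m)).2 ?_) ?_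
      · have := hx.endpoints m
        rwa [hf₁, hc₀, hc₀] at this
      · rintro ⟨v, hv⟩
        refine hd ⟨e₂.symm v, ?_⟩
        simp only [hf₂, hc₁, Equiv.apply_symm_apply]
        exact hv }

open Topology.CWComplex in
/-- The Gaussian image of a convex ideal hyperbolic polyhedron is ideally admissible, by way of
its cell decomposition into the images of the faces, edges and vertices of the polyhedron. -/
theorem theorem4p5 (P : IdealPolyhedron) :
    (∀ v : P.vertices, ∃ a : E3, ‖a‖ = 1 ∧ P.vertexDual v = closedHemisphere a) ∧
    (∀ (v : P.vertices) (F G : P.Face), IdealPolyhedron.IsEdgeAt F G v →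
      IdealPolyhedron.dualSide F G v ⊆ P.vertexDual v ∧
      angle (F.normalAt v) (G.normalAt v) = IdealPolyhedron.exteriorDihedralAngle F G ∧
      0 < IdealPolyhedron.exteriorDihedralAngle F G ∧
      IdealPolyhedron.exteriorDihedralAngle F G < Real.pi) ∧
    ∃ _ : CWComplex (univ : Set P.GaussianImage),
      IsIdeallyAdmissible P.GaussianImage ∧
      (∀ c : Set P.GaussianImage,
        ((∃ i : cell (univ : Set P.GaussianImage) 2, c = closedCell 2 i) ↔
          ∃ v : P.vertices, c = P.gaussVertex v) ∧
        ((∃ i : cell (univ : Set P.GaussianImage) 1, c = closedCell 1 i) ↔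
          ∃ F G : P.Face, IdealPolyhedron.IsEdge F G ∧
            c = IdealPolyhedron.gaussEdge F G) ∧
        ((∃ i : cell (univ : Set P.GaussianImage) 0, c = closedCell 0 i) ↔
          ∃ F : P.Face, c = IdealPolyhedron.gaussFace F)) := by
  refine ⟨fun v => ⟨v, IdealPolyhedron.norm_vertex v, IdealPolyhedron.vertexDual_eq v⟩,
    fun v F G h => ?_, ?_⟩
  · obtain ⟨w, h⟩ := IdealPolyhedron.isEdgeAt_iff.1 h
    exact ⟨h.dualSide_subset, h.angle_eq, h.exterior_pos, h.exterior_lt_pi⟩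
  obtain ⟨inst, e, he⟩ := P.exists_gaussComplex
  have hc : ∀ n i, closedCell n i = _ := fun n i => (he n i).1
  refine ⟨inst, IdealPolyhedron.isIdeallyAdmissible_of_cells e hc fun n i => (he n i).2,
    fun c => ⟨?_, ?_, ?_⟩⟩
  · simp only [hc, IdealPolyhedron.gaussVertex_eq_support]
    exact (e 2).exists_congr_left.trans (by simp only [Equiv.apply_symm_apply]; rfl)
  · simp only [hc]
    refine (e 1).exists_congr_left.trans ?_
    simp only [Equiv.apply_symm_apply]
    constructor
    · rintro ⟨⟨d, hd⟩, rfl⟩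
      obtain ⟨F, G, v, w, h, rfl⟩ := IdealPolyhedron.mem_edges.1 hd
      exact ⟨F, G, ⟨v, h.isEdgeAt⟩, by
        rw [h.gaussEdge_eq_support, IdealPolyhedron.vertexSet_mk]⟩
    · rintro ⟨F, G, ⟨v, h⟩, rfl⟩
      obtain ⟨w, h⟩ := IdealPolyhedron.isEdgeAt_iff.1 h
      exact ⟨⟨s(v, w), h.mem_edges⟩, by
        rw [h.gaussEdge_eq_support, IdealPolyhedron.vertexSet_mk]⟩
  · simp only [hc, IdealPolyhedron.gaussFace_eq_support]
    exact (e 0).exists_congr_left.trans (by simp only [Equiv.apply_symm_apply]; rfl)
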